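/- **Setting.** Let $d\ge 1$ and consider a hyperbolic system $\partial_t w+\mathbf A\cdot\nabla w=0$ in $\mathbb R^d$, where $\mathbf A=(A_1,\dots,A_d)$ are constant real $n\times n$ matrices such that $\mathbf A\cdot\xi=\sum_i\xi_iA_i$ is diagonalizable over $\mathbb R$ for each $\xi\in\mathbb R^d$. If $B=S\,\mathrm{diag}(\lambda_i)\,S^{-1}$, put $|B|=S\,\mathrm{diag}(|\lambda_i|)\,S^{-1}$. Let $\mathbb R^d$ be covered by a conforming locally finite simplicial mesh with node set $\mathcal N$ (node $j$ has radius-vector $\mathbf r_j$) that is translationally invariant, i.e. invariant under the translation by each mesh edge. The control volume $K_j$ consists of the points whose barycentric coordinate with respect to $\mathbf r_j$, in some mesh simplex having $j$ as a vertex, is the largest of all the barycentric coordinates in this simplex. $N(j)$ is the set of nodes $k\neq j$ for which $\partial K_j\cap\partial K_k$ has nonzero $(d-1)$-dimensional measure, and $\mathbf n_{jk}=\int_{\partial K_j\cap\partial K_k}\mathbf n\,dS$, where $\mathbf n$ is the unit normal pointing into $K_k$. $P_p$ is the space of polynomials of degree at most $p$ in $d$ variables, and $\Pi$ maps a function to its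 values at the nodes. Let $\mathbf G$ be a linear operator on mesh functions $\mathcal N\to\mathbb C^n$, with a finite stencil at each node and real matrix coefficients, that approximates the gradient 2-exactly: $\mathbf G\Pi f=\Pi\nabla f$ for $f\in(P_2)^n$. Put $$\mathcal R_{jk}[u]=u_j+\tfrac12(\mathbf r_k-\mathbf r_j)\cdot(\mathbf Gu)_j,$$ $$F_{jk}[u]=\tfrac12\bigl(\mathbf A\cdot\mathbf n_{jk}+|\mathbf A\cdot\mathbf n_{jk}|\bigr)\mathcal R_{jk}[u]+\tfrac12\bigl(\mathbf A\cdot\mathbf n_{jk}-|\mathbf A\cdot\mathbf n_{jk}|\bigr)\mathcal R_{kj}[u],$$ and assume that the fluxes $F_{jk}$ are invariant under the translations that preserve the mesh. For a semidiscrete scheme $M_j[du/dt]+L_j[u]=0$, $j\in\mathcal N$, the truncation error on $f$ is $\epsilon_j(f)=-M_j[\Pi(\mathbf A\cdot\nabla f)]+L_j[\Pi f]$; the scheme is $p$-exact if $\epsilon_j(f)=0$ for all $f\in(P_p)^n$ and $j\in\mathcal N$. In each scheme below $L_j[u]=|K_j|^{-1}\sum_{k\in N(j)}F_{jk}[u]$.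 **Statement.** For every $d\ge1$ the flux correction method is 3-exact on a translationally invariant simplicial mesh. Precisely: 1. (Extended Galerkin formula.) Let $M_j=|K_j|^{-1}\sum_{k\in N(j)}v_{jk}s_{jk}$ with $v_{jk}=\frac1{2d}(\mathbf r_k-\mathbf r_j)\cdot\mathbf n_{jk}$ and any linear functionals $s_{jk}$ with finite stencils and real matrix coefficients such that, for each $p\in(P_2)^n$, $$s_{jk}[\Pi p]=p(\mathbf r_j)-\tfrac{d}{4(d+2)}\bigl((\mathbf r_k-\mathbf r_j)\cdot\nabla\bigr)^2p .$$ Then the scheme is 3-exact. 2. (Divergence formulation.) Let $D_i$, $D_{ii}$ be linear operators on mesh functions, with finite stencils and real matrix coefficients, that are 2-exact approximations of $\partial_{x_i}$, $\partial_{x_i}^2$: $D_i\Pi f=\Pi\,\partial_{x_i}f$ and $D_{ii}\Pi f=\Pi\,\partial_{x_i}^2f$ for $f\in(P_2)^n$. Let $\mathbf v_j[u]$ be the vector mesh function with the components $$(\mathbf v_j[u])_{l,i}=\tfrac1d\Bigl(\delta\,u_l-\tfrac{\delta^2}{2}(D_iu)_l+\tfrac{\delta^3}{6}(D_{ii}u)_l\Bigr),\qquad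 \delta=(\mathbf r_l-\mathbf r_j)_i,\quad 1\le i\le d,$$ and let $M_j[u]=|K_j|^{-1}\sum_{k\in N(j)}\phi_{jk}[\mathbf v_j[u]]$, $\phi_{jk}[\mathbf v]=\mathbf n_{jk}\cdot\frac12(\mathcal R_{jk}[\mathbf v]+\mathcal R_{kj}[\mathbf v])$, where $\mathcal R_{jk}$ acts on each component of $\mathbf v$ and the fluxes $\phi_{jk}$ are invariant under the translations that preserve the mesh. Then the scheme is 3-exact. 3. (Steady method.) Let $M_j[u]=u_j$. Then $\epsilon_j(f)=0$ for all $j\in\mathcal N$ and all $f\in(P_3)^n$ such that $\mathbf A\cdot\nabla f\equiv0$. -/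

import Mathlib

open scoped MeasureTheory

noncomputable section

namespace FluxCorrection

/-! ### Simplicial meshes and barycentric control volumes -/

/-- A conforming simplicial mesh of `ℝ^d`: a locally finite geometric simplicial complex whose
`d`-dimensional simplices (those with `d + 1` vertices) cover the space, every simplex being a
face of a `d`-dimensional one. The field `faces` holds the vertex sets of simplices of all
dimensions; conformity is the field `inter_subset_convexHull`. -/
structure SimplicialMesh (d : ℕ) extends
    Geometry.SimplicialComplex ℝ (EuclideanSpace ℝ (Fin d)) where
  locallyFinite : LocallyFinite fun s : faces => convexHull ℝ (s.1 : Set (EuclideanSpace ℝ (Fin d)))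
  covers : ∀ x : EuclideanSpace ℝ (Fin d),
    ∃ e ∈ faces, e.card = d + 1 ∧ x ∈ convexHull ℝ (e : Set (EuclideanSpace ℝ (Fin d)))
  isPure : ∀ s ∈ faces, ∃ e ∈ faces, e.card = d + 1 ∧ s ⊆ e

/-- The outer unit normal to `K` at a point `x` near which `K` coincides with a half-space
`{y | ⟪ν, y - x⟫ ≤ 0}`, `‖ν‖ = 1`; such a `ν` is unique. At other points (for a polyhedral `K`,
a null set of the boundary) the value is `0`. -/
def outerUnitNormal {E : Type*} [NormedAddCommGroup E] [InnerProductSpace ℝ E]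
    (K : Set E) (x : E) : E :=
  open Classical in
  if h : ∃ ν : E, ‖ν‖ = 1 ∧ ∀ᶠ y in nhds x, (y ∈ K ↔ inner ℝ ν (y - x) ≤ 0) then h.choose else 0

namespace SimplicialMesh

variable {d : ℕ} (T : SimplicialMesh d)

/-- Mesh nodes; a node is identified with its radius-vector. -/
abbrev Node : Type := {x : EuclideanSpace ℝ (Fin d) // x ∈ T.toSimplicialComplex.vertices}

/-- The mesh elements: the (vertex sets of) `d`-dimensional simplices. -/
def elements : Set (Finset (EuclideanSpace ℝ (Fin d))) := {e ∈ T.faces | e.card = d + 1}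

/-- The mesh is invariant under the translation by `τ`. -/
def IsTranslation (τ : EuclideanSpace ℝ (Fin d)) : Prop :=
  ∀ s : Finset (EuclideanSpace ℝ (Fin d)), s.map (addRightEmbedding τ) ∈ T.faces ↔ s ∈ T.faces

/-- A translationally invariant mesh: it is invariant under the translation by each mesh edge. -/
def IsTI : Prop :=
  ∀ j k : EuclideanSpace ℝ (Fin d), j ≠ k → ({j, k} : Finset _) ∈ T.faces → T.IsTranslation (k - j)

/-- The image of a node under a translation that preserves the mesh. -/
def translate {τ : EuclideanSpace ℝ (Fin d)} (hτ : T.IsTranslation τ) (j : T.Node) : T.Node :=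
  ⟨j.1 + τ, by
    have h := (hτ {j.1}).2 j.2
    rwa [Finset.map_singleton] at h⟩

/-- The barycentric control volume `K_j`: the points whose barycentric coordinate with respect to
the node `j` is the largest one, in some element that contains `j`. -/
def controlVolume (j : T.Node) : Set (EuclideanSpace ℝ (Fin d)) :=
  {x | ∃ e ∈ T.elements, j.1 ∈ e ∧ ∃ α : EuclideanSpace ℝ (Fin d) → ℝ,
    (∀ l ∈ e, 0 ≤ α l) ∧ ∑ l ∈ e, α l = 1 ∧ ∑ l ∈ e, α l • l = x ∧ ∀ l ∈ e, α l ≤ α j.1}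

/-- `∂K_j ∩ ∂K_k`. -/
def interface (j k : T.Node) : Set (EuclideanSpace ℝ (Fin d)) :=
  frontier (T.controlVolume j) ∩ frontier (T.controlVolume k)

/-- `N(j)`: the nodes `k ≠ j` such that `∂K_j ∩ ∂K_k` has nonzero `(d-1)`-dimensional measure. -/
def neighbors (j : T.Node) : Set T.Node := {k | k ≠ j ∧ μHE[d - 1] (T.interface j k) ≠ 0}

/-- `n_jk`: the integral of the unit normal, oriented from `K_j` to `K_k`, over `∂K_j ∩ ∂K_k`. -/
def faceNormal (j k : T.Node) : EuclideanSpace ℝ (Fin d) :=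
  ∫ x in T.interface j k, outerUnitNormal (T.controlVolume j) x ∂μHE[d - 1]

/-- `|K_j|`. -/
def cellVolume (j : T.Node) : ℝ := MeasureTheory.volume.real (T.controlVolume j)

theorem finite_faces_of_mem (j : EuclideanSpace ℝ (Fin d)) : {s ∈ T.faces | j ∈ s}.Finite := by
  have h := T.locallyFinite.point_finite j
  refine (h.image (fun s => s.1)).subset ?_
  rintro s ⟨hs, hj⟩
  exact ⟨⟨s, hs⟩, subset_convexHull ℝ _ hj, rfl⟩

theorem isClosed_controlVolume (j : T.Node) : IsClosed (T.controlVolume j) := by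
  classical
  have hfin : {e ∈ T.elements | j.1 ∈ e}.Finite :=
    (T.finite_faces_of_mem j.1).subset fun e he => ⟨he.1.1, he.2⟩
  have key : T.controlVolume j = ⋃ e ∈ {e ∈ T.elements | j.1 ∈ e},
      (fun β : e → ℝ => ∑ l : e, β l • l.1) ''
        (stdSimplex ℝ e ∩ {β | ∀ (hj : j.1 ∈ e) (l : e), β l ≤ β ⟨j.1, hj⟩}) := by
    ext x
    simp only [controlVolume, Set.mem_iUnion, Set.mem_image, Set.mem_ofPred_eq, Set.mem_inter_iff]
    constructor
    · rintro ⟨e, he, hj, α, h0, h1, hx, hm⟩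
      refine ⟨e, ⟨he, hj⟩, fun l => α l.1, ⟨⟨fun l => h0 _ l.2, ?_⟩, fun _ l => hm _ l.2⟩, ?_⟩
      · rw [← h1]; exact Finset.sum_coe_sort e α
      · rw [← hx]; exact Finset.sum_coe_sort e (fun l => α l • l)
    · rintro ⟨e, ⟨he, hj⟩, β, ⟨⟨h0, h1⟩, hm⟩, hx⟩
      refine ⟨e, he, hj, fun l => if h : l ∈ e then β ⟨l, h⟩ else 0, ?_, ?_, ?_, ?_⟩
      · intro l hl; simpa [hl] using h0 ⟨l, hl⟩
      · rw [← h1, ← Finset.sum_coe_sort e]; simp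
      · rw [← hx, ← Finset.sum_coe_sort e]; simp
      · intro l hl; simpa [hl, hj] using hm hj ⟨l, hl⟩
  rw [key]
  refine hfin.isClosed_biUnion fun e _ => ?_
  refine (IsCompact.image ?_ (by fun_prop)).isClosed
  refine (isCompact_stdSimplex ℝ e).inter_right ?_
  simp only [Set.ofPred_forall]
  exact isClosed_iInter fun hj => isClosed_iInter fun l =>
    isClosed_le (continuous_apply l) (continuous_apply _)

theorem controlVolume_pos_mem {j : T.Node} {e e' : Finset (EuclideanSpace ℝ (Fin d))}
    (he : e ∈ T.faces) (he' : e' ∈ T.faces) {x : EuclideanSpace ℝ (Fin d)}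
    {α : EuclideanSpace ℝ (Fin d) → ℝ} (hj : j.1 ∈ e)
    (h0 : ∀ l ∈ e, 0 ≤ α l) (h1 : ∑ l ∈ e, α l = 1) (hx : ∑ l ∈ e, α l • l = x)
    (hm : ∀ l ∈ e, α l ≤ α j.1) (hx' : x ∈ convexHull ℝ (e' : Set (EuclideanSpace ℝ (Fin d)))) :
    j.1 ∈ e' := by
  classical
  have hxe : x ∈ convexHull ℝ (e : Set (EuclideanSpace ℝ (Fin d))) :=
    Finset.mem_convexHull'.2 ⟨α, h0, h1, hx⟩
  have hxi := T.inter_subset_convexHull he he' ⟨hxe, hx'⟩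
  rw [← Finset.coe_inter, Finset.mem_convexHull'] at hxi
  obtain ⟨γ, g0, g1, gx⟩ := hxi
  by_contra hne
  have hind := T.indep he
  rw [affineIndependent_iff] at hind
  have hsub : e ∩ e' ⊆ e := Finset.inter_subset_left
  let w : EuclideanSpace ℝ (Fin d) → ℝ := fun l => α l - if l ∈ e ∩ e' then γ l else 0
  have hw := hind Finset.univ (fun l : e => w l.1) ?_ ?_ ⟨j.1, hj⟩ (Finset.mem_univ _)
  · have hαj : α j.1 = 0 := by simpa [w, hne] using hw
    have hall : ∀ l ∈ e, α l = 0 := fun l hl => le_antisymm (hαj ▸ hm l hl) (h0 l hl)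
    rw [Finset.sum_eq_zero hall] at h1
    exact zero_ne_one h1
  · rw [Finset.sum_coe_sort e w]
    simp only [w, Finset.sum_sub_distrib, h1]
    rw [← Finset.sum_filter, Finset.filter_mem_eq_inter, Finset.inter_eq_right.2 hsub, g1, sub_self]
  · rw [Finset.sum_coe_sort e (fun l => w l • l)]
    simp only [w, sub_smul, Finset.sum_sub_distrib, hx, ite_smul, zero_smul]
    rw [← Finset.sum_filter, Finset.filter_mem_eq_inter, Finset.inter_eq_right.2 hsub, gx, sub_self]

theorem finite_neighbors (j : T.Node) : (T.neighbors j).Finite := by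
  classical
  have hf : (⋃ s ∈ {s ∈ T.faces | j.1 ∈ s}, (s : Set (EuclideanSpace ℝ (Fin d)))).Finite :=
    (T.finite_faces_of_mem j.1).biUnion fun s _ => s.finite_toSet
  refine Set.Finite.of_finite_image (f := Subtype.val) (hf.subset ?_) Subtype.val_injective.injOn
  rintro _ ⟨k, ⟨-, hk⟩, rfl⟩
  have hne : (T.interface j k).Nonempty := by
    rw [Set.nonempty_iff_ne_empty]
    intro h
    exact hk (by rw [h]; exact MeasureTheory.measure_empty)
  obtain ⟨x, hxj, hxk⟩ := hne
  obtain ⟨e, he, hj, α, h0, h1, hx, hm⟩ := (T.isClosed_controlVolume j).frontier_subset hxj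
  obtain ⟨e', he', hk', β, b0, b1, bx, -⟩ := (T.isClosed_controlVolume k).frontier_subset hxk
  have hje : j.1 ∈ e' := T.controlVolume_pos_mem he.1 he'.1 hj h0 h1 hx hm
    (Finset.mem_convexHull'.2 ⟨β, b0, b1, bx⟩)
  exact Set.mem_biUnion (x := e') ⟨he'.1, hje⟩ hk'

/-- `N(j)` as a finite set. -/
def neighborFinset (j : T.Node) : Finset T.Node := (T.finite_neighbors j).toFinset

end SimplicialMesh

/-! ### Hyperbolic systems -/

/-- `A · v = ∑ i, v_i A_i`. -/
def dotMatrix {d n : ℕ} (A : Fin d → Matrix (Fin n) (Fin n) ℝ) (v : EuclideanSpace ℝ (Fin d)) :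
    Matrix (Fin n) (Fin n) ℝ := ∑ i, v i • A i

/-- `B = S Λ S⁻¹` with an invertible real `S` and a real diagonal `Λ`. -/
def Diagonalizes {n : ℕ} (B S : Matrix (Fin n) (Fin n) ℝ) (Λ : Fin n → ℝ) : Prop :=
  IsUnit S.det ∧ B = S * Matrix.diagonal Λ * S⁻¹

/-- The system `∂w/∂t + A · ∇w = 0` is hyperbolic: every `A · ξ` is diagonalizable over `ℝ`. -/
def IsHyperbolic {d n : ℕ} (A : Fin d → Matrix (Fin n) (Fin n) ℝ) : Prop :=
  ∀ ξ : EuclideanSpace ℝ (Fin d), ∃ S Λ, Diagonalizes (dotMatrix A ξ) S Λ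

/-- `|B| = S |Λ| S⁻¹` for `B = S Λ S⁻¹` diagonalizable over `ℝ` (and `0` for other `B`). The result
does not depend on the choice of `S` and `Λ`, see `matrixAbs_eq`. -/
def matrixAbs {n : ℕ} (B : Matrix (Fin n) (Fin n) ℝ) : Matrix (Fin n) (Fin n) ℝ :=
  open Classical in
  if h : ∃ p : Matrix (Fin n) (Fin n) ℝ × (Fin n → ℝ), Diagonalizes B p.1 p.2 then
    h.choose.1 * Matrix.diagonal (fun i => |h.choose.2 i|) * h.choose.1⁻¹
  else 0

theorem Diagonalizes.abs_unique {n : ℕ} {B S R : Matrix (Fin n) (Fin n) ℝ} {Λ M : Fin n → ℝ}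
    (h₁ : Diagonalizes B S Λ) (h₂ : Diagonalizes B R M) :
    S * Matrix.diagonal (fun i => |Λ i|) * S⁻¹ = R * Matrix.diagonal (fun i => |M i|) * R⁻¹ := by
  obtain ⟨hS, hB⟩ := h₁
  obtain ⟨hR, hB'⟩ := h₂
  have e : R⁻¹ * S * Matrix.diagonal Λ = Matrix.diagonal M * (R⁻¹ * S) := by
    have h := hB.symm.trans hB'
    calc R⁻¹ * S * Matrix.diagonal Λ
        = R⁻¹ * (S * Matrix.diagonal Λ * S⁻¹) * S := by
          simp only [Matrix.mul_assoc, Matrix.nonsing_inv_mul S hS, Matrix.mul_one]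
      _ = R⁻¹ * (R * Matrix.diagonal M * R⁻¹) * S := by rw [h]
      _ = Matrix.diagonal M * (R⁻¹ * S) := by
          simp only [← Matrix.mul_assoc, Matrix.nonsing_inv_mul R hR, Matrix.one_mul]
  have e' : R⁻¹ * S * Matrix.diagonal (fun i => |Λ i|)
      = Matrix.diagonal (fun i => |M i|) * (R⁻¹ * S) := by
    ext i k
    have h := congrFun (congrFun e i) k
    rw [Matrix.mul_diagonal, Matrix.diagonal_mul] at h ⊢
    by_cases h0 : (R⁻¹ * S) i k = 0
    · simp [h0]
    · have : Λ k = M i := mul_left_cancel₀ h0 (by rw [h, mul_comm])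
      rw [this, mul_comm]
  calc S * Matrix.diagonal (fun i => |Λ i|) * S⁻¹
      = R * (R⁻¹ * S * Matrix.diagonal (fun i => |Λ i|)) * S⁻¹ := by
        simp only [← Matrix.mul_assoc, Matrix.mul_nonsing_inv R hR, Matrix.one_mul]
    _ = R * (Matrix.diagonal (fun i => |M i|) * (R⁻¹ * S)) * S⁻¹ := by rw [e']
    _ = R * Matrix.diagonal (fun i => |M i|) * R⁻¹ := by
        simp only [Matrix.mul_assoc, Matrix.mul_nonsing_inv S hS, Matrix.mul_one]

theorem matrixAbs_eq {n : ℕ} {B S : Matrix (Fin n) (Fin n) ℝ} {Λ : Fin n → ℝ}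
    (h : Diagonalizes B S Λ) : matrixAbs B = S * Matrix.diagonal (fun i => |Λ i|) * S⁻¹ := by
  have hex : ∃ p : Matrix (Fin n) (Fin n) ℝ × (Fin n → ℝ), Diagonalizes B p.1 p.2 := ⟨(S, Λ), h⟩
  rw [matrixAbs, dif_pos hex]
  exact hex.choose_spec.abs_unique h

/-! ### Vector-valued polynomials -/

/-- `(P)^n`: vectors of polynomials of `d` variables. -/
abbrev VecPoly (d n : ℕ) : Type := Fin n → MvPolynomial (Fin d) ℂ

/-- `f ∈ (P_p)^n`. -/
def VecPoly.DegLE {d n : ℕ} (p : ℕ) (f : VecPoly d n) : Prop := ∀ a, (f a).totalDegree ≤ p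

/-- The value of a vector of polynomials at a point. -/
def VecPoly.evalAt {d n : ℕ} (f : VecPoly d n) (x : EuclideanSpace ℝ (Fin d)) : Fin n → ℂ :=
  fun a => MvPolynomial.eval (fun i => (x i : ℂ)) (f a)

/-- The partial derivative `∂f/∂x_i`. -/
def VecPoly.partialDeriv {d n : ℕ} (i : Fin d) (f : VecPoly d n) : VecPoly d n :=
  fun a => MvPolynomial.pderiv i (f a)

/-- `A · ∇f = ∑ i, A_i ∂f/∂x_i`. -/
def VecPoly.advect {d n : ℕ} (A : Fin d → Matrix (Fin n) (Fin n) ℝ) (f : VecPoly d n) :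
    VecPoly d n :=
  fun a => ∑ i, ∑ b, MvPolynomial.C (A i a b : ℂ) * f.partialDeriv i b

/-- `(v · ∇)² f`. -/
def VecPoly.secondDeriv {d n : ℕ} (v : EuclideanSpace ℝ (Fin d)) (f : VecPoly d n) : VecPoly d n :=
  fun a => ∑ i, ∑ l, MvPolynomial.C ((v i * v l : ℝ) : ℂ) * (f.partialDeriv l).partialDeriv i a

namespace SimplicialMesh

variable {d : ℕ} (T : SimplicialMesh d)

/-! ### Mesh functions, stencils and schemes -/

/-- Mesh functions: elements of `(ℂ^n)^𝒩`. -/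
abbrev MeshFun (n : ℕ) : Type := T.Node → Fin n → ℂ

/-- The pointwise mapping `Π`. -/
def sample {n : ℕ} (f : VecPoly d n) : T.MeshFun n := fun j => f.evalAt j.1

/-- Real `n × n` coefficients on finitely many nodes. -/
abbrev Stencil (n : ℕ) : Type := T.Node →₀ Matrix (Fin n) (Fin n) ℝ

/-- The functional `u ↦ ∑ k, c_k u_k` defined by the coefficients `c`. -/
def functional {n : ℕ} (c : T.Stencil n) : T.MeshFun n →ₗ[ℂ] (Fin n → ℂ) :=
  c.sum fun k C => (C.map Complex.ofReal).mulVecLin ∘ₗ LinearMap.proj k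

/-- The family `Q` of stencils is a `p`-exact approximation of the operator `L`:
`Q Π f = Π L f` for each `f ∈ (P_p)^n`. -/
def Approximates {n : ℕ} (p : ℕ) (Q : T.Node → T.Stencil n) (L : VecPoly d n → VecPoly d n) : Prop :=
  ∀ f : VecPoly d n, f.DegLE p → ∀ j, T.functional (Q j) (T.sample f) = T.sample (L f) j

/-- A family of fluxes `F_jk[u]`, `k ∈ N(j)`, is invariant with respect to mesh translations. -/
def FluxInvariant {X Y : Type*} (F : T.Node → T.Node → (T.Node → X) → Y) : Prop :=
  ∀ (τ : EuclideanSpace ℝ (Fin d)) (hτ : T.IsTranslation τ) (j : T.Node), ∀ k ∈ T.neighbors j,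
    ∀ u : T.Node → X, F (T.translate hτ j) (T.translate hτ k) u = F j k (u ∘ T.translate hτ)

/-- A semidiscrete scheme `M_j[du/dt] + L_j[u] = 0`, `j ∈ 𝒩`. -/
structure Scheme (n : ℕ) where
  mass : T.Node → T.MeshFun n →ₗ[ℂ] (Fin n → ℂ)
  space : T.Node → T.MeshFun n →ₗ[ℂ] (Fin n → ℂ)

variable {T} in
/-- The truncation error `ε_j(f, Π) = - M_j[Π (A · ∇f)] + L_j[Π f]`. -/
def Scheme.truncationError {n : ℕ} (𝒮 : T.Scheme n) (A : Fin d → Matrix (Fin n) (Fin n) ℝ)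
    (f : VecPoly d n) (j : T.Node) : Fin n → ℂ :=
  - 𝒮.mass j (T.sample (f.advect A)) + 𝒮.space j (T.sample f)

variable {T} in
/-- The scheme is `p`-exact for the system `∂w/∂t + A · ∇w = 0`. -/
def Scheme.IsExact {n : ℕ} (𝒮 : T.Scheme n) (A : Fin d → Matrix (Fin n) (Fin n) ℝ) (p : ℕ) : Prop :=
  ∀ f : VecPoly d n, f.DegLE p → ∀ j, 𝒮.truncationError A f j = 0

/-! ### The flux correction method -/

/-- `R_jk[u] = u_j + (r_k - r_j)/2 · (G u)_j`; here `G j i` is the stencil of the `i`-th component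
of the approximate gradient at the node `j`. -/
def reconstruction {n : ℕ} (G : T.Node → Fin d → T.Stencil n) (j k : T.Node) :
    T.MeshFun n →ₗ[ℂ] (Fin n → ℂ) :=
  LinearMap.proj j + ∑ i, (((k.1 i - j.1 i) / 2 : ℝ) : ℂ) • T.functional (G j i)

/-- The upwind flux
`F_jk[u] = (A·n_jk + |A·n_jk|)/2 R_jk[u] + (A·n_jk - |A·n_jk|)/2 R_kj[u]`. -/
def upwindFlux {n : ℕ} (A : Fin d → Matrix (Fin n) (Fin n) ℝ) (G : T.Node → Fin d → T.Stencil n)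
    (j k : T.Node) : T.MeshFun n →ₗ[ℂ] (Fin n → ℂ) :=
  let B := dotMatrix A (T.faceNormal j k)
  (((1 / 2 : ℝ) • (B + matrixAbs B)).map Complex.ofReal).mulVecLin ∘ₗ T.reconstruction G j k
    + (((1 / 2 : ℝ) • (B - matrixAbs B)).map Complex.ofReal).mulVecLin ∘ₗ T.reconstruction G k j

/-- `(1/|K_j|) ∑ k ∈ N(j), F_jk[u]`. -/
def fluxDivergence {n : ℕ} (A : Fin d → Matrix (Fin n) (Fin n) ℝ)
    (G : T.Node → Fin d → T.Stencil n) (j : T.Node) : T.MeshFun n →ₗ[ℂ] (Fin n → ℂ) :=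
  ((T.cellVolume j)⁻¹ : ℂ) • ∑ k ∈ T.neighborFinset j, T.upwindFlux A G j k

/-- The steady flux correction method: `du_j/dt + (1/|K_j|) ∑ k ∈ N(j), F_jk[u] = 0`. -/
def steadyFC {n : ℕ} (A : Fin d → Matrix (Fin n) (Fin n) ℝ) (G : T.Node → Fin d → T.Stencil n) :
    T.Scheme n where
  mass j := LinearMap.proj j
  space j := T.fluxDivergence A G j

/-- `v_jk = (r_k - r_j) · n_jk / (2d)`. -/
def edgeVolume (j k : T.Node) : ℝ := 1 / (2 * d) * inner ℝ (k.1 - j.1) (T.faceNormal j k)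

/-- The condition on the functionals `s_jk` of the extended Galerkin formula:
`s_jk[Π p] = p(r_j) - d/(4(d+2)) ((r_k - r_j) · ∇)² p` for `p ∈ (P_2)^n`. -/
def IsExtendedGalerkin {n : ℕ} (s : T.Node → T.Node → T.Stencil n) : Prop :=
  ∀ j, ∀ k ∈ T.neighbors j, ∀ p : VecPoly d n, p.DegLE 2 →
    T.functional (s j k) (T.sample p) =
      p.evalAt j.1 - ((d / (4 * (d + 2)) : ℝ) : ℂ) • (p.secondDeriv (k.1 - j.1)).evalAt j.1

/-- The flux correction method with the extended Galerkin formula: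
`∑ k ∈ N(j), v_jk s_jk[du/dt] + ∑ k ∈ N(j), F_jk[u] = 0`, divided by `|K_j|`. -/
def extendedGalerkinFC {n : ℕ} (A : Fin d → Matrix (Fin n) (Fin n) ℝ)
    (G : T.Node → Fin d → T.Stencil n) (s : T.Node → T.Node → T.Stencil n) : T.Scheme n where
  mass j := ((T.cellVolume j)⁻¹ : ℂ) •
    ∑ k ∈ T.neighborFinset j, (T.edgeVolume j k : ℂ) • T.functional (s j k)
  space j := T.fluxDivergence A G j

/-- The auxiliary vector field `v_j[f]` of the divergence formulation: its `i`-th component at the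
node `l` is, with `δ = (r_l - r_j)_i`,
`(1/d) (δ f_l - δ²/2 (D_i f)_l + δ³/6 (D_ii f)_l)`; `D₁ l i` and `D₂ l i` are the stencils of
`D_i` and `D_ii` at `l`. For `d = 2` the coefficients are `1/2`, `1/4`, `1/12`. -/
def auxField {n : ℕ} (D₁ D₂ : T.Node → Fin d → T.Stencil n) (j : T.Node) :
    T.MeshFun n →ₗ[ℂ] (T.Node → Fin d → Fin n → ℂ) :=
  LinearMap.pi fun l => LinearMap.pi fun i =>
    (((l.1 i - j.1 i) / d : ℝ) : ℂ) • LinearMap.proj l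
      - (((l.1 i - j.1 i) ^ 2 / (2 * d) : ℝ) : ℂ) • T.functional (D₁ l i)
      + (((l.1 i - j.1 i) ^ 3 / (6 * d) : ℝ) : ℂ) • T.functional (D₂ l i)

/-- `φ_jk[v] = n_jk · (R_jk[v] + R_kj[v])/2`, the reconstruction acting on each component of `v`. -/
def centralFlux {n : ℕ} (G : T.Node → Fin d → T.Stencil n) (j k : T.Node) :
    (T.Node → Fin d → Fin n → ℂ) →ₗ[ℂ] (Fin n → ℂ) :=
  ∑ i, ((T.faceNormal j k i / 2 : ℝ) : ℂ) •
    (T.reconstruction G j k + T.reconstruction G k j) ∘ₗ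
      LinearMap.pi fun l => LinearMap.proj i ∘ₗ LinearMap.proj l

/-- The flux correction method with the divergence formulation: `(DIV v_j[du/dt])_j +
(1/|K_j|) ∑ k ∈ N(j), F_jk[u] = 0` where `(DIV v)_j = (1/|K_j|) ∑ k ∈ N(j), φ_jk[v]`. -/
def divergenceFC {n : ℕ} (A : Fin d → Matrix (Fin n) (Fin n) ℝ)
    (G D₁ D₂ : T.Node → Fin d → T.Stencil n) : T.Scheme n where
  mass j := ((T.cellVolume j)⁻¹ : ℂ) •
    (∑ k ∈ T.neighborFinset j, T.centralFlux G j k) ∘ₗ T.auxField D₁ D₂ j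
  space j := T.fluxDivergence A G j

end SimplicialMesh

end FluxCorrection

end

/-! Reflect a neighbour k of j to 2j - k. Antisymmetry and translation invariance of the fluxes
give, with h = r_k - r_j, 2 ∑_k F_jk[u] = ∑_k F_jk[u - u(· - h)] (`two_smul_sum_flux`). For a cubic
f the backward difference f - f(· - h) is quadratic. On quadratics G is exact and the
reconstructions from the two ends of an edge coincide (`halfStep_opposite`), so the |A·n_jk| terms
cancel and the flux is A·n_jk times an explicit functional of f, `edgeJump`. That functional kills
constants and quadratic monomials centred at r_j, sends the linear ones to h_i and the cubic ones to
-h_i h_l h_m / 2. Only two tensors of the mesh therefore enter: ∑ n_a h_i = 2|K_j| δ_ai and ∑ n_a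
h_i h_l h_m = δ_ai M_lm + δ_al M_im + δ_am M_il (`sum_normal_edge`, `sum_normal_edge_cube`), where M
is the `edgeMoment` matrix. Consequently, on cubics, L_j[Πf] = q(r_j) - (1/(4|K_j|)) μ_j(q), with q
= A·∇f and μ_j = ½ ∑ M_lm ∂_l ∂_m. The error depends on f only through q. The steady case is q = 0.
In the other two cases the mass operator yields the same right-hand side for every quadratic q: for
the extended Galerkin formula by contracting the cubic tensor, for the divergence formulation
because the central fluxes obey the same expansion and the auxiliary field is sampled from a cubic
field with divergence q.

The cubic tensor identity is the geometric core. The normal n_jk is the sum of |e|/(d+1) (∇λ_k -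
∇λ_j) over the elements e containing both nodes (`faceNormal_eq`). Translation invariance replaces a
sum over the star of j by an average over all vertices of its elements (`sum_star_vertices`). Inside
one simplex the defect of the identity, summed over the vertices, is a combination of |e| ∇λ_k times
third central moments of the facet opposite to k (`sum_sum_central`). Let X be the sum of these
terms over the star. Facets through j cancel in pairs between adjacent elements, so X equals its
part with k = j; averaging says that X is d + 1 times this part. Hence X = 0 (`sum_facet_moments`).
-/

noncomputable section

namespace FluxCorrection

/-! ### Barycentric coordinates of a nondegenerate simplex -/

/-- The space `ℝ^d`. -/
abbrev Space (d : ℕ) : Type := EuclideanSpace ℝ (Fin d)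

/-- The vertex set of a nondegenerate `d`-simplex. -/
structure IsSimplex {d : ℕ} (e : Finset (Space d)) : Prop where
  indep : AffineIndependent ℝ ((↑) : e → Space d)
  card : e.card = d + 1

/-- The gradient of an affine function. -/
def grad {d : ℕ} (f : Space d →ᵃ[ℝ] ℝ) : Space d :=
  (InnerProductSpace.toDual ℝ (Space d)).symm (LinearMap.toContinuousLinearMap f.linear)

section Grad

variable {d : ℕ}

theorem inner_grad (f : Space d →ᵃ[ℝ] ℝ) (v : Space d) : inner ℝ (grad f) v = f.linear v := by
  simp [grad]

theorem apply_sub_apply (f : Space d →ᵃ[ℝ] ℝ) (x y : Space d) :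
    f y - f x = inner ℝ (grad f) (y - x) := by
  rw [inner_grad]
  simpa using (f.linearMap_vsub y x).symm

theorem apply_add (f : Space d →ᵃ[ℝ] ℝ) (x v : Space d) :
    f (x + v) = f x + inner ℝ (grad f) v := by
  have := apply_sub_apply f x (x + v)
  rw [add_sub_cancel_left] at this
  linarith

theorem grad_sub (f g : Space d →ᵃ[ℝ] ℝ) : grad (f - g) = grad f - grad g := by
  refine ext_inner_right ℝ fun v => ?_
  simp [inner_grad, inner_sub_left]

theorem grad_smul (c : ℝ) (f : Space d →ᵃ[ℝ] ℝ) : grad (c • f) = c • grad f := by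
  refine ext_inner_right ℝ fun v => ?_
  simp [inner_grad, inner_smul_left]

theorem grad_const_sub (c : ℝ) (f : Space d →ᵃ[ℝ] ℝ) :
    grad (AffineMap.const ℝ (Space d) c - f) = - grad f := by
  refine ext_inner_right ℝ fun v => ?_
  simp [inner_grad]

theorem grad_add_const (c : ℝ) (f : Space d →ᵃ[ℝ] ℝ) :
    grad (f + AffineMap.const ℝ (Space d) c) = grad f := by
  refine ext_inner_right ℝ fun v => ?_
  simp [inner_grad]

@[fun_prop]
theorem continuous_affine (f : Space d →ᵃ[ℝ] ℝ) : Continuous f :=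
  f.continuous_of_finiteDimensional

theorem grad_eq_of_sub_eq {f : Space d →ᵃ[ℝ] ℝ} {v : Space d}
    (h : ∀ x y, f y - f x = inner ℝ v (y - x)) : grad f = v := by
  refine ext_inner_right ℝ fun w => ?_
  have h1 := h 0 w
  rw [apply_sub_apply] at h1
  simpa using h1

end Grad

namespace IsSimplex

variable {d : ℕ} {e : Finset (Space d)} (h : IsSimplex e)
include h

/-- The vertices of a simplex as an affine basis. -/
def basis : AffineBasis e ℝ (Space d) :=
  ⟨(↑), h.indep, by
    rw [h.indep.affineSpan_eq_top_iff_card_eq_finrank_add_one]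
    simp [h.card]⟩

theorem basis_apply (l : e) : h.basis l = l.1 := rfl

end IsSimplex

open Classical in
/-- The barycentric coordinate with respect to `l` in the simplex `e`; it is zero unless `l` is a
vertex of `e`. -/
def bary {d : ℕ} (e : Finset (Space d)) (l : Space d) : Space d →ᵃ[ℝ] ℝ :=
  if h : IsSimplex e ∧ l ∈ e then h.1.basis.coord ⟨l, h.2⟩ else 0

section Bary

variable {d : ℕ} {e : Finset (Space d)} {j k l : Space d}

theorem bary_of_mem (h : IsSimplex e) (hl : l ∈ e) : bary e l = h.basis.coord ⟨l, hl⟩ :=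
  dif_pos ⟨h, hl⟩

theorem bary_of_notMem (hl : l ∉ e) : bary e l = 0 := dif_neg fun h => hl h.2

theorem sum_bary (h : IsSimplex e) (x : Space d) : ∑ l ∈ e, bary e l x = 1 := by
  rw [← Finset.sum_coe_sort e (fun l => bary e l x), ← h.basis.sum_coord_apply_eq_one x]
  exact Finset.sum_congr rfl fun l _ => by rw [bary_of_mem h l.2]

theorem sum_bary_smul (h : IsSimplex e) (x : Space d) : ∑ l ∈ e, bary e l x • l = x := by
  rw [← Finset.sum_coe_sort e (fun l => bary e l x • l)]
  conv_rhs => rw [← h.basis.linear_combination_coord_eq_self x]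
  exact Finset.sum_congr rfl fun l _ => by rw [bary_of_mem h l.2, h.basis_apply]

theorem bary_unique (h : IsSimplex e) {α : Space d → ℝ} {x : Space d}
    (h1 : ∑ l ∈ e, α l = 1) (hx : ∑ l ∈ e, α l • l = x) (hl : l ∈ e) : bary e l x = α l := by
  have h1' : ∑ l : e, α l = 1 := by rw [← h1]; exact Finset.sum_coe_sort e α
  have hx' : Finset.univ.affineCombination ℝ h.basis (fun l : e => α l) = x := by
    rw [Finset.affineCombination_eq_linear_combination _ _ _ h1', ← hx]
    exact Finset.sum_coe_sort e (fun l => α l • l)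
  rw [bary_of_mem h hl, ← hx']
  exact h.basis.coord_apply_combination_of_mem (Finset.mem_univ _) h1'

open Classical in
theorem bary_vertex (h : IsSimplex e) (hl : l ∈ e) (hj : j ∈ e) :
    bary e l j = if l = j then 1 else 0 := by
  rw [bary_unique h (α := fun l => if l = j then 1 else 0) _ _ hl]
  · simp [hj]
  · simp [hj]

theorem bary_self (h : IsSimplex e) (hl : l ∈ e) : bary e l l = 1 := by
  simp [bary_vertex h hl hl]

theorem bary_ne (h : IsSimplex e) (hj : j ∈ e) (hlj : l ≠ j) : bary e l j = 0 := by
  by_cases hl : l ∈ e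
  · simp [bary_vertex h hl hj, hlj]
  · simp [bary_of_notMem hl]

theorem affine_eq_sum (h : IsSimplex e) (f : Space d →ᵃ[ℝ] ℝ) (x : Space d) :
    f x = ∑ l ∈ e, bary e l x * f l := by
  have h0 : ∀ y, f y = f 0 + inner ℝ (grad f) y := fun y => by
    have := apply_add f 0 y
    rwa [zero_add] at this
  rw [h0 x]
  conv_lhs => rw [← sum_bary_smul h x]
  simp_rw [inner_sum, inner_smul_right]
  rw [← mul_one (f 0), ← sum_bary h x, Finset.mul_sum, ← Finset.sum_add_distrib]
  exact Finset.sum_congr rfl fun l _ => by rw [h0 l]; ring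

theorem sum_grad (h : IsSimplex e) : ∑ l ∈ e, grad (bary e l) = 0 := by
  refine ext_inner_right ℝ fun v => ?_
  simp_rw [sum_inner]
  have h1 := sum_bary h (0 + v)
  simp_rw [apply_add, Finset.sum_add_distrib, sum_bary h] at h1
  simpa using h1

theorem sum_grad_mul (h : IsSimplex e) (a i : Fin d) :
    ∑ l ∈ e, grad (bary e l) a * l i = if a = i then 1 else 0 := by
  have h1 := sum_bary_smul h (0 + EuclideanSpace.single a 1)
  simp_rw [apply_add, add_smul, Finset.sum_add_distrib, sum_bary_smul h] at h1
  have h2 := congrFun (congrArg WithLp.ofLp h1) i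
  simp only [zero_add, WithLp.ofLp_sum, WithLp.ofLp_smul, Finset.sum_apply, Pi.smul_apply,
    smul_eq_mul] at h2
  simp only [EuclideanSpace.inner_single_right, one_mul] at h2
  simpa [eq_comm] using h2

theorem mem_convexHull_iff_bary (h : IsSimplex e) {x : Space d} :
    x ∈ convexHull ℝ (e : Set (Space d)) ↔ ∀ l ∈ e, 0 ≤ bary e l x := by
  rw [Finset.mem_convexHull']
  constructor
  · rintro ⟨α, h0, h1, hx⟩ l hl
    rw [bary_unique h h1 hx hl]
    exact h0 l hl
  · intro h0
    exact ⟨fun l => bary e l x, h0, sum_bary h x, sum_bary_smul h x⟩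

end Bary

/-! ### Volumes of cones and hyperplane areas -/

section Cone

open MeasureTheory

variable {d : ℕ}

/-- The truncated cone with apex `p` over a subset `B` of the hyperplane `f = 1`, where `f p = 0`. -/
def coneOver (f : Space d →ᵃ[ℝ] ℝ) (p : Space d) (B : Set (Space d)) : Set (Space d) :=
  {x | 0 < f x ∧ f x ≤ 1 ∧ p + (f x)⁻¹ • (x - p) ∈ B}

theorem measurableSet_coneOver (f : Space d →ᵃ[ℝ] ℝ) (p : Space d) {B : Set (Space d)}
    (hB : MeasurableSet B) : MeasurableSet (coneOver f p B) := by
  have hf : Measurable f := (continuous_affine f).measurable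
  have h1 : Measurable fun x => p + (f x)⁻¹ • (x - p) := by fun_prop
  exact (measurableSet_lt measurable_const hf).inter
    ((measurableSet_le hf measurable_const).inter (h1 hB))

theorem lintegral_pow_Ioc (m : ℕ) :
    ∫⁻ s in Set.Ioc (0 : ℝ) 1, ENNReal.ofReal (s ^ m) = ENNReal.ofReal (1 / (m + 1)) := by
  have h := integral_pow (a := (0 : ℝ)) (b := 1) m
  rw [intervalIntegral.integral_of_le zero_le_one] at h
  rw [← ofReal_integral_eq_lintegral_ofReal, h]
  · simp
  · have := (intervalIntegral.intervalIntegrable_pow (a := 0) (b := 1) (μ := volume) m)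
    exact (intervalIntegrable_iff_integrableOn_Ioc_of_le zero_le_one).1 this
  · exact (ae_restrict_iff' measurableSet_Ioc).2 (.of_forall fun s hs => pow_nonneg hs.1.le m)

/-- Fubini along grad f: the slice of the cone at f = s is a copy of B scaled by s, its area is
s^(d-1) times that of B, and the height of the cone is 1/‖grad f‖. This trades Hausdorff measure for
Lebesgue measure, so that areas can be found from symmetries of volumes. -/
theorem area_eq_volume_coneOver (hd : 1 ≤ d) {f : Space d →ᵃ[ℝ] ℝ} {p : Space d} (hp : f p = 0)
    (hg : grad f ≠ 0) {B : Set (Space d)} (hB : MeasurableSet B) (hB1 : ∀ x ∈ B, f x = 1) :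
    μHE[d - 1] B = ENNReal.ofReal (d * ‖grad f‖) * volume (coneOver f p B) := by
  obtain ⟨m, rfl⟩ : ∃ m, d = m + 1 := ⟨d - 1, by omega⟩
  have hgn : ‖grad f‖ ≠ 0 := norm_ne_zero_iff.2 hg
  -- Normalized so that f (p + s • v) = s: the hyperplanes orthogonal to v through these points are
  -- the level sets of f, and ‖v‖ is the height of the cone.
  set v : Space (m + 1) := (‖grad f‖ ^ 2)⁻¹ • grad f with hv
  have hgv : inner ℝ (grad f) v = 1 := by
    rw [hv, inner_smul_right, real_inner_self_eq_norm_sq, inv_mul_cancel₀ (pow_ne_zero 2 hgn)]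
  have hv0 : v ≠ 0 := by
    rintro h
    rw [h, inner_zero_right] at hgv
    exact zero_ne_one hgv
  have hnv : ‖v‖ = ‖grad f‖⁻¹ := by
    rw [hv, norm_smul, norm_inv, norm_pow, norm_norm]
    field_simp
  have hmem : ∀ (s : ℝ) (x : Space (m + 1)),
      x ∈ AffineSubspace.mk' (s • v +ᵥ p) (ℝ ∙ v)ᗮ ↔ f x = s := by
    intro s x
    rw [AffineSubspace.mem_mk', Submodule.mem_orthogonal_singleton_iff_inner_right]
    have h1 := apply_sub_apply f p x
    rw [hp, sub_zero] at h1
    have h2 : inner ℝ v (x -ᵥ (s • v +ᵥ p)) = (‖grad f‖ ^ 2)⁻¹ * (f x - s) := by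
      have : x -ᵥ (s • v +ᵥ p) = (x - p) - s • v := by
        rw [vsub_eq_sub, vadd_eq_add]; abel
      rw [this]
      conv_lhs => rw [hv]
      rw [inner_smul_left, inner_sub_right, ← h1, inner_smul_right, hgv, mul_one]
      rfl
    rw [h2, mul_eq_zero, sub_eq_zero]
    simp [hgn]
  have hsec : ∀ s : ℝ, μHE[m] (coneOver f p B ∩ AffineSubspace.mk' (s • v +ᵥ p) (ℝ ∙ v)ᗮ) =
      (Set.Ioc (0 : ℝ) 1).indicator (fun s => ENNReal.ofReal (s ^ m) * μHE[m] B) s := by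
    intro s
    by_cases hs : s ∈ Set.Ioc (0 : ℝ) 1
    · rw [Set.indicator_of_mem hs]
      have : coneOver f p B ∩ AffineSubspace.mk' (s • v +ᵥ p) (ℝ ∙ v)ᗮ =
          AffineMap.homothety p s '' B := by
        ext x
        rw [Set.mem_inter_iff, SetLike.mem_coe, hmem]
        simp only [coneOver, Set.mem_ofPred_eq, Set.mem_image, AffineMap.homothety_apply, vsub_eq_sub, vadd_eq_add]
        constructor
        · rintro ⟨⟨-, -, hx⟩, hfx⟩
          refine ⟨_, hx, ?_⟩
          rw [hfx, add_sub_cancel_left, smul_smul, mul_inv_cancel₀ hs.1.ne', one_smul,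
            sub_add_cancel]
        · rintro ⟨y, hy, rfl⟩
          have h1 := apply_sub_apply f p y
          rw [hp, sub_zero, hB1 y hy] at h1
          have hfx : f (s • (y - p) + p) = s := by
            rw [add_comm (s • (y - p)) p, apply_add, hp, inner_smul_right, ← h1]; ring
          refine ⟨⟨hfx.symm ▸ hs.1, hfx.symm ▸ hs.2, ?_⟩, hfx⟩
          rw [hfx, add_sub_cancel_right, smul_smul, inv_mul_cancel₀ hs.1.ne', one_smul]
          simpa using hy
      rw [this, euclideanHausdorffMeasure_homothety_image m p hs.1.ne', ENNReal.smul_def,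
        smul_eq_mul]
      congr 1
      rw [ENNReal.ofReal_pow hs.1.le, ENNReal.coe_pow]
      congr 1
      rw [ENNReal.ofReal, Real.toNNReal_eq_nnnorm_of_nonneg hs.1.le]
    · rw [Set.indicator_of_notMem hs]
      convert measure_empty (μ := (μHE[m] : Measure (Space (m + 1))))
      rw [Set.eq_empty_iff_forall_notMem]
      rintro x ⟨hx, hx'⟩
      rw [SetLike.mem_coe, hmem] at hx'
      exact hs ⟨hx' ▸ hx.1, hx' ▸ hx.2.1⟩
  have key := EuclideanGeometry.euclideanHausdorffMeasure_eq_lintegral p hv0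
    (measurableSet_coneOver f p hB)
  rw [InnerProductSpace.euclideanHausdorffMeasure_eq_volume] at key
  simp only [finrank_euclideanSpace, Fintype.card_fin, Nat.add_sub_cancel] at key
  simp_rw [hsec] at key
  rw [lintegral_indicator measurableSet_Ioc, lintegral_mul_const _ (by fun_prop),
    lintegral_pow_Ioc] at key
  rw [key, Nat.add_sub_cancel, ← ofReal_norm, hnv, ← mul_assoc, ← mul_assoc,
    ← ENNReal.ofReal_mul (by positivity), ← ENNReal.ofReal_mul (by positivity)]
  have : ((m + 1 : ℕ) : ℝ) * ‖grad f‖ * ‖grad f‖⁻¹ * (1 / (m + 1)) = 1 := by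
    push_cast
    field_simp
  rw [this, ENNReal.ofReal_one, one_mul]

theorem volume_affine_eq_zero {f : Space d →ᵃ[ℝ] ℝ} {x₀ : Space d} (h : f x₀ ≠ 0) :
    volume {x | f x = 0} = 0 := by
  let S : AffineSubspace ℝ (Space d) := (⊥ : Submodule ℝ ℝ).toAffineSubspace.comap f
  have hS : (S : Set (Space d)) = {x | f x = 0} := by
    ext x
    simp [S]
  rw [← hS]
  refine Measure.addHaar_affineSubspace _ _ fun htop => h ?_
  have : x₀ ∈ (S : Set (Space d)) := by rw [htop]; trivial
  rwa [hS] at this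

/-- The linear part squares to the identity, so its determinant is ±1. -/
theorem volume_preimage_of_involutive (T : Space d →ᵃ[ℝ] Space d) (hT : ∀ x, T (T x) = x)
    (s : Set (Space d)) : volume (T ⁻¹' s) = volume s := by
  have hdec : ∀ x, T x = T.linear x + T 0 := fun x => by
    simpa [sub_eq_iff_eq_add] using (T.linearMap_vsub x 0).symm
  have hlin : T.linear * T.linear = 1 := by
    ext1 x
    have h1 := hT x
    have h2 := hT 0
    rw [hdec (T x), hdec x, map_add] at h1
    rw [hdec (T 0)] at h2
    rw [Module.End.mul_apply, Module.End.one_apply]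
    rw [add_assoc, h2, add_zero] at h1
    exact h1
  have hdet : LinearMap.det T.linear * LinearMap.det T.linear = 1 := by
    rw [← map_mul, hlin, map_one]
  have habs : |(LinearMap.det T.linear)⁻¹| = 1 := by
    rw [abs_inv, inv_eq_one]
    have h := abs_mul (LinearMap.det T.linear) (LinearMap.det T.linear)
    rw [hdet, abs_one] at h
    nlinarith [abs_nonneg (LinearMap.det T.linear)]
  have h0 : LinearMap.det T.linear ≠ 0 := left_ne_zero_of_mul (hdet ▸ one_ne_zero)
  have hpre : T ⁻¹' s = T.linear ⁻¹' ((fun x => x + T 0) ⁻¹' s) := by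
    ext x
    simp only [Set.mem_preimage, ← hdec]
  rw [hpre, Measure.addHaar_preimage_linearMap volume h0, habs, ENNReal.ofReal_one, one_mul,
    measure_preimage_add_right]

end Cone

/-! ### Parts of a simplex cut out by comparing barycentric coordinates -/

section Parts

open MeasureTheory

variable {d : ℕ} {e : Finset (Space d)} {j k l : Space d}

/-- The interior of a simplex. -/
def openSimplex (e : Finset (Space d)) : Set (Space d) := {x | ∀ l ∈ e, 0 < bary e l x}

/-- The part of a simplex where the barycentric coordinate of `j` is the largest one. -/
def simplexCell (e : Finset (Space d)) (j : Space d) : Set (Space d) :=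
  {x | ∀ l ∈ e, 0 ≤ bary e l x ∧ bary e l x ≤ bary e j x}

/-- The interior points of a simplex where the coordinates of `j` and `k` coincide and exceed the
other ones. -/
def openPiece (e : Finset (Space d)) (j k : Space d) : Set (Space d) :=
  {x | (∀ l ∈ e, 0 < bary e l x) ∧ bary e j x = bary e k x ∧
    ∀ l ∈ e, l ≠ j → l ≠ k → bary e l x < bary e k x}

/-- The points of a simplex where the coordinates of `j` and `k` coincide and are the largest. -/
def closedPiece (e : Finset (Space d)) (j k : Space d) : Set (Space d) :=
  {x | (∀ l ∈ e, 0 ≤ bary e l x ∧ bary e l x ≤ bary e k x) ∧ bary e j x = bary e k x}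

/-- The interior points of a simplex where the coordinate of `j` is the largest one and that of `k`
is the next. -/
def chamber (e : Finset (Space d)) (j k : Space d) : Set (Space d) :=
  {x | (∀ l ∈ e, 0 < bary e l x) ∧ bary e k x ≤ bary e j x ∧
    ∀ l ∈ e, l ≠ j → l ≠ k → bary e l x < bary e k x}

/-- The relative interior of the facet opposite to `k`. -/
def openFacet (e : Finset (Space d)) (k : Space d) : Set (Space d) :=
  {x | bary e k x = 0 ∧ ∀ l ∈ e, l ≠ k → 0 < bary e l x}

/-- The volume of a simplex. -/
def simplexVolume (e : Finset (Space d)) : ℝ := volume.real (openSimplex e)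

theorem measurableSet_forall_mem {p : Space d → Space d → Prop}
    (h : ∀ l ∈ e, MeasurableSet {x | p l x}) : MeasurableSet {x | ∀ l ∈ e, p l x} := by
  have : {x | ∀ l ∈ e, p l x} = ⋂ l ∈ e, {x | p l x} := by ext; simp
  rw [this]
  exact Finset.measurableSet_biInter _ h

theorem measurable_bary (e : Finset (Space d)) (l : Space d) : Measurable (bary e l) :=
  (continuous_affine _).measurable

theorem isOpen_openSimplex (e : Finset (Space d)) : IsOpen (openSimplex e) := by
  have : openSimplex e = ⋂ l ∈ e, {x | 0 < bary e l x} := by ext; simp [openSimplex]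
  rw [this]
  exact isOpen_biInter_finset fun l _ => isOpen_lt continuous_const (continuous_affine _)

theorem measurableSet_simplexCell (e : Finset (Space d)) (j : Space d) :
    MeasurableSet (simplexCell e j) :=
  measurableSet_forall_mem fun l _ => (measurableSet_le measurable_const (measurable_bary e l)).inter
    (measurableSet_le (measurable_bary e l) (measurable_bary e j))

theorem measurableSet_strict (e : Finset (Space d)) (j k : Space d) :
    MeasurableSet {x | ∀ l ∈ e, l ≠ j → l ≠ k → bary e l x < bary e k x} := by
  refine measurableSet_forall_mem fun l _ => ?_
  by_cases h : l ≠ j ∧ l ≠ k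
  · convert! measurableSet_lt (measurable_bary e l) (measurable_bary e k) using 1
    ext x
    simp [h.1, h.2]
  · convert! MeasurableSet.univ using 1
    ext x
    simp only [Set.mem_ofPred_eq, Set.mem_univ, iff_true]
    exact fun h1 h2 => absurd ⟨h1, h2⟩ h

theorem measurableSet_openPiece (e : Finset (Space d)) (j k : Space d) :
    MeasurableSet (openPiece e j k) :=
  (isOpen_openSimplex e).measurableSet.inter
    ((measurableSet_eq_fun (measurable_bary e j) (measurable_bary e k)).inter
      (measurableSet_strict e j k))

theorem measurableSet_chamber (e : Finset (Space d)) (j k : Space d) :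
    MeasurableSet (chamber e j k) :=
  (isOpen_openSimplex e).measurableSet.inter
    ((measurableSet_le (measurable_bary e k) (measurable_bary e j)).inter
      (measurableSet_strict e j k))

theorem measurableSet_closedPiece (e : Finset (Space d)) (j k : Space d) :
    MeasurableSet (closedPiece e j k) :=
  (measurableSet_simplexCell e k).inter
    (measurableSet_eq_fun (measurable_bary e j) (measurable_bary e k))

theorem measurableSet_openFacet (e : Finset (Space d)) (k : Space d) :
    MeasurableSet (openFacet e k) := by
  refine (measurableSet_eq_fun (measurable_bary e k) measurable_const).inter
    (measurableSet_forall_mem fun l _ => ?_)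
  by_cases h : l = k
  · convert! MeasurableSet.univ using 1
    ext x
    simp [h]
  · convert! measurableSet_lt (measurable_const (a := (0 : ℝ))) (measurable_bary e l) using 1
    ext x
    simp [h]

theorem ae_bary_ne (h : IsSimplex e) : ∀ᵐ x : Space d, (∀ l ∈ e, bary e l x ≠ 0) ∧
    ∀ l ∈ e, ∀ m ∈ e, l ≠ m → bary e l x ≠ bary e m x := by
  rw [Filter.eventually_and]
  constructor
  · rw [Filter.eventually_all_finset]
    intro l hl
    have : volume {x | bary e l x = 0} = 0 :=
      volume_affine_eq_zero (x₀ := l) (by rw [bary_self h hl]; exact one_ne_zero)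
    simpa [ae_iff] using this
  · rw [Filter.eventually_all_finset]
    intro l hl
    rw [Filter.eventually_all_finset]
    intro m hm
    by_cases hlm : l = m
    · simp [hlm]
    have : volume {x | (bary e l - bary e m) x = 0} = 0 :=
      volume_affine_eq_zero (x₀ := l) (by
        simp [bary_self h hl, bary_ne h hl (Ne.symm hlm)])
    simpa [ae_iff, hlm, sub_eq_zero] using this

theorem isBounded_simplex (h : IsSimplex e) :
    Bornology.IsBounded {x | ∀ l ∈ e, 0 ≤ bary e l x} := by
  have : {x | ∀ l ∈ e, 0 ≤ bary e l x} = convexHull ℝ (e : Set (Space d)) := by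
    ext x
    exact (mem_convexHull_iff_bary h).symm
  rw [this]
  exact isBounded_convexHull.2 e.finite_toSet.isBounded

theorem volume_ne_top_of_subset (h : IsSimplex e) {s : Set (Space d)}
    (hs : s ⊆ {x | ∀ l ∈ e, 0 ≤ bary e l x}) : volume s ≠ ⊤ :=
  (((isBounded_simplex h).subset hs).measure_lt_top).ne

theorem simplexVolume_pos (h : IsSimplex e) : 0 < simplexVolume e := by
  refine ENNReal.toReal_pos ?_ (volume_ne_top_of_subset h fun x hx l hl => (hx l hl).le)
  refine (IsOpen.measure_pos _ (isOpen_openSimplex e) ?_).ne'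
  -- The barycenter, all of whose coordinates are 1/(d+1), shows that the interior is nonempty.
  refine ⟨∑ l ∈ e, ((d : ℝ) + 1)⁻¹ • l, fun l hl => ?_⟩
  rw [bary_unique h (α := fun _ => ((d : ℝ) + 1)⁻¹) _ rfl hl]
  · positivity
  · rw [Finset.sum_const, h.card, nsmul_eq_mul]
    push_cast
    field_simp

/-! ### Vertex symmetries of a simplex and the volumes of its parts -/

/-- The affine map that interchanges the vertices `a` and `b` of a simplex. -/
def vertexSwap (e : Finset (Space d)) (a b : Space d) : Space d →ᵃ[ℝ] Space d where
  toFun x := x + (bary e a x - bary e b x) • (b - a)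
  linear := LinearMap.id +
    ((bary e a).linear - (bary e b).linear).smulRight (b - a)
  map_vadd' p v := by
    have hv : ∀ l, bary e l (v + p) = bary e l p + (bary e l).linear v := fun l => by
      rw [add_comm, apply_add, inner_grad]
    simp only [vadd_eq_add, LinearMap.add_apply, LinearMap.id_apply,
      LinearMap.smulRight_apply, LinearMap.sub_apply, hv]
    module

open Classical in
theorem bary_vertexSwap (h : IsSimplex e) {a b : Space d} (ha : a ∈ e) (hb : b ∈ e)
    (x : Space d) : bary e l (vertexSwap e a b x) = bary e (Equiv.swap a b l) x := by
  have key : bary e l (vertexSwap e a b x) =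
      bary e l x + (bary e a x - bary e b x) * (bary e l b - bary e l a) := by
    change bary e l (x + (bary e a x - bary e b x) • (b - a)) = _
    rw [apply_add, inner_smul_right, apply_sub_apply]
  rw [key]
  by_cases hab : a = b
  · simp [hab]
  by_cases hla : l = a
  · subst hla
    rw [Equiv.swap_apply_left, bary_ne h hb hab, bary_self h ha]
    ring
  by_cases hlb : l = b
  · subst hlb
    rw [Equiv.swap_apply_right, bary_ne h ha (Ne.symm hab), bary_self h hb]
    ring
  · rw [Equiv.swap_apply_of_ne_of_ne hla hlb, bary_ne h hb hlb, bary_ne h ha hla]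
    ring

theorem eq_of_bary_eq (h : IsSimplex e) {x y : Space d} (hxy : ∀ l, bary e l x = bary e l y) :
    x = y := by
  rw [← sum_bary_smul h x, ← sum_bary_smul h y]
  simp_rw [hxy]

theorem vertexSwap_vertexSwap (h : IsSimplex e) {a b : Space d} (ha : a ∈ e) (hb : b ∈ e)
    (x : Space d) : vertexSwap e a b (vertexSwap e a b x) = x := by
  classical
  refine eq_of_bary_eq h fun l => ?_
  rw [bary_vertexSwap h ha hb, bary_vertexSwap h ha hb, Equiv.swap_apply_self]

open Classical in
theorem forall_mem_swap {a b : Space d} (ha : a ∈ e) (hb : b ∈ e) {p : Space d → Prop} :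
    (∀ l ∈ e, p (Equiv.swap a b l)) ↔ ∀ l ∈ e, p l := by
  have hmem : ∀ l ∈ e, Equiv.swap a b l ∈ e := fun l hl => by
    rw [Equiv.swap_apply_def]
    split_ifs <;> assumption
  refine ⟨fun h l hl => ?_, fun h l hl => h _ (hmem l hl)⟩
  have := h _ (hmem l hl)
  rwa [Equiv.swap_apply_self] at this

theorem volume_simplexCell_eq (h : IsSimplex e) (hj : j ∈ e) (hk : k ∈ e) :
    volume (simplexCell e j) = volume (simplexCell e k) := by
  classical
  rw [← volume_preimage_of_involutive _ (vertexSwap_vertexSwap h hj hk) (simplexCell e j)]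
  congr 1
  ext x
  simp only [Set.mem_preimage, simplexCell, Set.mem_ofPred_eq, bary_vertexSwap h hj hk,
    Equiv.swap_apply_left]
  exact forall_mem_swap hj hk (p := fun l => 0 ≤ bary e l x ∧ bary e l x ≤ bary e k x)

theorem volume_chamber_eq (h : IsSimplex e) (hk : k ∈ e) (hl : l ∈ e) (hjk : j ≠ k)
    (hjl : j ≠ l) : volume (chamber e j k) = volume (chamber e j l) := by
  classical
  rw [← volume_preimage_of_involutive _ (vertexSwap_vertexSwap h hk hl) (chamber e j k)]
  congr 1
  ext x
  simp only [Set.mem_preimage, chamber, Set.mem_ofPred_eq, bary_vertexSwap h hk hl,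
    Equiv.swap_apply_left, Equiv.swap_apply_of_ne_of_ne hjk hjl]
  refine and_congr (forall_mem_swap hk hl (p := fun m => 0 < bary e m x))
    (and_congr Iff.rfl ?_)
  rw [← forall_mem_swap hk hl
    (p := fun m => m ≠ j → m ≠ l → bary e m x < bary e l x)]
  refine forall₂_congr fun m hm => imp_congr (not_congr ?_) (imp_congr (not_congr ?_) Iff.rfl)
  · rw [Equiv.swap_apply_eq_iff, Equiv.swap_apply_of_ne_of_ne hjk hjl]
  · rw [Equiv.swap_apply_eq_iff, Equiv.swap_apply_right]

/-- At almost every point of the cell of j the second largest coordinate is unique, which places the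
point in exactly one of the d chambers. Swaps of vertices other than j interchange the chambers, so
these have equal volumes. -/
theorem volume_simplexCell (h : IsSimplex e) (hj : j ∈ e) (hk : k ∈ e)
    (hjk : j ≠ k) : volume (simplexCell e j) = d * volume (chamber e j k) := by
  classical
  have hae : simplexCell e j =ᵐ[volume] ⋃ m ∈ e.erase j, chamber e j m := by
    filter_upwards [ae_bary_ne h] with x hx
    refine propext ?_
    change x ∈ simplexCell e j ↔ x ∈ ⋃ m ∈ e.erase j, chamber e j m
    simp only [Set.mem_iUnion, exists_prop]
    constructor
    · intro hxj
      obtain ⟨m, hm, hmax⟩ := (e.erase j).exists_max_image (fun m => bary e m x)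
        ⟨k, Finset.mem_erase.2 ⟨hjk.symm, hk⟩⟩
      have hm' := Finset.mem_erase.1 hm
      refine ⟨m, hm, fun l hl => lt_of_le_of_ne (hxj l hl).1 (hx.1 l hl).symm, (hxj m hm'.2).2,
        fun l hl hlj hlm => ?_⟩
      exact lt_of_le_of_ne (hmax l (Finset.mem_erase.2 ⟨hlj, hl⟩)) (hx.2 l hl m hm'.2 hlm)
    · rintro ⟨m, hm, h0, h1, h2⟩ l hl
      refine ⟨(h0 l hl).le, ?_⟩
      by_cases hlj : l = j
      · rw [hlj]
      by_cases hlm : l = m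
      · rwa [hlm]
      · exact (h2 l hl hlj hlm).le.trans h1
  rw [measure_congr hae, measure_biUnion_finset _ fun m _ => measurableSet_chamber e j m]
  · have : ∀ m ∈ e.erase j, volume (chamber e j m) = volume (chamber e j k) := fun m hm =>
      volume_chamber_eq h (Finset.mem_of_mem_erase hm) hk (Finset.ne_of_mem_erase hm).symm hjk
    rw [Finset.sum_congr rfl this, Finset.sum_const, Finset.card_erase_of_mem hj, h.card]
    simp
  · intro m hm m' hm' hne
    refine Set.disjoint_left.2 fun x hx hx' => ?_
    have hm1 := Finset.mem_erase.1 (Finset.mem_coe.1 hm)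
    have hm2 := Finset.mem_erase.1 (Finset.mem_coe.1 hm')
    exact lt_asymm (hx.2.2 m' hm2.2 hm2.1 hne.symm) (hx'.2.2 m hm1.2 hm1.1 hne)

/-- The d + 1 cells have equal volumes, cover the simplex up to a null set and overlap only where
two coordinates coincide. -/
theorem volume_openSimplex (h : IsSimplex e) (hj : j ∈ e) :
    volume (openSimplex e) = (d + 1) * volume (simplexCell e j) := by
  have hae : openSimplex e =ᵐ[volume] ⋃ m ∈ e, simplexCell e m := by
    filter_upwards [ae_bary_ne h] with x hx
    refine propext ?_
    change x ∈ openSimplex e ↔ x ∈ ⋃ m ∈ e, simplexCell e m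
    simp only [Set.mem_iUnion, exists_prop]
    constructor
    · intro hxe
      obtain ⟨m, hm, hmax⟩ := e.exists_max_image (fun m => bary e m x) ⟨j, hj⟩
      exact ⟨m, hm, fun l hl => ⟨(hxe l hl).le, hmax l hl⟩⟩
    · rintro ⟨m, hm, h0⟩ l hl
      exact lt_of_le_of_ne (h0 l hl).1 (hx.1 l hl).symm
  rw [measure_congr hae, measure_biUnion_finset₀ _
    fun m _ => (measurableSet_simplexCell e m).nullMeasurableSet]
  · rw [Finset.sum_congr rfl fun m hm => volume_simplexCell_eq h hm hj, Finset.sum_const, h.card]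
    simp
  · intro m hm m' hm' hne
    change volume _ = 0
    refine measure_mono_null ?_ (ae_iff.1 (ae_bary_ne h))
    rintro x ⟨hx, hx'⟩ hgen
    exact hgen.2 m hm m' hm' hne (le_antisymm (hx' m hm).2 (hx m' hm').2)

theorem volume_real_simplexCell (h : IsSimplex e) (hj : j ∈ e) :
    volume.real (simplexCell e j) = simplexVolume e / (d + 1) := by
  rw [simplexVolume, measureReal_def, measureReal_def, volume_openSimplex h hj, ENNReal.toReal_mul,
    eq_div_iff (by positivity), mul_comm]
  congr 1

theorem volume_real_chamber (h : IsSimplex e) (hj : j ∈ e) (hk : k ∈ e)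
    (hjk : j ≠ k) : d * volume.real (chamber e j k) = simplexVolume e / (d + 1) := by
  rw [← volume_real_simplexCell h hj, measureReal_def, measureReal_def,
    volume_simplexCell h hj hk hjk, ENNReal.toReal_mul, ENNReal.toReal_natCast]

/-! ### Areas of interface pieces and of facets -/

theorem apply_homothety (f : Space d →ᵃ[ℝ] ℝ) (p x : Space d) (c : ℝ) :
    f (p + c • (x - p)) = f p + c * (f x - f p) := by
  rw [apply_add, inner_smul_right, apply_sub_apply]

theorem bary_le_one (h : IsSimplex e) {x : Space d} (hx : ∀ l ∈ e, 0 ≤ bary e l x) (hj : j ∈ e) :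
    bary e j x ≤ 1 := by
  rw [← sum_bary h x]
  exact Finset.single_le_sum hx hj

/-- The affine function that vanishes at `j` and is `1` where the coordinates of `j` and `k`
coincide. -/
def pieceFun (e : Finset (Space d)) (j k : Space d) : Space d →ᵃ[ℝ] ℝ :=
  bary e k - bary e j + AffineMap.const ℝ (Space d) 1

theorem pieceFun_apply (x : Space d) : pieceFun e j k x = bary e k x - bary e j x + 1 := by
  simp [pieceFun]

theorem grad_pieceFun : grad (pieceFun e j k) = grad (bary e k) - grad (bary e j) := by
  rw [pieceFun, grad_add_const, grad_sub]

theorem pieceFun_self (h : IsSimplex e) (hj : j ∈ e) (hjk : j ≠ k) : pieceFun e j k j = 0 := by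
  rw [pieceFun_apply, bary_self h hj, bary_ne h hj hjk.symm]
  ring

theorem inner_grad_sub (h : IsSimplex e) (hj : j ∈ e) (hk : k ∈ e) (hjk : j ≠ k) :
    inner ℝ (k - j) (grad (bary e k) - grad (bary e j)) = 2 := by
  rw [real_inner_comm, inner_sub_left, ← apply_sub_apply, ← apply_sub_apply, bary_self h hk,
    bary_self h hj, bary_ne h hj hjk.symm, bary_ne h hk hjk]
  norm_num

theorem grad_sub_ne_zero (h : IsSimplex e) (hj : j ∈ e) (hk : k ∈ e) (hjk : j ≠ k) :
    grad (bary e k) - grad (bary e j) ≠ 0 := fun h0 => by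
  have := inner_grad_sub h hj hk hjk
  rw [h0, inner_zero_right] at this
  norm_num at this

/-- A homothety centred at j multiplies all coordinates except that of j by one factor, hence keeps
their order. The cone from j over the piece is thus the region where k comes second after j. -/
theorem coneOver_openPiece (h : IsSimplex e) (hj : j ∈ e) (hk : k ∈ e) (hjk : j ≠ k) :
    coneOver (pieceFun e j k) j (openPiece e j k) = chamber e j k := by
  ext x
  have hl : ∀ c : ℝ, ∀ l, l ≠ j → bary e l (j + c • (x - j)) = c * bary e l x := fun c l hlj => by
    rw [apply_homothety, bary_ne h hj hlj]; ring
  have hj' : ∀ c : ℝ, bary e j (j + c • (x - j)) = 1 + c * (bary e j x - 1) := fun c => by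
    rw [apply_homothety, bary_self h hj]
  have hjc : 0 < pieceFun e j k x → bary e j (j + (pieceFun e j k x)⁻¹ • (x - j)) =
      (pieceFun e j k x)⁻¹ * bary e k x := fun h0 => by
    rw [hj', eq_inv_mul_iff_mul_eq₀ h0.ne', mul_add, mul_inv_cancel_left₀ h0.ne', pieceFun_apply]
    ring
  constructor
  · rintro ⟨h0, h1, h2, -, h4⟩
    have hpos : ∀ l ∈ e, l ≠ j → 0 < bary e l x := fun l hle hlj => by
      have := h2 l hle
      rw [hl _ l hlj] at this
      exact pos_of_mul_pos_right this (inv_pos.2 h0).le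
    have hle : bary e k x ≤ bary e j x := by
      rw [pieceFun_apply] at h1
      linarith
    refine ⟨fun l hle' => ?_, hle, fun l hle hlj hlk => ?_⟩
    · by_cases hlj : l = j
      · rw [hlj]
        exact (hpos k hk hjk.symm).trans_le hle
      · exact hpos l hle' hlj
    · have := h4 l hle hlj hlk
      rw [hl _ l hlj, hl _ k hjk.symm] at this
      exact lt_of_mul_lt_mul_left this (inv_pos.2 h0).le
  · rintro ⟨h0, h1, h2⟩
    have hj1 := bary_le_one h (fun l hl => (h0 l hl).le) hj
    have hk0 := h0 k hk
    have hf : 0 < pieceFun e j k x := by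
      rw [pieceFun_apply]
      linarith
    have hf' := inv_pos.2 hf
    refine ⟨hf, ?_, fun l hle => ?_, ?_, fun l hle hlj hlk => ?_⟩
    · rw [pieceFun_apply]
      linarith
    · by_cases hlj : l = j
      · rw [hlj, hjc hf]
        exact mul_pos hf' hk0
      · rw [hl _ l hlj]
        exact mul_pos hf' (h0 l hle)
    · rw [hjc hf, hl _ k hjk.symm]
    · rw [hl _ l hlj, hl _ k hjk.symm]
      exact mul_lt_mul_of_pos_left (h2 l hle hlj hlk) hf'

/-- The factor d of the cone formula cancels against the number d of equal chambers in the cell of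
j, which leaves the cell volume |e|/(d+1). -/
theorem area_openPiece (hd : 1 ≤ d) (h : IsSimplex e) (hj : j ∈ e) (hk : k ∈ e) (hjk : j ≠ k) :
    μHE[d - 1] (openPiece e j k) = ENNReal.ofReal
      (‖grad (bary e k) - grad (bary e j)‖ * (simplexVolume e / (d + 1))) := by
  have hg : grad (pieceFun e j k) ≠ 0 := by
    rw [grad_pieceFun]
    exact grad_sub_ne_zero h hj hk hjk
  rw [area_eq_volume_coneOver hd (pieceFun_self h hj hjk) hg (measurableSet_openPiece e j k),
    coneOver_openPiece h hj hk hjk, ← volume_real_chamber h hj hk hjk, grad_pieceFun,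
    ← ofReal_measureReal (volume_ne_top_of_subset h fun x hx l hl => (hx.1 l hl).le),
    ← ENNReal.ofReal_mul (by positivity)]
  · congr 1
    ring
  · intro x hx
    rw [pieceFun_apply, hx.2.1]
    ring

/-- The cone from j over the excess consists of points with a vanishing or a repeated coordinate,
which form a Lebesgue null set. -/
theorem area_closedPiece_diff (hd : 1 ≤ d) (h : IsSimplex e) (hj : j ∈ e) (hk : k ∈ e)
    (hjk : j ≠ k) : μHE[d - 1] (closedPiece e j k \ openPiece e j k) = 0 := by
  have hg : grad (pieceFun e j k) ≠ 0 := by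
    rw [grad_pieceFun]
    exact grad_sub_ne_zero h hj hk hjk
  rw [area_eq_volume_coneOver hd (pieceFun_self h hj hjk) hg
    ((measurableSet_closedPiece e j k).diff (measurableSet_openPiece e j k))]
  · refine mul_eq_zero_of_right _ (measure_mono_null ?_ (ae_iff.1 (ae_bary_ne h)))
    rintro x ⟨h0, h1, ⟨h2, h3⟩, h4⟩ ⟨g1, g2⟩
    have hl : ∀ l, l ≠ j → bary e l (j + (pieceFun e j k x)⁻¹ • (x - j)) =
        (pieceFun e j k x)⁻¹ * bary e l x := fun l hlj => by
      rw [apply_homothety, bary_ne h hj hlj]; ring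
    have hne : ∀ l ∈ e, l ≠ j → bary e l (j + (pieceFun e j k x)⁻¹ • (x - j)) ≠ 0 :=
      fun l hle hlj => by
        rw [hl l hlj]
        exact mul_ne_zero (inv_pos.2 h0).ne' (g1 l hle)
    refine h4 ⟨fun l hle => lt_of_le_of_ne (h2 l hle).1 (Ne.symm ?_), h3, fun l hle hlj hlk =>
      lt_of_le_of_ne (h2 l hle).2 ?_⟩
    · by_cases hlj : l = j
      · rw [hlj, h3]
        exact hne k hk hjk.symm
      · exact hne l hle hlj
    · rw [hl l hlj, hl k hjk.symm]
      exact fun h' => g2 l hle k hk hlk (mul_left_cancel₀ (inv_pos.2 h0).ne' h')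
  · intro x hx
    rw [pieceFun_apply, hx.1.2]
    ring

/-- The cone from the opposite vertex k fills the simplex up to a null set. -/
theorem area_openFacet (hd : 1 ≤ d) (h : IsSimplex e) (hk : k ∈ e) :
    μHE[d - 1] (openFacet e k) =
      ENNReal.ofReal (d * (simplexVolume e * ‖grad (bary e k)‖)) := by
  obtain ⟨j, hj, hjk⟩ : ∃ j ∈ e, j ≠ k :=
    Finset.exists_mem_ne (by rw [h.card]; omega) k
  set f : Space d →ᵃ[ℝ] ℝ := AffineMap.const ℝ (Space d) 1 - bary e k with hf
  have hfx : ∀ x, f x = 1 - bary e k x := fun x => by simp [hf]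
  have hfk : f k = 0 := by rw [hfx, bary_self h hk, sub_self]
  have hg : grad f = - grad (bary e k) := grad_const_sub _ _
  have hg0 : grad f ≠ 0 := fun h0 => by
    have := apply_sub_apply f k j
    rw [hfk, hfx, bary_ne h hj hjk.symm, h0, inner_zero_left] at this
    norm_num at this
  have hae : coneOver f k (openFacet e k) =ᵐ[volume] openSimplex e := by
    filter_upwards [ae_bary_ne h] with x hx
    refine propext ?_
    change x ∈ coneOver f k (openFacet e k) ↔ x ∈ openSimplex e
    have hl : ∀ c : ℝ, ∀ l, l ≠ k → bary e l (k + c • (x - k)) = c * bary e l x :=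
      fun c l hlk => by
        rw [apply_homothety, bary_ne h hk hlk]; ring
    constructor
    · rintro ⟨h0, h1, -, h2⟩ l hle
      by_cases hlk : l = k
      · rw [hfx] at h1
        rw [hlk]
        exact lt_of_le_of_ne (by linarith) (hx.1 k hk).symm
      · have := h2 l hle hlk
        rw [hl _ l hlk] at this
        exact pos_of_mul_pos_right this (inv_pos.2 h0).le
    · intro hxe
      have h0 : 0 < f x := by
        have h1 := sum_bary h x
        rw [← Finset.add_sum_erase e _ hk] at h1
        have h2 : 0 < ∑ l ∈ e.erase k, bary e l x :=
          Finset.sum_pos (fun l hl => hxe l (Finset.mem_of_mem_erase hl))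
            ⟨j, Finset.mem_erase.2 ⟨hjk, hj⟩⟩
        rw [hfx]
        linarith
      refine ⟨h0, ?_, ?_, fun l hle hlk => ?_⟩
      · rw [hfx]
        linarith [hxe k hk]
      · rw [apply_homothety, bary_self h hk, inv_mul_eq_div, ← neg_sub, ← hfx, neg_div,
          div_self h0.ne']
        ring
      · rw [hl _ l hlk]
        exact mul_pos (inv_pos.2 h0) (hxe l hle)
  rw [area_eq_volume_coneOver hd hfk hg0 (measurableSet_openFacet e k), measure_congr hae, hg,
    norm_neg, ← ofReal_measureReal (volume_ne_top_of_subset h fun x hx l hl => (hx l hl).le),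
    ← ENNReal.ofReal_mul (by positivity)]
  · congr 1
    rw [simplexVolume]
    ring
  · intro x hx
    rw [hfx, hx.1, sub_zero]

end Parts

/-! ### Smooth boundary points -/

section Normal

variable {d : ℕ} {K : Set (Space d)} {x ν : Space d}

theorem eventually_line {p : Space d → Prop} (v : Space d) (h : ∀ᶠ y in nhds x, p y) :
    ∀ᶠ t : ℝ in nhdsWithin 0 (Set.Ioi 0), p (x + t • v) := by
  have hc : Filter.Tendsto (fun t : ℝ => x + t • v) (nhds 0) (nhds x) := by
    have : Continuous fun t : ℝ => x + t • v := by fun_prop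
    simpa using this.tendsto 0
  exact (hc.eventually h).filter_mono nhdsWithin_le_nhds

theorem mem_frontier_of_eventually (hν : ν ≠ 0)
    (h : ∀ᶠ y in nhds x, (y ∈ K ↔ inner ℝ ν (y - x) ≤ 0)) : x ∈ frontier K := by
  refine ⟨subset_closure (h.self_of_nhds.2 (by simp)), fun hx => ?_⟩
  have h1 := h.and (mem_interior_iff_mem_nhds.1 hx)
  obtain ⟨t, ht, ht0⟩ := ((eventually_line ν h1).and self_mem_nhdsWithin).exists
  have h2 := ht.1.1 ht.2
  rw [add_sub_cancel_left, inner_smul_right, real_inner_self_eq_norm_sq] at h2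
  have h3 : 0 < t * ‖ν‖ ^ 2 := mul_pos ht0 (pow_pos (norm_pos_iff.2 hν) 2)
  linarith

/-- Half-spaces through x are invariant under dilation from x, so an inclusion that holds near x
holds globally: it is tested at x + t z with a small t > 0. -/
theorem inner_nonpos_of_eventually {ν' : Space d}
    (h : ∀ᶠ y in nhds x, (y ∈ K ↔ inner ℝ ν (y - x) ≤ 0))
    (h' : ∀ᶠ y in nhds x, (y ∈ K ↔ inner ℝ ν' (y - x) ≤ 0)) {z : Space d}
    (hz : inner ℝ ν z ≤ 0) : inner ℝ ν' z ≤ 0 := by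
  obtain ⟨t, ht, ht0⟩ := ((eventually_line z (h.and h')).and self_mem_nhdsWithin).exists
  rw [add_sub_cancel_left, inner_smul_right, inner_smul_right] at ht
  have h1 := ht.2.1 (ht.1.2 (mul_nonpos_of_nonneg_of_nonpos (le_of_lt ht0) hz))
  exact nonpos_of_mul_nonpos_right h1 ht0

theorem outerUnitNormal_eq (hν : ‖ν‖ = 1)
    (h : ∀ᶠ y in nhds x, (y ∈ K ↔ inner ℝ ν (y - x) ≤ 0)) : outerUnitNormal K x = ν := by
  have hex : ∃ ν : Space d, ‖ν‖ = 1 ∧ ∀ᶠ y in nhds x, (y ∈ K ↔ inner ℝ ν (y - x) ≤ 0) :=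
    ⟨ν, hν, h⟩
  rw [outerUnitNormal, dif_pos hex]
  obtain ⟨hμ, hμ'⟩ := hex.choose_spec
  set μ := hex.choose
  -- The first test vector is orthogonal to ν and yields ⟪ν, μ⟫² ≥ 1; the second is -ν and yields
  -- ⟪ν, μ⟫ ≥ 0. For unit vectors this forces μ = ν.
  have h1 := inner_nonpos_of_eventually h hμ' (z := μ - inner ℝ ν μ • ν) (by
    rw [inner_sub_right, inner_smul_right, real_inner_self_eq_norm_sq, hν]
    simp)
  have h2 := inner_nonpos_of_eventually h hμ' (z := -ν) (by
    rw [inner_neg_right, real_inner_self_eq_norm_sq, hν]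
    simp)
  rw [inner_sub_right, inner_smul_right, real_inner_self_eq_norm_sq, hμ,
    real_inner_comm ν μ] at h1
  rw [inner_neg_right, real_inner_comm ν μ] at h2
  have h3 : inner ℝ ν μ = 1 := le_antisymm (by
    simpa [hν, hμ] using real_inner_le_norm ν μ) (by nlinarith)
  exact ((inner_eq_one_iff_of_norm_eq_one hν hμ).1 h3).symm

end Normal

/-! ### Control volumes and their interfaces -/

namespace SimplicialMesh

open MeasureTheory

variable {d : ℕ} (T : SimplicialMesh d) {e e' : Finset (Space d)} {x : Space d}

/-- The elements that contain a given point as a vertex. -/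
def star (j : Space d) : Finset (Finset (Space d)) :=
  Set.Finite.toFinset (s := {e ∈ T.elements | j ∈ e})
    ((T.finite_faces_of_mem j).subset fun _ he => ⟨he.1.1, he.2⟩)

variable {T}

theorem mem_star {j : Space d} : e ∈ T.star j ↔ e ∈ T.elements ∧ j ∈ e := by
  simp [star]

theorem isSimplex (he : e ∈ T.elements) : IsSimplex e := ⟨T.indep he.1, he.2⟩

/-- By conformity a common point of two elements lies in the hull of their common vertices. Its
weights there, extended by zero, are its coordinates in both elements; the convention that `bary`
vanishes off the vertices makes this valid for every l. -/
theorem bary_eq_bary (he : e ∈ T.elements) (he' : e' ∈ T.elements)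
    (hx : ∀ l ∈ e, 0 ≤ bary e l x) (hx' : ∀ l ∈ e', 0 ≤ bary e' l x) (l : Space d) :
    bary e l x = bary e' l x := by
  classical
  have hs := isSimplex he
  have hs' := isSimplex he'
  have hxi := T.inter_subset_convexHull he.1 he'.1
    ⟨(mem_convexHull_iff_bary hs).2 hx, (mem_convexHull_iff_bary hs').2 hx'⟩
  rw [← Finset.coe_inter, Finset.mem_convexHull'] at hxi
  obtain ⟨γ, -, g1, gx⟩ := hxi
  have key : ∀ s, IsSimplex s → e ∩ e' ⊆ s →
      bary s l x = if l ∈ e ∩ e' then γ l else 0 := by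
    intro s hs hsub
    by_cases hl : l ∈ s
    · refine bary_unique hs (α := fun l => if l ∈ e ∩ e' then γ l else 0) ?_ ?_ hl
      · rw [← Finset.sum_filter, Finset.filter_mem_eq_inter, Finset.inter_eq_right.2 hsub, g1]
      · simp only [ite_smul, zero_smul]
        rw [← Finset.sum_filter, Finset.filter_mem_eq_inter, Finset.inter_eq_right.2 hsub, gx]
    · rw [bary_of_notMem hl, if_neg fun h => hl (hsub h)]
      rfl
  rw [key e hs Finset.inter_subset_left, key e' hs' Finset.inter_subset_right]

theorem mem_of_bary_pos (he : e ∈ T.elements) (he' : e' ∈ T.elements)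
    (hx : ∀ l ∈ e, 0 ≤ bary e l x) (hx' : ∀ l ∈ e', 0 ≤ bary e' l x) {l : Space d}
    (hl : 0 < bary e l x) : l ∈ e' := by
  by_contra h
  rw [bary_eq_bary he he' hx hx', bary_of_notMem h] at hl
  exact lt_irrefl _ hl

theorem eq_of_mem_openSimplex (he : e ∈ T.elements) (he' : e' ∈ T.elements)
    (hx : x ∈ openSimplex e) (hx' : ∀ l ∈ e', 0 ≤ bary e' l x) : e = e' := by
  refine Finset.eq_of_subset_of_card_le (fun l hl => ?_) (by rw [he.2, he'.2])
  exact mem_of_bary_pos he he' (fun l hl => (hx l hl).le) hx' (hx l hl)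

theorem controlVolume_eq (j : T.Node) :
    T.controlVolume j = ⋃ e ∈ T.star j.1, simplexCell e j.1 := by
  ext x
  simp only [Set.mem_iUnion, exists_prop, controlVolume, Set.mem_ofPred_eq, mem_star]
  constructor
  · rintro ⟨e, he, hj, α, h0, h1, hx, hm⟩
    refine ⟨e, ⟨he, hj⟩, fun l hl => ?_⟩
    rw [bary_unique (isSimplex he) h1 hx hl, bary_unique (isSimplex he) h1 hx hj]
    exact ⟨h0 l hl, hm l hl⟩
  · rintro ⟨e, ⟨he, hj⟩, hx⟩
    exact ⟨e, he, hj, fun l => bary e l x, fun l hl => (hx l hl).1, sum_bary (isSimplex he) x,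
      sum_bary_smul (isSimplex he) x, fun l hl => (hx l hl).2⟩

theorem bary_pos_of_mem_simplexCell (hs : IsSimplex e) {j : Space d}
    (hx : x ∈ simplexCell e j) : 0 < bary e j x := by
  by_contra! h
  have h1 := sum_bary hs x
  rw [Finset.sum_eq_zero fun l hl => le_antisymm ((hx l hl).2.trans h) (hx l hl).1] at h1
  exact zero_ne_one h1

/-- A largest coordinate is positive, so conformity makes each of the two nodes a vertex of both
elements. Each of the two coordinates then bounds the other. -/
theorem exists_closedPiece {j k : T.Node} (hj : x ∈ T.controlVolume j)
    (hk : x ∈ T.controlVolume k) : ∃ e ∈ T.star j.1, k.1 ∈ e ∧ x ∈ closedPiece e j.1 k.1 := by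
  simp only [controlVolume_eq, Set.mem_iUnion, exists_prop, mem_star] at hj hk
  obtain ⟨e, ⟨he, hje⟩, hx⟩ := hj
  obtain ⟨e', ⟨he', hke⟩, hx'⟩ := hk
  have heq := bary_eq_bary he he' (fun l hl => (hx l hl).1) (fun l hl => (hx' l hl).1)
  have hje' : j.1 ∈ e' := mem_of_bary_pos he he' (fun l hl => (hx l hl).1)
    (fun l hl => (hx' l hl).1) (bary_pos_of_mem_simplexCell (isSimplex he) hx)
  have hke' : k.1 ∈ e := mem_of_bary_pos he' he (fun l hl => (hx' l hl).1)
    (fun l hl => (hx l hl).1) (bary_pos_of_mem_simplexCell (isSimplex he') hx')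
  refine ⟨e', mem_star.2 ⟨he', hje'⟩, hke, hx', le_antisymm (hx' _ hje').2 ?_⟩
  rw [← heq, ← heq]
  exact (hx _ hke').2

theorem eventually_mem_controlVolume {j : T.Node} (he : e ∈ T.star j.1)
    (hx : x ∈ openSimplex e) :
    ∀ᶠ y in nhds x, (y ∈ T.controlVolume j ↔ ∀ l ∈ e, bary e l y ≤ bary e j.1 y) := by
  filter_upwards [(isOpen_openSimplex e).mem_nhds hx] with y hy
  have he1 := mem_star.1 he
  rw [controlVolume_eq]
  simp only [Set.mem_iUnion, exists_prop]
  constructor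
  · rintro ⟨e', he', hy'⟩
    have := eq_of_mem_openSimplex he1.1 (mem_star.1 he').1 hy fun l hl => (hy' l hl).1
    subst this
    exact fun l hl => (hy' l hl).2
  · exact fun h => ⟨e, he, fun l hl => ⟨(hy l hl).le, h l hl⟩⟩

theorem openPiece_comm (e : Finset (Space d)) (j k : Space d) :
    openPiece e j k = openPiece e k j := by
  ext x
  constructor <;>
  · rintro ⟨h0, h1, h2⟩
    exact ⟨h0, h1.symm, fun l hl hk hj => h1 ▸ h2 l hl hj hk⟩

/-- The strict inequalities against the remaining vertices persist near x. Only the comparison of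
the coordinates of j and k is left, and their difference is affine and vanishes at x. -/
theorem eventually_mem_of_openPiece {j : T.Node} {k : Space d} (he : e ∈ T.star j.1) (hk : k ∈ e)
    (hx : x ∈ openPiece e j.1 k) : ∀ᶠ y in nhds x, (y ∈ T.controlVolume j ↔
      inner ℝ (grad (bary e k) - grad (bary e j.1)) (y - x) ≤ 0) := by
  have hstrict : ∀ᶠ y in nhds x, ∀ l ∈ e, l ≠ j.1 → l ≠ k → bary e l y < bary e j.1 y := by
    rw [Filter.eventually_all_finset]
    intro l hl
    by_cases h : l ≠ j.1 ∧ l ≠ k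
    · filter_upwards [(continuous_affine (bary e l)).continuousAt.eventually_lt
        (continuous_affine (bary e j.1)).continuousAt
        (hx.2.1 ▸ hx.2.2 l hl h.1 h.2)] with y hy _ _ using hy
    · exact .of_forall fun y h1 h2 => absurd ⟨h1, h2⟩ h
  filter_upwards [eventually_mem_controlVolume he hx.1, hstrict] with y hy hy'
  rw [hy, inner_sub_left, ← apply_sub_apply, ← apply_sub_apply, hx.2.1]
  constructor
  · intro h
    have := h k hk
    linarith
  · intro h l hl
    by_cases hlj : l = j.1
    · rw [hlj]
    by_cases hlk : l = k
    · rw [hlk]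
      linarith
    · exact (hy' l hl hlj hlk).le

theorem openPiece_subset_interface {j k : T.Node} (hjk : j ≠ k) (he : e ∈ T.star j.1)
    (hk : k.1 ∈ e) : openPiece e j.1 k.1 ⊆ T.interface j k := by
  have he1 := mem_star.1 he
  have hs := isSimplex he1.1
  have hne : j.1 ≠ k.1 := fun h => hjk (Subtype.ext h)
  intro x hx
  refine ⟨mem_frontier_of_eventually (grad_sub_ne_zero hs he1.2 hk hne)
    (eventually_mem_of_openPiece he hk hx), ?_⟩
  rw [openPiece_comm] at hx
  exact mem_frontier_of_eventually (grad_sub_ne_zero hs hk he1.2 hne.symm)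
    (eventually_mem_of_openPiece (mem_star.2 ⟨he1.1, hk⟩) he1.2 hx)

theorem outerUnitNormal_of_openPiece {j k : T.Node} (hjk : j ≠ k) (he : e ∈ T.star j.1)
    (hk : k.1 ∈ e) (hx : x ∈ openPiece e j.1 k.1) : outerUnitNormal (T.controlVolume j) x =
      ‖grad (bary e k.1) - grad (bary e j.1)‖⁻¹ • (grad (bary e k.1) - grad (bary e j.1)) := by
  have he1 := mem_star.1 he
  have hne : j.1 ≠ k.1 := fun h => hjk (Subtype.ext h)
  have h0 := norm_pos_iff.2 (grad_sub_ne_zero (isSimplex he1.1) he1.2 hk hne)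
  refine outerUnitNormal_eq ?_ ?_
  · rw [norm_smul, norm_inv, norm_norm, inv_mul_cancel₀ h0.ne']
  · filter_upwards [eventually_mem_of_openPiece he hk hx] with y hy
    rw [hy, inner_smul_left]
    simp only [map_inv₀, conj_trivial]
    exact (mul_nonpos_iff_pos_imp_nonpos.trans (by simp [h0, inv_pos])).symm

-- A common point of two control volumes lies in a closed piece, and closed pieces exceed open ones
-- by zero area; conversely, open pieces consist of smooth boundary points of both volumes. The
-- frontiers themselves need no exact description.
open Classical in
theorem interface_ae_eq (hd : 1 ≤ d) {j k : T.Node} (hjk : j ≠ k) :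
    T.interface j k =ᵐ[μHE[d - 1]]
      ⋃ e ∈ (T.star j.1).filter (k.1 ∈ ·), openPiece e j.1 k.1 := by
  have hne : j.1 ≠ k.1 := fun h => hjk (Subtype.ext h)
  have hnull : ∀ᵐ x ∂(μHE[d - 1] : Measure (Space d)), ∀ e ∈ (T.star j.1).filter (k.1 ∈ ·),
      x ∈ closedPiece e j.1 k.1 → x ∈ openPiece e j.1 k.1 := by
    rw [Filter.eventually_all_finset]
    intro e he
    obtain ⟨he, hk⟩ := Finset.mem_filter.1 he
    have he1 := mem_star.1 he
    have := area_closedPiece_diff hd (isSimplex he1.1) he1.2 hk hne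
    rw [ae_iff]
    convert this using 2
    ext x
    simp
  filter_upwards [hnull] with x hx
  refine propext ?_
  change x ∈ T.interface j k ↔ x ∈ ⋃ e ∈ (T.star j.1).filter (k.1 ∈ ·), openPiece e j.1 k.1
  simp only [Set.mem_iUnion, exists_prop]
  constructor
  · rintro ⟨h1, h2⟩
    obtain ⟨e, he, hk, hxe⟩ := exists_closedPiece ((T.isClosed_controlVolume j).frontier_subset h1)
      ((T.isClosed_controlVolume k).frontier_subset h2)
    have he' : e ∈ (T.star j.1).filter (k.1 ∈ ·) := Finset.mem_filter.2 ⟨he, hk⟩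
    exact ⟨e, he', hx e he' hxe⟩
  · rintro ⟨e, he, hxe⟩
    obtain ⟨he, hk⟩ := Finset.mem_filter.1 he
    exact openPiece_subset_interface hjk he hk hxe

-- The normal is constant on each piece, and its normalizing factor cancels the norm in the area of
-- the piece.
open Classical in
theorem faceNormal_eq (hd : 1 ≤ d) {j k : T.Node} (hjk : j ≠ k) :
    T.faceNormal j k = ∑ e ∈ (T.star j.1).filter (k.1 ∈ ·),
      (simplexVolume e / (d + 1)) • (grad (bary e k.1) - grad (bary e j.1)) := by
  have hne : j.1 ≠ k.1 := fun h => hjk (Subtype.ext h)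
  have hconst : ∀ e ∈ (T.star j.1).filter (k.1 ∈ ·), Set.EqOn (outerUnitNormal (T.controlVolume j))
      (fun _ => ‖grad (bary e k.1) - grad (bary e j.1)‖⁻¹ •
        (grad (bary e k.1) - grad (bary e j.1))) (openPiece e j.1 k.1) := fun e he x hx => by
    obtain ⟨he, hk⟩ := Finset.mem_filter.1 he
    exact outerUnitNormal_of_openPiece hjk he hk hx
  rw [faceNormal, setIntegral_congr_set (interface_ae_eq hd hjk), integral_biUnion_finset]
  · refine Finset.sum_congr rfl fun e he => ?_
    rw [setIntegral_congr_fun (measurableSet_openPiece e j.1 k.1) (hconst e he), setIntegral_const]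
    obtain ⟨he, hk⟩ := Finset.mem_filter.1 he
    have he1 := mem_star.1 he
    have hs := isSimplex he1.1
    have h0 := norm_pos_iff.2 (grad_sub_ne_zero hs he1.2 hk hne)
    rw [measureReal_def, area_openPiece hd hs he1.2 hk hne, ENNReal.toReal_ofReal
      (mul_nonneg h0.le (div_nonneg (simplexVolume_pos hs).le (by positivity))), smul_smul]
    congr 1
    field_simp
  · exact fun e _ => measurableSet_openPiece e j.1 k.1
  · intro e he e' he' hee'
    refine Set.disjoint_left.2 fun x hx hx' => hee' ?_
    have he1 := mem_star.1 (Finset.mem_filter.1 (Finset.mem_coe.1 he)).1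
    have he1' := mem_star.1 (Finset.mem_filter.1 (Finset.mem_coe.1 he')).1
    exact eq_of_mem_openSimplex he1.1 he1'.1 hx.1 fun l hl => (hx'.1 l hl).le
  · intro e he
    rw [integrableOn_congr_fun (hconst e he) (measurableSet_openPiece e j.1 k.1)]
    obtain ⟨he, hk⟩ := Finset.mem_filter.1 he
    have he1 := mem_star.1 he
    refine integrableOn_const ?_
    rw [area_openPiece hd (isSimplex he1.1) he1.2 hk hne]
    exact ENNReal.ofReal_ne_top

/-- Every shared element contributes a piece of positive area, and without one the interface is
null. From here on the neighbour relation is purely combinatorial. -/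
theorem mem_neighbors_iff (hd : 1 ≤ d) {j k : T.Node} :
    k ∈ T.neighbors j ↔ k ≠ j ∧ ∃ e ∈ T.star j.1, k.1 ∈ e := by
  classical
  refine and_congr_right fun hkj => ?_
  have hne : j.1 ≠ k.1 := fun h => hkj (Subtype.ext h.symm)
  constructor
  · intro h
    by_contra! hno
    refine h ?_
    rw [measure_congr (interface_ae_eq hd hkj.symm), Finset.filter_eq_empty_iff.2
      fun e he => hno e he]
    simp
  · rintro ⟨e, he, hk⟩ h0
    have he1 := mem_star.1 he
    have hs := isSimplex he1.1
    have h1 := measure_mono_null (openPiece_subset_interface hkj.symm he hk) h0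
    rw [area_openPiece hd hs he1.2 hk hne, ENNReal.ofReal_eq_zero] at h1
    have h2 := norm_pos_iff.2 (grad_sub_ne_zero hs he1.2 hk hne)
    have h3 := mul_pos h2 (div_pos (simplexVolume_pos hs) (by positivity : (0 : ℝ) < d + 1))
    linarith

theorem faceNormal_comm (hd : 1 ≤ d) (j k : T.Node) (hjk : j ≠ k) :
    T.faceNormal k j = - T.faceNormal j k := by
  classical
  rw [faceNormal_eq hd hjk, faceNormal_eq hd hjk.symm, ← Finset.sum_neg_distrib]
  refine Finset.sum_congr ?_ fun e _ => by rw [← smul_neg, neg_sub]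
  ext e
  simp only [Finset.mem_filter, mem_star]
  tauto

theorem cellVolume_eq (j : T.Node) :
    T.cellVolume j = ∑ e ∈ T.star j.1, simplexVolume e / (d + 1) := by
  rw [cellVolume, controlVolume_eq, measureReal_def, measure_biUnion_finset₀,
    ENNReal.toReal_sum]
  · refine Finset.sum_congr rfl fun e he => ?_
    have he1 := mem_star.1 he
    exact volume_real_simplexCell (isSimplex he1.1) he1.2
  · intro e he
    exact volume_ne_top_of_subset (isSimplex (mem_star.1 he).1) fun x hx l hl => (hx l hl).1
  · intro e he e' he' hee'
    have he1 := mem_star.1 (Finset.mem_coe.1 he)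
    have he1' := mem_star.1 (Finset.mem_coe.1 he')
    refine measure_mono_null ?_ (ae_iff.1 (ae_bary_ne (isSimplex he1.1)))
    rintro x ⟨hx, hx'⟩ hgen
    exact hee' (eq_of_mem_openSimplex he1.1 he1'.1
      (fun l hl => lt_of_le_of_ne (hx l hl).1 (hgen.1 l hl).symm) fun l hl => (hx' l hl).1)
  · exact fun e _ => (measurableSet_simplexCell e j.1).nullMeasurableSet

end SimplicialMesh

/-! ### Adjacent simplices -/

section Facets

variable {d : ℕ} {e e' : Finset (Space d)} {k k' l : Space d}

/-- The barycenter of the `d` points of `s`. -/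
def facetCenter (s : Finset (Space d)) : Space d := ∑ l ∈ s, (d : ℝ)⁻¹ • l

open Classical in
theorem bary_facetCenter (hd : 1 ≤ d) (h : IsSimplex e) (hk : k ∈ e) (hl : l ∈ e) :
    bary e l (facetCenter (e.erase k)) = if l = k then 0 else (d : ℝ)⁻¹ := by
  have hd0 : (d : ℝ) ≠ 0 := by positivity
  refine bary_unique h (α := fun l => if l = k then 0 else (d : ℝ)⁻¹) ?_ ?_ hl
  · rw [← Finset.add_sum_erase e _ hk, if_pos rfl, zero_add,
      Finset.sum_congr rfl fun m hm => if_neg (Finset.ne_of_mem_erase hm), Finset.sum_const,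
      Finset.card_erase_of_mem hk, h.card, nsmul_eq_mul, Nat.add_sub_cancel, mul_inv_cancel₀ hd0]
  · rw [← Finset.add_sum_erase e _ hk, if_pos rfl, zero_smul, zero_add]
    exact Finset.sum_congr rfl fun m hm => by rw [if_neg (Finset.ne_of_mem_erase hm)]

/-- Both functions vanish on the vertices of the common facet, hence are proportional, with the
factor read off at k. The sign of the factor tells whether the two simplices lie on the same side of
the facet. -/
theorem bary_opposite (h : IsSimplex e) (h' : IsSimplex e') (hk : k ∈ e)
    (hF : e'.erase k' = e.erase k) : bary e' k' = bary e' k' k • bary e k := by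
  ext x
  rw [affine_eq_sum h (bary e' k') x, ← Finset.add_sum_erase e _ hk, Finset.sum_eq_zero, add_zero,
    AffineMap.coe_smul, Pi.smul_apply, smul_eq_mul, mul_comm]
  intro l hl
  rw [← hF, Finset.mem_erase] at hl
  rw [bary_ne h' hl.2 hl.1.symm, mul_zero]

theorem openFacet_subset (h : IsSimplex e) (h' : IsSimplex e') (hk : k ∈ e)
    (hF : e'.erase k' = e.erase k) : openFacet e k ⊆ openFacet e' k' := by
  rintro x ⟨h0, h1⟩
  refine ⟨?_, fun l hl hlk => ?_⟩
  · rw [bary_opposite h h' hk hF, AffineMap.coe_smul, Pi.smul_apply, h0, smul_zero]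
  · have hl' : l ∈ e.erase k := hF ▸ Finset.mem_erase.2 ⟨hlk, hl⟩
    have hl2 := Finset.mem_erase.1 hl'
    rw [affine_eq_sum h (bary e' l) x, Finset.sum_eq_single_of_mem l hl2.2, bary_self h' hl, mul_one]
    · exact h1 l hl2.2 hl2.1
    · intro m hm hml
      by_cases hmk : m = k
      · rw [hmk, h0, zero_mul]
      · have : m ∈ e'.erase k' := hF ▸ Finset.mem_erase.2 ⟨hmk, hm⟩
        rw [bary_ne h' (Finset.mem_of_mem_erase this) hml.symm, mul_zero]

theorem grad_bary_ne_zero (hd : 1 ≤ d) (h : IsSimplex e) (hk : k ∈ e) : grad (bary e k) ≠ 0 := by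
  obtain ⟨j, hj, hjk⟩ : ∃ j ∈ e, j ≠ k :=
    Finset.exists_mem_ne (by rw [h.card]; omega) k
  intro h0
  have := apply_sub_apply (bary e k) j k
  rw [bary_self h hk, bary_ne h hj hjk.symm, h0, inner_zero_left] at this
  norm_num at this

/-- Computing the area of the common facet from both sides gives |e| ‖∇λ_k‖ = |e'| ‖∇λ'_k'‖, and the
two gradients point in opposite directions. -/
theorem volume_smul_grad (hd : 1 ≤ d) (h : IsSimplex e) (h' : IsSimplex e') (hk : k ∈ e)
    (hk' : k' ∈ e') (hF : e'.erase k' = e.erase k) (hneg : bary e' k' k < 0) :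
    simplexVolume e • grad (bary e k) + simplexVolume e' • grad (bary e' k') = 0 := by
  have hg := norm_pos_iff.2 (grad_bary_ne_zero hd h hk)
  have hd0 : (0 : ℝ) < d := by positivity
  have hgrad : grad (bary e' k') = bary e' k' k • grad (bary e k) := by
    conv_lhs => rw [bary_opposite h h' hk hF]
    rw [grad_smul]
  have harea := area_openFacet hd h' hk'
  rw [(openFacet_subset h' h hk' hF.symm).antisymm (openFacet_subset h h' hk hF),
    area_openFacet hd h hk, ENNReal.ofReal_eq_ofReal_iff
      (mul_nonneg hd0.le (mul_nonneg (simplexVolume_pos h).le (norm_nonneg _)))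
      (mul_nonneg hd0.le (mul_nonneg (simplexVolume_pos h').le (norm_nonneg _))),
    hgrad, norm_smul, Real.norm_eq_abs, abs_of_neg hneg] at harea
  have hV : simplexVolume e = - (simplexVolume e' * bary e' k' k) := by
    have h1 := mul_left_cancel₀ hd0.ne' harea
    rw [← mul_assoc] at h1
    have h2 := mul_right_cancel₀ hg.ne' h1
    linarith
  rw [hgrad, hV, smul_smul, ← add_smul, neg_add_cancel, zero_smul]

end Facets

namespace SimplicialMesh

variable {d : ℕ} {T : SimplicialMesh d} {e e' : Finset (Space d)} {k k' : Space d}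

/-- A point moved slightly from the facet center towards k lies in e and in the interior of e'; an
interior point of an element belongs to no other element. -/
theorem eq_of_same_side (hd : 1 ≤ d) (he : e ∈ T.elements) (he' : e' ∈ T.elements) (hk : k ∈ e)
    (hF : e'.erase k' = e.erase k) (hpos : 0 < bary e' k' k) : e = e' := by
  have h := isSimplex he
  have h' := isSimplex he'
  have hd0 : (0 : ℝ) < (d : ℝ)⁻¹ := by positivity
  by_cases hk' : k' ∈ e'
  swap
  · rw [bary_of_notMem hk'] at hpos
    exact absurd hpos (lt_irrefl _)
  set x := facetCenter (e.erase k) with hx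
  have hev : ∀ᶠ y in nhds x, ∀ l ∈ e', l ≠ k' → 0 < bary e' l y := by
    rw [Filter.eventually_all_finset]
    intro l hl
    by_cases hlk : l = k'
    · exact .of_forall fun y h => absurd hlk h
    have h0 : 0 < bary e' l x := by
      rw [hx, ← hF, bary_facetCenter hd h' hk' hl, if_neg hlk]
      exact hd0
    filter_upwards [(continuous_affine (bary e' l)).continuousAt.eventually_const_lt h0]
      with y hy _ using hy
  have hlt : ∀ᶠ t : ℝ in nhdsWithin 0 (Set.Ioi 0), t < 1 :=
    (eventually_lt_nhds one_pos).filter_mono nhdsWithin_le_nhds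
  obtain ⟨t, ⟨ht, ht1⟩, ht0⟩ :=
    (((eventually_line (k - x) hev).and hlt).and self_mem_nhdsWithin).exists
  have ht0' : 0 < t := ht0
  have hy : ∀ l ∈ e, 0 ≤ bary e l (x + t • (k - x)) := fun l hl => by
    rw [apply_homothety, hx, bary_facetCenter hd h hk hl]
    by_cases hlk : l = k
    · rw [if_pos hlk, hlk, bary_self h hk]
      linarith
    · rw [if_neg hlk, bary_ne h hk hlk]
      nlinarith
  refine (eq_of_mem_openSimplex he' he (fun l hl => ?_) hy).symm
  by_cases hlk : l = k'
  · rw [hlk, bary_opposite h h' hk hF, AffineMap.coe_smul, Pi.smul_apply, smul_eq_mul,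
      apply_homothety, hx, bary_facetCenter hd h hk hk, if_pos rfl, bary_self h hk]
    simpa using mul_pos hpos ht0'
  · exact ht l hl hlk

theorem bary_neg_of_ne (hd : 1 ≤ d) (he : e ∈ T.elements) (he' : e' ∈ T.elements) (hk : k ∈ e)
    (hk' : k' ∈ e') (hF : e'.erase k' = e.erase k) (hne : e' ≠ e) : bary e' k' k < 0 := by
  rcases lt_trichotomy (bary e' k' k) 0 with h | h | h
  · exact h
  · have h1 := bary_opposite (isSimplex he) (isSimplex he') hk hF
    rw [h, zero_smul] at h1
    have h2 := bary_self (isSimplex he') hk'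
    rw [h1] at h2
    simp at h2
  · exact absurd (eq_of_same_side hd he he' hk hF h).symm hne

/-- Both e₁ and e₂ lie across the facet from e, hence on the same side of it. Uniqueness of the
element across a facet is what makes the pairing in `sum_facets` an involution. -/
theorem eq_of_both_ne (hd : 1 ≤ d) (he : e ∈ T.elements) (hk : k ∈ e)
    {e₁ e₂ : Finset (Space d)} {k₁ k₂ : Space d} (he₁ : e₁ ∈ T.elements) (he₂ : e₂ ∈ T.elements)
    (hk₁ : k₁ ∈ e₁) (hk₂ : k₂ ∈ e₂) (hF₁ : e₁.erase k₁ = e.erase k)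
    (hF₂ : e₂.erase k₂ = e.erase k) (hne₁ : e₁ ≠ e) (hne₂ : e₂ ≠ e) : e₁ = e₂ ∧ k₁ = k₂ := by
  have c₁ := bary_neg_of_ne hd he he₁ hk hk₁ hF₁ hne₁
  have c₂ := bary_neg_of_ne hd he he₂ hk hk₂ hF₂ hne₂
  have hb₁ := congrArg (fun f => f k₁) (bary_opposite (isSimplex he) (isSimplex he₁) hk hF₁)
  have hb₂ := congrArg (fun f => f k₁) (bary_opposite (isSimplex he) (isSimplex he₂) hk hF₂)
  simp only [AffineMap.coe_smul, Pi.smul_apply, smul_eq_mul, bary_self (isSimplex he₁) hk₁] at hb₁ hb₂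
  have hneg : bary e k k₁ < 0 := by
    by_contra! h
    have := mul_nonpos_of_nonpos_of_nonneg c₁.le h
    linarith
  have hpos : 0 < bary e₂ k₂ k₁ := hb₂ ▸ mul_pos_of_neg_of_neg c₂ hneg
  have heq := eq_of_same_side hd he₁ he₂ hk₁ (hF₂.trans hF₁.symm) hpos
  subst heq
  refine ⟨rfl, ?_⟩
  by_contra hkk
  have h1 : k₁ ∈ e₁.erase k₂ := Finset.mem_erase.2 ⟨hkk, hk₁⟩
  rw [hF₂, ← hF₁] at h1
  exact Finset.notMem_erase _ _ h1

/-- Points slightly beyond the facet center, seen from k, are covered by finitely many elements, so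
one element contains such points arbitrarily close to the center. Being closed, it contains the
center and therefore all vertices of the facet. It differs from e because the coordinate of k is
negative beyond the facet. -/
theorem exists_adjacent (hd : 1 ≤ d) (he : e ∈ T.elements) (hk : k ∈ e) :
    ∃ e' ∈ T.elements, ∃ k' ∈ e', e'.erase k' = e.erase k ∧ e' ≠ e := by
  have h := isSimplex he
  have hd0 : (0 : ℝ) < (d : ℝ)⁻¹ := by positivity
  set x := facetCenter (e.erase k) with hx
  obtain ⟨U, hU, hfin⟩ := T.locallyFinite x
  have hex : ∀ᶠ t : ℝ in nhdsWithin 0 (Set.Ioi 0), ∃ s ∈ hfin.toFinset,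
      s.1.card = d + 1 ∧ x + t • (x - k) ∈ convexHull ℝ (s.1 : Set (Space d)) := by
    filter_upwards [eventually_line (x - k) hU] with t ht
    obtain ⟨s, hs, hc, hxs⟩ := T.covers (x + t • (x - k))
    exact ⟨⟨s, hs⟩, hfin.mem_toFinset.2 ⟨_, hxs, ht⟩, hc, hxs⟩
  obtain ⟨⟨e', hf'⟩, -, hfreq⟩ := (Filter.frequently_exists_finset _).1 hex.frequently
  obtain ⟨t₀, hc, -⟩ := hfreq.exists
  have he' : e' ∈ T.elements := ⟨hf', hc⟩
  have h' := isSimplex he'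
  have hxe' : x ∈ convexHull ℝ (e' : Set (Space d)) := by
    by_contra hno
    have hcl : IsClosed (convexHull ℝ (e' : Set (Space d))) :=
      (e'.finite_toSet.isCompact_convexHull ℝ).isClosed
    refine hfreq ?_
    filter_upwards [eventually_line (x - k) (hcl.isOpen_compl.mem_nhds hno)] with t ht ht'
    exact ht ht'.2
  rw [mem_convexHull_iff_bary h'] at hxe'
  obtain ⟨t, ⟨-, ht⟩, ht0⟩ := (hfreq.and_eventually self_mem_nhdsWithin).exists
  have ht0' : 0 < t := ht0
  rw [mem_convexHull_iff_bary h'] at ht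
  have hxk : ∀ l ∈ e, bary e l x = if l = k then 0 else (d : ℝ)⁻¹ := fun l hl =>
    bary_facetCenter hd h hk hl
  have hsub : e.erase k ⊆ e' := fun l hl => by
    have hl' := Finset.mem_erase.1 hl
    refine mem_of_bary_pos he he' (x := x) (fun m hm => ?_) hxe' ?_
    · rw [hxk m hm]
      split_ifs <;> positivity
    · rw [hxk l hl'.2, if_neg hl'.1]
      exact hd0
  have hne : e' ≠ e := by
    rintro rfl
    have := ht k hk
    have h2 : x + t • (x - k) = x + (-t) • (k - x) := by module
    rw [h2, apply_homothety, hxk k hk, if_pos rfl, bary_self h hk] at this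
    linarith
  have hcard : (e' \ e.erase k).card = 1 := by
    rw [Finset.card_sdiff_of_subset hsub, Finset.card_erase_of_mem hk, h.card, h'.card]
    omega
  obtain ⟨k', hk'⟩ := Finset.card_eq_one.1 hcard
  have hk'e : k' ∈ e' \ e.erase k := by rw [hk']; exact Finset.mem_singleton_self _
  have hk'' := Finset.mem_sdiff.1 hk'e
  refine ⟨e', he', k', hk''.1, ?_, hne⟩
  rw [Finset.erase_eq, ← hk', Finset.sdiff_sdiff_eq_self hsub]

/-- The contributions of the two elements adjacent to a facet cancel. -/
theorem sum_facets (hd : 1 ≤ d) (j : Space d) (a : Fin d) (Y : Finset (Space d) → ℝ) :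
    ∑ e ∈ T.star j, ∑ k ∈ e.erase j,
      simplexVolume e * grad (bary e k) a * Y (e.erase k) = 0 := by
  classical
  rw [Finset.sum_sigma']
  -- A facet opposite to k ≠ j contains j, so the element across it is again in the star of j.
  have hex : ∀ p ∈ (T.star j).sigma fun e => e.erase j, ∃ q ∈ (T.star j).sigma fun e => e.erase j,
      q.1.erase q.2 = p.1.erase p.2 ∧ q.1 ≠ p.1 := by
    rintro ⟨e, k⟩ hp
    obtain ⟨he, hk⟩ := Finset.mem_sigma.1 hp
    have he := mem_star.1 he
    have hk := Finset.mem_erase.1 hk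
    obtain ⟨e', he', k', hk', hF, hne⟩ := exists_adjacent hd he.1 hk.2
    have hj : j ∈ e'.erase k' := hF ▸ Finset.mem_erase.2 ⟨hk.1.symm, he.2⟩
    have hj' := Finset.mem_erase.1 hj
    exact ⟨⟨e', k'⟩, Finset.mem_sigma.2 ⟨mem_star.2 ⟨he', hj'.2⟩,
      Finset.mem_erase.2 ⟨hj'.1.symm, hk'⟩⟩, hF, hne⟩
  choose g hgm hgF hgne using hex
  have hdata : ∀ p ∈ (T.star j).sigma fun e => e.erase j, p.1 ∈ T.elements ∧ p.2 ∈ p.1 :=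
    fun p hp => ⟨(mem_star.1 (Finset.mem_sigma.1 hp).1).1,
      Finset.mem_of_mem_erase (Finset.mem_sigma.1 hp).2⟩
  refine Finset.sum_involution g (fun p hp => ?_) (fun p hp _ h => hgne p hp (by rw [h])) hgm
    (fun p hp => ?_)
  · obtain ⟨he, hk⟩ := hdata p hp
    obtain ⟨he', hk'⟩ := hdata _ (hgm p hp)
    have := congrArg (fun v : Space d => v a)
      (volume_smul_grad hd (isSimplex he) (isSimplex he') hk hk' (hgF p hp)
      (bary_neg_of_ne hd he he' hk hk' (hgF p hp) (hgne p hp)))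
    simp only [PiLp.add_apply, PiLp.smul_apply, smul_eq_mul, PiLp.zero_apply] at this
    rw [hgF p hp, ← add_mul, this, zero_mul]
  · obtain ⟨he, hk⟩ := hdata p hp
    obtain ⟨he', hk'⟩ := hdata _ (hgm p hp)
    obtain ⟨he'', hk''⟩ := hdata _ (hgm _ (hgm p hp))
    obtain ⟨h1, h2⟩ := eq_of_both_ne hd he' hk' he'' he hk'' hk (hgF _ (hgm p hp))
      (hgF p hp).symm (hgne _ (hgm p hp)) (hgne p hp).symm
    exact Sigma.ext h1 (heq_of_eq h2)

end SimplicialMesh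

/-! ### Translation of simplices -/

section Shift

open MeasureTheory

variable {d : ℕ} {e : Finset (Space d)} {τ k l : Space d}

/-- The translate of a finite set of points. -/
def shift (e : Finset (Space d)) (τ : Space d) : Finset (Space d) := e.map (addRightEmbedding τ)

theorem mem_shift : k ∈ shift e τ ↔ k - τ ∈ e := by
  simp only [shift, Finset.mem_map, addRightEmbedding_apply]
  constructor
  · rintro ⟨a, ha, rfl⟩
    simpa using ha
  · exact fun h => ⟨_, h, sub_add_cancel _ _⟩

theorem add_mem_shift : k + τ ∈ shift e τ ↔ k ∈ e := by
  rw [mem_shift, add_sub_cancel_right]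

theorem shift_shift (σ : Space d) : shift (shift e τ) σ = shift e (τ + σ) := by
  ext k
  rw [mem_shift, mem_shift, mem_shift, sub_sub, add_comm σ τ]

theorem shift_zero : shift e 0 = e := by
  ext k
  rw [mem_shift, sub_zero]

theorem sum_shift {M : Type*} [AddCommMonoid M] (f : Space d → M) :
    ∑ l ∈ shift e τ, f l = ∑ l ∈ e, f (l + τ) := by
  simp [shift]

theorem shift_erase : (shift e τ).erase (k + τ) = shift (e.erase k) τ := by
  ext l
  simp only [Finset.mem_erase, mem_shift, ne_eq, sub_eq_iff_eq_add]

theorem bary_shift (h : IsSimplex e) (h' : IsSimplex (shift e τ)) (hl : l ∈ e) (x : Space d) :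
    bary (shift e τ) (l + τ) (x + τ) = bary e l x := by
  rw [bary_unique h' (α := fun m => bary e (m - τ) x) _ _ (add_mem_shift.2 hl),
    add_sub_cancel_right]
  · rw [sum_shift]
    simp_rw [add_sub_cancel_right]
    exact sum_bary h x
  · rw [sum_shift]
    simp_rw [add_sub_cancel_right, smul_add, Finset.sum_add_distrib, ← Finset.sum_smul,
      sum_bary_smul h, sum_bary h, one_smul]

theorem grad_bary_shift (h : IsSimplex e) (h' : IsSimplex (shift e τ)) (hl : l ∈ e) :
    grad (bary (shift e τ) (l + τ)) = grad (bary e l) := by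
  refine grad_eq_of_sub_eq fun x y => ?_
  rw [← apply_sub_apply, ← bary_shift h h' hl, ← bary_shift h h' hl, apply_sub_apply,
    apply_sub_apply, add_sub_add_right_eq_sub]

theorem simplexVolume_shift (h : IsSimplex e) (h' : IsSimplex (shift e τ)) :
    simplexVolume (shift e τ) = simplexVolume e := by
  rw [simplexVolume, simplexVolume, measureReal_def, measureReal_def,
    ← measure_preimage_add_right volume τ (openSimplex (shift e τ))]
  congr 2
  ext x
  simp only [openSimplex, Set.mem_preimage, Set.mem_ofPred_eq]
  constructor
  · intro hx l hl
    rw [← bary_shift h h' hl]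
    exact hx _ (add_mem_shift.2 hl)
  · intro hx l hl
    have hl' := mem_shift.1 hl
    rw [← sub_add_cancel l τ, bary_shift h h' hl']
    exact hx _ hl'

end Shift

namespace SimplicialMesh

variable {d : ℕ} {T : SimplicialMesh d} {e : Finset (Space d)} {j k : Space d}

theorem shift_mem_elements {τ : Space d} (hτ : T.IsTranslation τ) (he : e ∈ T.elements) :
    shift e τ ∈ T.elements := ⟨(hτ e).2 he.1, by rw [shift, Finset.card_map, he.2]⟩

theorem isTranslation_zero : T.IsTranslation 0 := fun s => by
  have : s.map (addRightEmbedding 0) = s := shift_zero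
  rw [this]

theorem isTranslation_sub (hT : T.IsTI) (he : e ∈ T.elements) (hj : j ∈ e) (hk : k ∈ e) :
    T.IsTranslation (k - j) := by
  by_cases hjk : j = k
  · rw [hjk, sub_self]
    exact isTranslation_zero
  · refine hT j k hjk (T.down_closed he.1 ?_ ⟨j, by simp⟩)
    intro l hl
    rcases Finset.mem_insert.1 hl with rfl | hl
    · exact hj
    · rw [Finset.mem_singleton.1 hl]
      exact hk

/-- Summation of a translation invariant quantity over the vertices of the elements around `j`. -/
theorem sum_star_vertices (hT : T.IsTI) (j : Space d) {Φ : Finset (Space d) → Space d → ℝ}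
    (hΦ : ∀ e τ k, IsSimplex e → IsSimplex (shift e τ) → k ∈ e → Φ (shift e τ) (k + τ) = Φ e k) :
    ∑ e ∈ T.star j, ∑ k ∈ e, Φ e k = (d + 1) * ∑ e ∈ T.star j, Φ e j := by
  have h1 : ∑ p ∈ (T.star j).sigma (fun e => e), Φ p.1 p.2 =
      ∑ p ∈ (T.star j).sigma (fun e => e), Φ p.1 j := by
    have hdata : ∀ p ∈ (T.star j).sigma (fun e => e), p.1 ∈ T.elements ∧ j ∈ p.1 ∧ p.2 ∈ p.1 ∧
        shift p.1 (j - p.2) ∈ T.elements := fun p hp => by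
      obtain ⟨h1, h2⟩ := Finset.mem_sigma.1 hp
      have h1 := mem_star.1 h1
      exact ⟨h1.1, h1.2, h2, shift_mem_elements (isTranslation_sub hT h1.1 h2 h1.2) h1.1⟩
    -- Translation by j - k takes the vertex k of e to j and the vertex j to 2j - k. Hence (e, k) ↦
    -- (e + (j - k), 2j - k) is an involution, and it moves the distinguished vertex to j.
    let i : (Σ _ : Finset (Space d), Space d) → (Σ _ : Finset (Space d), Space d) :=
      fun p => ⟨shift p.1 (j - p.2), j + (j - p.2)⟩
    have hi : ∀ p ∈ (T.star j).sigma (fun e => e), i p ∈ (T.star j).sigma (fun e => e) :=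
      fun p hp => by
        obtain ⟨-, h2, h3, h4⟩ := hdata p hp
        refine Finset.mem_sigma.2 ⟨mem_star.2 ⟨h4, ?_⟩, add_mem_shift.2 h2⟩
        rw [mem_shift, sub_sub_cancel]
        exact h3
    have hii : ∀ p ∈ (T.star j).sigma (fun e => e), i (i p) = p := fun p _ => by
      refine Sigma.ext ?_ (heq_of_eq ?_)
      · change shift (shift p.1 (j - p.2)) (j - (j + (j - p.2))) = p.1
        rw [shift_shift]
        convert shift_zero using 2
        abel
      · change j + (j - (j + (j - p.2))) = p.2
        abel
    refine Finset.sum_nbij' i i hi hi hii hii fun p hp => ?_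
    obtain ⟨h1, h2, h3, h4⟩ := hdata p hp
    have := hΦ p.1 (j - p.2) p.2 (isSimplex h1) (isSimplex h4) h3
    rw [add_sub_cancel] at this
    exact this.symm
  rw [Finset.sum_sigma', h1, Finset.sum_sigma, Finset.mul_sum]
  refine Finset.sum_congr rfl fun e he => ?_
  change ∑ _k ∈ e, Φ e j = _
  rw [Finset.sum_const, (mem_star.1 he).1.2, nsmul_eq_mul]
  push_cast
  rfl

end SimplicialMesh

/-! ### Moments over the vertices of a simplex -/

section Moments

variable {ι : Type*} (s : Finset ι)

theorem sum_sub_mul_sub (x y : ι → ℝ) (b c : ℝ) :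
    ∑ k ∈ s, (x k - b) * (y k - c) =
      ∑ k ∈ s, x k * y k - b * ∑ k ∈ s, y k - c * ∑ k ∈ s, x k + s.card * (b * c) := by
  classical
  induction s using Finset.induction_on with
  | empty => simp
  | insert i s hi ih =>
    simp only [Finset.sum_insert hi, Finset.card_insert_of_notMem hi, ih]
    push_cast
    ring

theorem sum_sub_mul_sub_mul_sub_mul_sub (g x y z : ι → ℝ) (a b c e : ℝ) :
    ∑ k ∈ s, (g k - a) * (x k - b) * (y k - c) * (z k - e) =
      ∑ k ∈ s, g k * x k * y k * z k - a * ∑ k ∈ s, x k * y k * z k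
      - b * ∑ k ∈ s, g k * y k * z k - c * ∑ k ∈ s, g k * x k * z k
      - e * ∑ k ∈ s, g k * x k * y k + a * b * ∑ k ∈ s, y k * z k + a * c * ∑ k ∈ s, x k * z k
      + a * e * ∑ k ∈ s, x k * y k + b * c * ∑ k ∈ s, g k * z k + b * e * ∑ k ∈ s, g k * y k
      + c * e * ∑ k ∈ s, g k * x k - a * b * c * ∑ k ∈ s, z k - a * b * e * ∑ k ∈ s, y k
      - a * c * e * ∑ k ∈ s, x k - b * c * e * ∑ k ∈ s, g k + s.card * (a * b * c * e) := by
  classical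
  induction s using Finset.induction_on with
  | empty => simp
  | insert i s hi ih =>
    simp only [Finset.sum_insert hi, Finset.card_insert_of_notMem hi, ih]
    push_cast
    ring

/-- `n²` times the sum of the third mixed central moments of `n` numbers. -/
def centralMoment (x y z : ι → ℝ) (n : ℝ) : ℝ :=
  n ^ 2 * ∑ k ∈ s, x k * y k * z k
    - n * ((∑ k ∈ s, x k) * ∑ k ∈ s, y k * z k + (∑ k ∈ s, y k) * ∑ k ∈ s, x k * z k
      + (∑ k ∈ s, z k) * ∑ k ∈ s, x k * y k)
    + 2 * ((∑ k ∈ s, x k) * (∑ k ∈ s, y k) * ∑ k ∈ s, z k)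

theorem centralMoment_add_const (x y z : ι → ℝ) (a b c : ℝ) :
    centralMoment s (fun k => x k + a) (fun k => y k + b) (fun k => z k + c) s.card =
      centralMoment s x y z s.card := by
  have h1 : ∀ (x : ι → ℝ) (a : ℝ), ∑ k ∈ s, (x k + a) = ∑ k ∈ s, x k + s.card * a :=
    fun x a => by rw [Finset.sum_add_distrib, Finset.sum_const, nsmul_eq_mul]
  have h2 : ∀ (x y : ι → ℝ) (a b : ℝ), ∑ k ∈ s, (x k + a) * (y k + b) =
      ∑ k ∈ s, x k * y k + a * ∑ k ∈ s, y k + b * ∑ k ∈ s, x k + s.card * (a * b) :=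
    fun x y a b => by
      have := sum_sub_mul_sub s x y (-a) (-b)
      simp only [sub_neg_eq_add] at this
      rw [this]
      ring
  have h3 : ∑ k ∈ s, (x k + a) * (y k + b) * (z k + c) =
      ∑ k ∈ s, x k * y k * z k + a * ∑ k ∈ s, y k * z k + b * ∑ k ∈ s, x k * z k
      + c * ∑ k ∈ s, x k * y k + a * b * ∑ k ∈ s, z k + a * c * ∑ k ∈ s, y k
      + b * c * ∑ k ∈ s, x k + s.card * (a * b * c) := by
    have := sum_sub_mul_sub_mul_sub_mul_sub s (fun _ => 1) x y z 0 (-a) (-b) (-c)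
    simp only [sub_neg_eq_add, sub_zero, one_mul, Finset.sum_const, nsmul_eq_mul] at this
    rw [this]
    ring
  simp only [centralMoment, h1, h2, h3]
  ring

/-- For a simplex of dimension n with g_k = ∂_a λ_k, the sums ∑ g x are Kronecker deltas, and the
left side is the defect of the cubic normal tensor identity summed over the vertices j. It collapses
to moments of facets. The proof expands both sides in power sums over s. -/
theorem sum_sum_central [DecidableEq ι] (g x y z : ι → ℝ) (n : ℝ) (hn : (s.card : ℝ) = n + 1)
    (hg : ∑ k ∈ s, g k = 0) :
    ∑ j ∈ s, ((n + 2) * ∑ k ∈ s, (g k - g j) * (x k - x j) * (y k - y j) * (z k - z j)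
      - 2 * ((∑ k ∈ s, g k * x k) * ∑ k ∈ s, (y k - y j) * (z k - z j)
        + (∑ k ∈ s, g k * y k) * ∑ k ∈ s, (x k - x j) * (z k - z j)
        + (∑ k ∈ s, g k * z k) * ∑ k ∈ s, (x k - x j) * (y k - y j))) =
    -2 * ∑ k ∈ s, g k * centralMoment (s.erase k) x y z n := by
  -- Erasing k lowers every power sum by its k-th term; the result is sorted by the monomials in the
  -- index k, ready for summation.
  have hC : ∀ k ∈ s, g k * centralMoment (s.erase k) x y z n =
      g k * centralMoment s x y z n
      - (n + 1) * (n + 2) * (g k * x k * y k * z k)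
      + (n + 2) * ((∑ k ∈ s, x k) * (g k * y k * z k) + (∑ k ∈ s, y k) * (g k * x k * z k)
        + (∑ k ∈ s, z k) * (g k * x k * y k))
      + (n * (∑ k ∈ s, y k * z k) - 2 * ((∑ k ∈ s, y k) * ∑ k ∈ s, z k)) * (g k * x k)
      + (n * (∑ k ∈ s, x k * z k) - 2 * ((∑ k ∈ s, x k) * ∑ k ∈ s, z k)) * (g k * y k)
      + (n * (∑ k ∈ s, x k * y k) - 2 * ((∑ k ∈ s, x k) * ∑ k ∈ s, y k)) * (g k * z k) := by
    intro k hk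
    have he : ∀ f : ι → ℝ, ∑ l ∈ s.erase k, f l = ∑ l ∈ s, f l - f k := fun f => by
      rw [← Finset.add_sum_erase s f hk, add_sub_cancel_left]
    simp only [centralMoment, he]
    ring
  have hL : ∀ j ∈ s, ((n + 2) * ∑ k ∈ s, (g k - g j) * (x k - x j) * (y k - y j) * (z k - z j)
      - 2 * ((∑ k ∈ s, g k * x k) * ∑ k ∈ s, (y k - y j) * (z k - z j)
        + (∑ k ∈ s, g k * y k) * ∑ k ∈ s, (x k - x j) * (z k - z j)
        + (∑ k ∈ s, g k * z k) * ∑ k ∈ s, (x k - x j) * (y k - y j))) =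
      ((n + 2) * ∑ k ∈ s, g k * x k * y k * z k
        - 2 * ((∑ k ∈ s, g k * x k) * ∑ k ∈ s, y k * z k + (∑ k ∈ s, g k * y k) * ∑ k ∈ s, x k * z k
          + (∑ k ∈ s, g k * z k) * ∑ k ∈ s, x k * y k))
      + (-(n + 2) * ∑ k ∈ s, x k * y k * z k) * g j
      + (-(n + 2) * (∑ k ∈ s, g k * y k * z k) + 2 * ((∑ k ∈ s, g k * y k) * (∑ k ∈ s, z k)
        + (∑ k ∈ s, g k * z k) * (∑ k ∈ s, y k))) * x j
      + (-(n + 2) * (∑ k ∈ s, g k * x k * z k) + 2 * ((∑ k ∈ s, g k * x k) * (∑ k ∈ s, z k)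
        + (∑ k ∈ s, g k * z k) * (∑ k ∈ s, x k))) * y j
      + (-(n + 2) * (∑ k ∈ s, g k * x k * y k) + 2 * ((∑ k ∈ s, g k * x k) * (∑ k ∈ s, y k)
        + (∑ k ∈ s, g k * y k) * (∑ k ∈ s, x k))) * z j
      + ((n + 2) * ∑ k ∈ s, y k * z k) * (g j * x j)
      + ((n + 2) * ∑ k ∈ s, x k * z k) * (g j * y j)
      + ((n + 2) * ∑ k ∈ s, x k * y k) * (g j * z j)
      + ((n + 2 - 2 * (n + 1)) * ∑ k ∈ s, g k * z k) * (x j * y j)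
      + ((n + 2 - 2 * (n + 1)) * ∑ k ∈ s, g k * y k) * (x j * z j)
      + ((n + 2 - 2 * (n + 1)) * ∑ k ∈ s, g k * x k) * (y j * z j)
      + (-(n + 2) * ∑ k ∈ s, z k) * (g j * x j * y j)
      + (-(n + 2) * ∑ k ∈ s, y k) * (g j * x j * z j)
      + (-(n + 2) * ∑ k ∈ s, x k) * (g j * y j * z j)
      + ((n + 2) * (n + 1)) * (g j * x j * y j * z j) := by
    intro j _
    rw [sum_sub_mul_sub_mul_sub_mul_sub, sum_sub_mul_sub, sum_sub_mul_sub, sum_sub_mul_sub, hg, hn]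
    ring
  rw [Finset.sum_congr rfl hC, Finset.sum_congr rfl hL]
  simp only [Finset.sum_add_distrib, Finset.sum_sub_distrib, ← Finset.mul_sum, ← Finset.sum_mul,
    Finset.sum_const, nsmul_eq_mul, hg, hn]
  ring

theorem sum_sum_linear (g x : ι → ℝ) (hg : ∑ k ∈ s, g k = 0) :
    ∑ j ∈ s, ∑ k ∈ s, (g k - g j) * (x k - x j) = 2 * (s.card * ∑ k ∈ s, g k * x k) := by
  have hL : ∀ j ∈ s, ∑ k ∈ s, (g k - g j) * (x k - x j) =
      ∑ k ∈ s, g k * x k + (-∑ k ∈ s, x k) * g j + s.card * (g j * x j) := fun j _ => by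
    rw [sum_sub_mul_sub, hg]
    ring
  rw [Finset.sum_congr rfl hL]
  simp only [Finset.sum_add_distrib, ← Finset.mul_sum, Finset.sum_const, nsmul_eq_mul, hg]
  ring

end Moments

/-! ### The tensors of the interface normals -/

namespace SimplicialMesh

variable {d : ℕ} {T : SimplicialMesh d} {e : Finset (Space d)}

/-- The normals are split into element contributions and the two summations are exchanged. Since φ
vanishes at j, the inner sum may run over all vertices of e. -/
theorem sum_neighborFinset (hd : 1 ≤ d) (j : T.Node) (a : Fin d) (φ : Space d → ℝ)
    (hφ : φ j.1 = 0) :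
    ∑ k ∈ T.neighborFinset j, T.faceNormal j k a * φ k.1 =
      ∑ e ∈ T.star j.1, simplexVolume e / (d + 1) *
        ∑ k ∈ e, (grad (bary e k) a - grad (bary e j.1) a) * φ k := by
  classical
  have hmem : ∀ k, k ∈ T.neighborFinset j ↔ k ≠ j ∧ ∃ e ∈ T.star j.1, k.1 ∈ e := fun k => by
    rw [neighborFinset, Set.Finite.mem_toFinset, mem_neighbors_iff hd]
  have h1 : ∀ k ∈ T.neighborFinset j, T.faceNormal j k a * φ k.1 =
      ∑ e ∈ (T.star j.1).filter (k.1 ∈ ·), simplexVolume e / (d + 1) *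
        ((grad (bary e k.1) a - grad (bary e j.1) a) * φ k.1) := fun k hk => by
    rw [faceNormal_eq hd ((hmem k).1 hk).1.symm, WithLp.ofLp_sum, Finset.sum_apply, Finset.sum_mul]
    refine Finset.sum_congr rfl fun e _ => ?_
    simp only [PiLp.smul_apply, PiLp.sub_apply, smul_eq_mul]
    ring
  rw [Finset.sum_congr rfl h1, Finset.sum_comm' (t' := T.star j.1)
    (s' := fun e => (T.neighborFinset j).filter (·.1 ∈ e))]
  · refine Finset.sum_congr rfl fun e he => ?_
    have he1 := mem_star.1 he
    rw [← Finset.mul_sum, ← Finset.add_sum_erase e _ he1.2, hφ, mul_zero, zero_add]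
    congr 1
    have hv : ∀ k ∈ e, k ∈ T.toSimplicialComplex.vertices := fun k hk =>
      T.down_closed he1.1.1 (Finset.singleton_subset_iff.2 hk) (Finset.singleton_nonempty _)
    refine Finset.sum_bij (fun k _ => k.1) (fun k hk => ?_) (fun k _ k' _ h => Subtype.ext h)
      (fun k hk => ?_) (fun k _ => rfl)
    · obtain ⟨h2, h3⟩ := Finset.mem_filter.1 hk
      exact Finset.mem_erase.2 ⟨fun h => ((hmem k).1 h2).1 (Subtype.ext h), h3⟩
    · obtain ⟨h2, h3⟩ := Finset.mem_erase.1 hk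
      exact ⟨⟨k, hv k h3⟩, Finset.mem_filter.2 ⟨(hmem _).2
        ⟨fun h => h2 (congrArg Subtype.val h), e, he, h3⟩, h3⟩, rfl⟩
  · intro k e
    simp only [Finset.mem_filter, hmem]
    constructor
    · rintro ⟨h2, h3, h4⟩
      exact ⟨⟨h2, h4⟩, h3⟩
    · rintro ⟨⟨h2, h4⟩, h3⟩
      exact ⟨h2, h3, h4⟩

/-- After averaging over the vertices, each simplex contributes through the duality ∑_k ∂_a λ_k
x_i(k) = δ_ai. -/
theorem sum_normal_edge (hd : 1 ≤ d) (hT : T.IsTI) (j : T.Node) (a i : Fin d) :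
    ∑ k ∈ T.neighborFinset j, T.faceNormal j k a * (k.1 i - j.1 i) =
      if a = i then 2 * T.cellVolume j else 0 := by
  rw [sum_neighborFinset hd j a (fun k => k i - j.1 i) (sub_self _)]
  have hfold := sum_star_vertices hT j.1 (Φ := fun e j => simplexVolume e / (d + 1) *
    ∑ k ∈ e, (grad (bary e k) a - grad (bary e j) a) * (k i - j i)) (by
      intro e τ k h h' hk
      rw [simplexVolume_shift h h', sum_shift]
      congr 1
      refine Finset.sum_congr rfl fun l hl => ?_
      rw [grad_bary_shift h h' hl, grad_bary_shift h h' hk]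
      simp only [PiLp.add_apply]
      ring)
  have hd1 : (d : ℝ) + 1 ≠ 0 := by positivity
  refine mul_left_cancel₀ hd1 (hfold.symm.trans ?_)
  have hel : ∀ e ∈ T.star j.1, ∑ j ∈ e, simplexVolume e / (d + 1) *
      ∑ k ∈ e, (grad (bary e k) a - grad (bary e j) a) * (k i - j i) =
      simplexVolume e / (d + 1) * ((d + 1) * if a = i then 2 else 0) := fun e he => by
    have h := isSimplex (mem_star.1 he).1
    have h0 : ∑ k ∈ e, grad (bary e k) a = 0 := by
      have := congrArg (fun v : Space d => v a) (sum_grad h)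
      simpa using this
    rw [← Finset.mul_sum, sum_sum_linear e (fun k => grad (bary e k) a) (fun k => k i) h0,
      sum_grad_mul h, h.card]
    push_cast
    split_ifs <;> ring
  rw [Finset.sum_congr rfl hel, ← Finset.sum_mul, ← cellVolume_eq]
  split_ifs <;> ring

/-- The weighted second moments of the mesh edges around `j`. -/
def edgeMoment (T : SimplicialMesh d) (j : T.Node) (l m : Fin d) : ℝ :=
  2 / (d + 2) * ∑ e ∈ T.star j.1, simplexVolume e / (d + 1) *
    ∑ k ∈ e, (k l - j.1 l) * (k m - j.1 m)

theorem edgeMoment_comm (j : T.Node) (l m : Fin d) : T.edgeMoment j l m = T.edgeMoment j m l := by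
  simp only [edgeMoment, mul_comm (_ - j.1 l)]

/-- Call the sum X. Central moments do not change under translation, so averaging gives X = (d + 1)
Y, where Y is the part with k = j. The terms with k ≠ j belong to facets through j and cancel by
`sum_facets`, so X = Y as well, and d X = 0. -/
theorem sum_facet_moments (hd : 1 ≤ d) (hT : T.IsTI) (j : T.Node) (a i l m : Fin d) :
    ∑ e ∈ T.star j.1, ∑ k ∈ e, simplexVolume e * grad (bary e k) a *
      centralMoment (e.erase k) (fun k => k i) (fun k => k l) (fun k => k m) d = 0 := by
  have hfold := sum_star_vertices hT j.1 (Φ := fun e k => simplexVolume e * grad (bary e k) a *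
      centralMoment (e.erase k) (fun k => k i) (fun k => k l) (fun k => k m) d) (by
    intro e τ k h h' hk
    rw [simplexVolume_shift h h', grad_bary_shift h h' hk, shift_erase]
    congr 1
    have hc : (d : ℝ) = ((e.erase k).card : ℝ) := by
      rw [Finset.card_erase_of_mem hk, h.card, Nat.add_sub_cancel]
    rw [hc, ← centralMoment_add_const _ _ _ _ (τ i) (τ l) (τ m)]
    simp only [centralMoment, sum_shift, PiLp.add_apply])
  have hsplit : ∑ e ∈ T.star j.1, ∑ k ∈ e, simplexVolume e * grad (bary e k) a *
      centralMoment (e.erase k) (fun k => k i) (fun k => k l) (fun k => k m) d =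
      ∑ e ∈ T.star j.1, simplexVolume e * grad (bary e j.1) a *
        centralMoment (e.erase j.1) (fun k => k i) (fun k => k l) (fun k => k m) d := by
    have h0 := sum_facets hd j.1 a (T := T)
      (fun F => centralMoment F (fun k => k i) (fun k => k l) (fun k => k m) d)
    rw [← add_zero (Finset.sum _ fun e => simplexVolume e * grad (bary e j.1) a * _), ← h0,
      ← Finset.sum_add_distrib]
    exact Finset.sum_congr rfl fun e he => (Finset.add_sum_erase e _ (mem_star.1 he).2).symm
  rw [← hsplit] at hfold
  have hd0 : (d : ℝ) ≠ 0 := by positivity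
  exact (mul_eq_zero.1 (by linarith : (d : ℝ) * _ = 0)).resolve_left hd0

/-- The third-order tensor of the interface normals is determined by second moments. -/
theorem sum_normal_edge_cube (hd : 1 ≤ d) (hT : T.IsTI) (j : T.Node) (a i l m : Fin d) :
    ∑ k ∈ T.neighborFinset j, T.faceNormal j k a *
      ((k.1 i - j.1 i) * (k.1 l - j.1 l) * (k.1 m - j.1 m)) =
      (if a = i then 1 else 0) * T.edgeMoment j l m + (if a = l then 1 else 0) * T.edgeMoment j i m
        + (if a = m then 1 else 0) * T.edgeMoment j i l := by
  classical
  have hd1 : (d : ℝ) + 1 ≠ 0 := by positivity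
  have hd2 : (d : ℝ) + 2 ≠ 0 := by positivity
  rw [sum_neighborFinset hd j a
    (fun k => (k i - j.1 i) * (k l - j.1 l) * (k m - j.1 m)) (by ring)]
  -- Φ is the contribution of one simplex to the defect of the claim, cleared of denominators; the
  -- factor 2/(d+2) in `edgeMoment` becomes the pair of weights d + 2 and 2.
  have hfold := sum_star_vertices hT j.1 (Φ := fun e j => simplexVolume e * (((d : ℝ) + 2) *
      ∑ k ∈ e, (grad (bary e k) a - grad (bary e j) a) * (k i - j i) * (k l - j l) * (k m - j m)
      - 2 * ((if a = i then 1 else 0) * ∑ k ∈ e, (k l - j l) * (k m - j m)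
        + (if a = l then 1 else 0) * ∑ k ∈ e, (k i - j i) * (k m - j m)
        + (if a = m then 1 else 0) * ∑ k ∈ e, (k i - j i) * (k l - j l)))) (by
      intro e τ k h h' hk
      simp only [simplexVolume_shift h h', sum_shift, PiLp.add_apply, add_sub_add_right_eq_sub]
      congr 3
      refine Finset.sum_congr rfl fun l hl => ?_
      rw [grad_bary_shift h h' hl, grad_bary_shift h h' hk])
  have hel : ∀ e ∈ T.star j.1, ∑ j ∈ e, simplexVolume e * (((d : ℝ) + 2) *
      ∑ k ∈ e, (grad (bary e k) a - grad (bary e j) a) * (k i - j i) * (k l - j l) * (k m - j m)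
      - 2 * ((if a = i then 1 else 0) * ∑ k ∈ e, (k l - j l) * (k m - j m)
        + (if a = l then 1 else 0) * ∑ k ∈ e, (k i - j i) * (k m - j m)
        + (if a = m then 1 else 0) * ∑ k ∈ e, (k i - j i) * (k l - j l))) =
      -2 * ∑ k ∈ e, simplexVolume e * grad (bary e k) a *
        centralMoment (e.erase k) (fun k => k i) (fun k => k l) (fun k => k m) d := fun e he => by
    have h := isSimplex (mem_star.1 he).1
    have h0 : ∑ k ∈ e, grad (bary e k) a = 0 := by
      have := congrArg (fun v : Space d => v a) (sum_grad h)
      simpa using this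
    have := sum_sum_central e (fun k => grad (bary e k) a) (fun k => k i) (fun k => k l)
      (fun k => k m) d (by rw [h.card]; push_cast; rfl) h0
    simp only [sum_grad_mul h] at this
    rw [← Finset.mul_sum, this]
    simp only [Finset.mul_sum]
    exact Finset.sum_congr rfl fun k _ => by ring
  rw [Finset.sum_congr rfl hel, ← Finset.mul_sum, sum_facet_moments hd hT, mul_zero] at hfold
  have h0 := (mul_eq_zero.1 hfold.symm).resolve_left hd1
  simp only [edgeMoment]
  refine mul_left_cancel₀ (mul_ne_zero hd1 hd2) (sub_eq_zero.1 (Eq.trans ?_ h0))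
  have hr : ∀ A B C D : ℝ, ((d : ℝ) + 1) * (d + 2) * A - (d + 1) * (d + 2) *
      ((if a = i then 1 else 0) * (2 / (d + 2) * B) + (if a = l then 1 else 0) * (2 / (d + 2) * C)
        + (if a = m then 1 else 0) * (2 / (d + 2) * D)) =
      (d + 1) * ((d + 2) * A - 2 * ((if a = i then 1 else 0) * B + (if a = l then 1 else 0) * C
        + (if a = m then 1 else 0) * D)) := fun A B C D => by
    field_simp
  rw [hr]
  simp only [Finset.mul_sum (s := T.star j.1), ← Finset.sum_add_distrib, ← Finset.sum_sub_distrib]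
  refine Finset.sum_congr rfl fun e _ => ?_
  simp only [mul_assoc]
  field_simp

end SimplicialMesh

/-! ### Polynomials of low degree -/

section Polynomials

open MvPolynomial

variable {d : ℕ}

/-- The evaluation of a complex polynomial at a real point. -/
def evalPt (x : Space d) : MvPolynomial (Fin d) ℂ →ₗ[ℂ] ℂ :=
  (aeval fun i => (x i : ℂ)).toLinearMap

theorem evalPt_apply (x : Space d) (f : MvPolynomial (Fin d) ℂ) :
    evalPt x f = eval (fun i => (x i : ℂ)) f := by
  simp [evalPt, aeval_eq_eval]

theorem evalPt_mul (x : Space d) (f g : MvPolynomial (Fin d) ℂ) :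
    evalPt x (f * g) = evalPt x f * evalPt x g := by
  simp [evalPt]

theorem evalPt_one (x : Space d) : evalPt x 1 = 1 := by
  simp [evalPt]

theorem evalPt_C (x : Space d) (a : ℂ) : evalPt x (C a) = a := by
  simp [evalPt]

theorem evalPt_X (x : Space d) (i : Fin d) : evalPt x (X i) = x i := by
  simp [evalPt]

theorem evalPt_C_mul (x : Space d) (a : ℂ) (f : MvPolynomial (Fin d) ℂ) :
    evalPt x (C a * f) = a * evalPt x f := by
  rw [evalPt_mul, evalPt_C]

/-- The coordinate function `x_i` centered at `r`. -/
def centered (r : Space d) (i : Fin d) : MvPolynomial (Fin d) ℂ := X i - C (r i : ℂ)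

theorem evalPt_centered (x r : Space d) (i : Fin d) :
    evalPt x (centered r i) = ((x i - r i : ℝ) : ℂ) := by
  rw [centered, map_sub, evalPt_X, evalPt_C]
  push_cast
  rfl

theorem pderiv_centered (r : Space d) (i l : Fin d) :
    pderiv i (centered r l) = C (if i = l then 1 else 0) := by
  rw [centered, map_sub, pderiv_C, sub_zero, pderiv_X, Pi.single_apply]
  simp only [eq_comm]
  split_ifs <;> simp

theorem totalDegree_centered (r : Space d) (i : Fin d) : (centered r i).totalDegree ≤ 1 := by
  refine (totalDegree_sub _ _).trans ?_
  simp [totalDegree_X, totalDegree_C]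

/-- Writing X_i as its centred version plus a constant, the factors of a monomial are exchanged one
at a time. Linear identities on polynomials of bounded degree then need checking only on products of
centred coordinates. -/
theorem mem_of_totalDegree_le (r : Space d) {p : ℕ} (S : Submodule ℂ (MvPolynomial (Fin d) ℂ))
    (hS : ∀ m : Multiset (Fin d), Multiset.card m ≤ p → (m.map (centered r)).prod ∈ S)
    {f : MvPolynomial (Fin d) ℂ} (hf : f.totalDegree ≤ p) : f ∈ S := by
  have key : ∀ m m' : Multiset (Fin d), Multiset.card m + Multiset.card m' ≤ p →
      (m.map X).prod * (m'.map (centered r)).prod ∈ S := by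
    intro m
    induction m using Multiset.induction_on with
    | empty =>
      intro m' h
      simpa using hS m' (by simpa using h)
    | cons i m ih =>
      intro m' h
      rw [Multiset.card_cons] at h
      have h1 := ih (i ::ₘ m') (by rw [Multiset.card_cons]; omega)
      have h2 := S.smul_mem (r i : ℂ) (ih m' (by omega))
      have h3 := S.add_mem h1 h2
      rw [Multiset.map_cons, Multiset.prod_cons, centered, smul_eq_C_mul] at h3
      rw [Multiset.map_cons, Multiset.prod_cons]
      convert h3 using 1
      ring
  have hmon : ∀ m : Multiset (Fin d),
      monomial (Multiset.toFinsupp m) (1 : ℂ) = (m.map X).prod := by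
    intro m
    induction m using Multiset.induction_on with
    | empty => simp
    | cons i m ih =>
      rw [Multiset.map_cons, Multiset.prod_cons, ← ih, ← Multiset.singleton_add, map_add,
        Multiset.toFinsupp_singleton, X, monomial_mul, one_mul]
  rw [f.as_sum]
  refine S.sum_mem fun s hs => ?_
  have hcard : Multiset.card (Finsupp.toMultiset s) ≤ p := by
    rw [Finsupp.card_toMultiset]
    exact (le_totalDegree hs).trans hf
  have h1 := key (Finsupp.toMultiset s) 0 (by simpa using hcard)
  rw [← hmon, Finsupp.toMultiset_toFinsupp, Multiset.map_zero, Multiset.prod_zero, mul_one] at h1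
  have h2 := S.smul_mem (coeff s f) h1
  rwa [smul_monomial, smul_eq_mul, mul_one] at h2

theorem mem_of_totalDegree_le_two (r : Space d) (S : Submodule ℂ (MvPolynomial (Fin d) ℂ))
    (h0 : 1 ∈ S) (h1 : ∀ i, centered r i ∈ S) (h2 : ∀ i l, centered r i * centered r l ∈ S)
    {f : MvPolynomial (Fin d) ℂ} (hf : f.totalDegree ≤ 2) : f ∈ S := by
  refine mem_of_totalDegree_le r S (fun m hm => ?_) hf
  obtain h | h | h : Multiset.card m = 0 ∨ Multiset.card m = 1 ∨ Multiset.card m = 2 := by omega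
  · rw [Multiset.card_eq_zero.1 h]
    simpa using h0
  · obtain ⟨a, rfl⟩ := Multiset.card_eq_one.1 h
    simpa using h1 a
  · obtain ⟨a, b, rfl⟩ := Multiset.card_eq_two.1 h
    simpa using h2 a b

theorem mem_of_totalDegree_le_three (r : Space d) (S : Submodule ℂ (MvPolynomial (Fin d) ℂ))
    (h0 : 1 ∈ S) (h1 : ∀ i, centered r i ∈ S) (h2 : ∀ i l, centered r i * centered r l ∈ S)
    (h3 : ∀ i l m, centered r i * (centered r l * centered r m) ∈ S)
    {f : MvPolynomial (Fin d) ℂ} (hf : f.totalDegree ≤ 3) : f ∈ S := by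
  refine mem_of_totalDegree_le r S (fun m hm => ?_) hf
  obtain h | h : Multiset.card m ≤ 2 ∨ Multiset.card m = 3 := by omega
  · refine mem_of_totalDegree_le_two r S h0 h1 h2 ?_
    refine (totalDegree_multiset_prod _).trans ?_
    rw [Multiset.map_map]
    refine (Multiset.sum_le_card_nsmul _ 1 fun x hx => ?_).trans ?_
    · obtain ⟨i, -, rfl⟩ := Multiset.mem_map.1 hx
      exact totalDegree_centered r i
    · simpa using h
  · obtain ⟨a, b, c, rfl⟩ := Multiset.card_eq_three.1 h
    simpa using h3 a b c

theorem totalDegree_pderiv_le (i : Fin d) {f : MvPolynomial (Fin d) ℂ} {p : ℕ}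
    (hf : f.totalDegree ≤ p + 1) : (pderiv i f).totalDegree ≤ p := by
  refine Finset.sup_le fun m hm => ?_
  have h1 : coeff (m + Finsupp.single i 1) f ≠ 0 := by
    intro h
    rw [mem_support_iff, coeff_pderiv, h] at hm
    simp at hm
  have h2 := (le_totalDegree (mem_support_iff.2 h1)).trans hf
  rw [Finsupp.sum_add_index' (by simp) (by simp), Finsupp.sum_single_index rfl] at h2
  omega

theorem pderiv_eq_zero_of_totalDegree (i : Fin d) {f : MvPolynomial (Fin d) ℂ}
    (hf : f.totalDegree ≤ 0) : pderiv i f = 0 := by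
  rw [totalDegree_eq_zero_iff_eq_C.1 (Nat.le_zero.1 hf), pderiv_C]

/-- The polynomial `x ↦ f (x - h)`. -/
def translatePoly (h : Space d) : MvPolynomial (Fin d) ℂ →ₐ[ℂ] MvPolynomial (Fin d) ℂ :=
  aeval (centered h)

theorem translatePoly_centered (h r : Space d) (i : Fin d) :
    translatePoly h (centered r i) = centered r i - C (h i : ℂ) := by
  rw [translatePoly, centered, map_sub, aeval_X, aeval_C, centered, algebraMap_eq]
  ring

theorem evalPt_translatePoly (h x : Space d) (f : MvPolynomial (Fin d) ℂ) :
    evalPt x (translatePoly h f) = evalPt (x - h) f := by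
  induction f using MvPolynomial.induction_on with
  | C a => rw [translatePoly, aeval_C, algebraMap_eq, evalPt_C, evalPt_C]
  | add f g hf hg => rw [map_add, map_add, map_add, hf, hg]
  | mul_X f i hf =>
    rw [map_mul, evalPt_mul, evalPt_mul, hf, translatePoly, aeval_X, evalPt_centered, evalPt_X]
    rfl

/-- Translation preserves the top-degree part. This brings the difference of a cubic within reach of
a 2-exact gradient. -/
theorem totalDegree_sub_translatePoly (h : Space d) {f : MvPolynomial (Fin d) ℂ}
    (hf : f.totalDegree ≤ 3) : (f - translatePoly h f).totalDegree ≤ 2 := by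
  let S : Submodule ℂ (MvPolynomial (Fin d) ℂ) :=
    (restrictTotalDegree (Fin d) ℂ 2).comap (LinearMap.id - (translatePoly h).toLinearMap)
  have hmem : ∀ g, g ∈ S ↔ g - translatePoly h g ∈ restrictTotalDegree (Fin d) ℂ 2 :=
    fun g => Iff.rfl
  have hC : ∀ a : ℂ, C a ∈ restrictTotalDegree (Fin d) ℂ 2 := fun a => by
    rw [mem_restrictTotalDegree, totalDegree_C]
    exact Nat.zero_le _
  have h1 : ∀ i, centered (0 : Space d) i ∈ restrictTotalDegree (Fin d) ℂ 2 := fun i => by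
    rw [mem_restrictTotalDegree]
    exact (totalDegree_centered _ _).trans one_le_two
  have h2 : ∀ i l, centered (0 : Space d) i * centered 0 l ∈ restrictTotalDegree (Fin d) ℂ 2 :=
    fun i l => by
      rw [mem_restrictTotalDegree]
      exact (totalDegree_mul _ _).trans
        (add_le_add (totalDegree_centered _ _) (totalDegree_centered _ _))
  rw [← mem_restrictTotalDegree, ← hmem]
  refine mem_of_totalDegree_le_three 0 S ?_ (fun i => ?_) (fun i l => ?_) (fun i l m => ?_) hf
  · rw [hmem, map_one, sub_self]
    exact Submodule.zero_mem _
  · rw [hmem, translatePoly_centered, sub_sub_cancel]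
    exact hC _
  · rw [hmem, map_mul, translatePoly_centered, translatePoly_centered]
    have : centered (0 : Space d) i * centered 0 l - (centered 0 i - C (h i : ℂ)) *
        (centered 0 l - C (h l : ℂ)) = (h l : ℂ) • centered 0 i + (h i : ℂ) • centered 0 l
          - C ((h i : ℂ) * h l) := by
      simp only [smul_eq_C_mul, map_mul]
      ring
    rw [this]
    exact Submodule.sub_mem _ (Submodule.add_mem _ (Submodule.smul_mem _ _ (h1 i))
      (Submodule.smul_mem _ _ (h1 l))) (hC _)
  · rw [hmem, map_mul, map_mul, translatePoly_centered, translatePoly_centered,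
      translatePoly_centered]
    have : centered (0 : Space d) i * (centered 0 l * centered 0 m) - (centered 0 i - C (h i : ℂ)) *
        ((centered 0 l - C (h l : ℂ)) * (centered 0 m - C (h m : ℂ))) =
        (h m : ℂ) • (centered 0 i * centered 0 l) + (h l : ℂ) • (centered 0 i * centered 0 m)
          + (h i : ℂ) • (centered 0 l * centered 0 m)
          - ((h i * h l : ℂ) • centered 0 m + (h i * h m : ℂ) • centered 0 l
          + (h l * h m : ℂ) • centered 0 i) + C (h i * h l * h m : ℂ) := by
      simp only [smul_eq_C_mul, map_mul]
      ring
    rw [this]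
    refine Submodule.add_mem _ (Submodule.sub_mem _ (Submodule.add_mem _ (Submodule.add_mem _
      (Submodule.smul_mem _ _ (h2 i l)) (Submodule.smul_mem _ _ (h2 i m)))
      (Submodule.smul_mem _ _ (h2 l m))) (Submodule.add_mem _ (Submodule.add_mem _
      (Submodule.smul_mem _ _ (h1 m)) (Submodule.smul_mem _ _ (h1 l)))
      (Submodule.smul_mem _ _ (h1 i)))) (hC _)

/-- The value `q(r) + ½ (h · ∇) q (r)`. -/
def halfStep (r h : Space d) : MvPolynomial (Fin d) ℂ →ₗ[ℂ] ℂ :=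
  evalPt r + ∑ i, ((h i / 2 : ℝ) : ℂ) • (evalPt r ∘ₗ (pderiv i).toLinearMap)

theorem halfStep_apply (r h : Space d) (f : MvPolynomial (Fin d) ℂ) :
    halfStep r h f = evalPt r f + ∑ i, ((h i / 2 : ℝ) : ℂ) * evalPt r (pderiv i f) := by
  simp [halfStep, LinearMap.sum_apply]

theorem sum_half_centered (h : Space d) (l : Fin d) :
    ∑ i, ((h i / 2 : ℝ) : ℂ) * (if i = l then 1 else 0) = ((h l / 2 : ℝ) : ℂ) := by simp

theorem halfStep_one (r h : Space d) : halfStep r h 1 = 1 := by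
  rw [halfStep_apply, evalPt_one]
  simp

theorem halfStep_centered (x r h : Space d) (i : Fin d) :
    halfStep x h (centered r i) = ((x i - r i + h i / 2 : ℝ) : ℂ) := by
  rw [halfStep_apply, evalPt_centered]
  simp only [pderiv_centered, evalPt_C, sum_half_centered]
  push_cast
  rfl

theorem halfStep_mul (x h : Space d) (f g : MvPolynomial (Fin d) ℂ) :
    halfStep x h (f * g) = evalPt x f * halfStep x h g + evalPt x g * halfStep x h f
      - evalPt x f * evalPt x g := by
  have h1 : ∑ i, ((h i / 2 : ℝ) : ℂ) * evalPt x (pderiv i (f * g)) =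
      evalPt x f * ∑ i, ((h i / 2 : ℝ) : ℂ) * evalPt x (pderiv i g)
        + evalPt x g * ∑ i, ((h i / 2 : ℝ) : ℂ) * evalPt x (pderiv i f) := by
    rw [Finset.mul_sum, Finset.mul_sum, ← Finset.sum_add_distrib]
    refine Finset.sum_congr rfl fun i _ => ?_
    rw [pderiv_mul, map_add, evalPt_mul, evalPt_mul]
    ring
  rw [halfStep_apply, halfStep_apply, halfStep_apply, h1, evalPt_mul]
  ring

/-- Reconstructions from the two ends of an edge coincide on quadratic polynomials. -/
theorem halfStep_opposite (r s : Space d) {f : MvPolynomial (Fin d) ℂ} (hf : f.totalDegree ≤ 2) :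
    halfStep r (s - r) f = halfStep s (r - s) f := by
  -- The claim is the trapezoidal rule f(s) - f(r) = ½ (s - r) · (∇f(r) + ∇f(s)), exact because ∇f
  -- is affine.
  refine mem_of_totalDegree_le_two r
    (LinearMap.eqLocus (halfStep r (s - r)) (halfStep s (r - s))) ?_ (fun i => ?_)
    (fun i l => ?_) hf
  · rw [LinearMap.mem_eqLocus, halfStep_one, halfStep_one]
  · rw [LinearMap.mem_eqLocus, halfStep_centered, halfStep_centered]
    congr 1
    simp only [PiLp.sub_apply]
    ring
  · rw [LinearMap.mem_eqLocus, halfStep_mul, halfStep_mul, halfStep_centered, halfStep_centered,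
      halfStep_centered, halfStep_centered]
    simp only [evalPt_centered, PiLp.sub_apply]
    push_cast
    ring

end Polynomials

/-! ### Consistency of the flux divergence -/

namespace SimplicialMesh

open MvPolynomial

variable {d n : ℕ} {T : SimplicialMesh d}

/-- The increment of the reconstructed value along an edge between consecutive nodes. -/
def edgeJump (r h : Space d) : MvPolynomial (Fin d) ℂ →ₗ[ℂ] ℂ :=
  halfStep r h ∘ₗ (LinearMap.id - (translatePoly h).toLinearMap)

theorem edgeJump_apply (r h : Space d) (f : MvPolynomial (Fin d) ℂ) :
    edgeJump r h f = halfStep r h (f - translatePoly h f) := rfl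

theorem halfStep_centered_self (r h : Space d) (i : Fin d) :
    halfStep r h (centered r i) = h i / 2 := by
  rw [halfStep_centered]
  push_cast
  ring

theorem evalPt_centered_self (r : Space d) (i : Fin d) : evalPt r (centered r i) = 0 := by
  rw [evalPt_centered, sub_self]
  rfl

theorem halfStep_C (r h : Space d) (a : ℂ) : halfStep r h (C a) = a := by
  rw [← mul_one (C a), ← smul_eq_C_mul, map_smul, halfStep_one, smul_eq_mul, mul_one]

theorem edgeJump_one (r h : Space d) : edgeJump r h 1 = 0 := by
  rw [edgeJump_apply, map_one, sub_self, map_zero]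

theorem edgeJump_centered (r h : Space d) (i : Fin d) : edgeJump r h (centered r i) = h i := by
  rw [edgeJump_apply, translatePoly_centered, sub_sub_cancel, halfStep_C]

/-- The difference has the value -h_i h_l at r, and half its derivative along h is +h_i h_l. -/
theorem edgeJump_centered_mul (r h : Space d) (i l : Fin d) :
    edgeJump r h (centered r i * centered r l) = 0 := by
  rw [edgeJump_apply, map_mul, translatePoly_centered, translatePoly_centered, map_sub,
    halfStep_mul, halfStep_mul]
  simp only [map_sub, halfStep_C, evalPt_C, evalPt_centered_self, halfStep_centered_self]
  ring

/-- The difference has the value h_i h_l h_m at r, and half its derivative along h is -3/2 of this.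
-/
theorem edgeJump_centered_mul_mul (r h : Space d) (i l m : Fin d) :
    edgeJump r h (centered r i * (centered r l * centered r m)) = -(h i * h l * h m) / 2 := by
  rw [edgeJump_apply, map_mul, map_mul, translatePoly_centered, translatePoly_centered,
    translatePoly_centered, map_sub, halfStep_mul, halfStep_mul, halfStep_mul, halfStep_mul]
  simp only [map_sub, evalPt_mul, halfStep_C, evalPt_C, evalPt_centered_self,
    halfStep_centered_self]
  ring

/-- The second-order differential functional defined by the second moments of the mesh edges. -/
def momentFunctional (T : SimplicialMesh d) (j : T.Node) : MvPolynomial (Fin d) ℂ →ₗ[ℂ] ℂ :=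
  ∑ l, ∑ m, ((T.edgeMoment j l m / 2 : ℝ) : ℂ) •
    (evalPt j.1 ∘ₗ (pderiv l).toLinearMap ∘ₗ (pderiv m).toLinearMap)

theorem momentFunctional_apply (j : T.Node) (f : MvPolynomial (Fin d) ℂ) :
    T.momentFunctional j f = ∑ l, ∑ m, ((T.edgeMoment j l m / 2 : ℝ) : ℂ) *
      evalPt j.1 (pderiv l (pderiv m f)) := by
  simp [momentFunctional, LinearMap.sum_apply]

theorem momentFunctional_C (j : T.Node) (a : ℂ) : T.momentFunctional j (C a) = 0 := by
  simp [momentFunctional_apply]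

theorem momentFunctional_centered (j : T.Node) (i : Fin d) :
    T.momentFunctional j (centered j.1 i) = 0 := by
  simp only [momentFunctional_apply, pderiv_centered, pderiv_C, map_zero, mul_zero,
    Finset.sum_const_zero]

theorem momentFunctional_centered_mul (j : T.Node) (i k : Fin d) :
    T.momentFunctional j (centered j.1 i * centered j.1 k) = T.edgeMoment j i k := by
  have h : ∀ l m, evalPt j.1 (pderiv l (pderiv m (centered j.1 i * centered j.1 k))) =
      (if m = i then 1 else 0) * (if l = k then 1 else 0)
        + (if l = i then 1 else 0) * (if m = k then 1 else 0) := fun l m => by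
    simp only [pderiv_mul, map_add, pderiv_centered, evalPt_mul, evalPt_C, pderiv_C,
      zero_mul, mul_zero, zero_add, add_zero]
  rw [momentFunctional_apply]
  simp only [h, mul_add, Finset.sum_add_distrib]
  simp only [mul_ite, mul_one, mul_zero, Finset.sum_ite_eq',
    Finset.mem_univ, if_true]
  simp only [Finset.sum_ite_irrel, Finset.sum_const_zero, Finset.sum_ite_eq', Finset.mem_univ,
    if_true]
  rw [edgeMoment_comm j k i]
  push_cast
  ring

/-- The linear part of f meets the first normal tensor and the cubic part the third. The symmetrized
form of the third tensor is what makes the result depend on ∂_a f alone. -/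
theorem sum_normal_edgeJump (hd : 1 ≤ d) (hT : T.IsTI) (j : T.Node) (a : Fin d)
    {f : MvPolynomial (Fin d) ℂ} (hf : f.totalDegree ≤ 3) :
    ∑ k ∈ T.neighborFinset j, (T.faceNormal j k a : ℂ) * edgeJump j.1 (k.1 - j.1) f =
      2 * (T.cellVolume j : ℂ) * evalPt j.1 (pderiv a f)
        - 1 / 2 * T.momentFunctional j (pderiv a f) := by
  let S : Submodule ℂ (MvPolynomial (Fin d) ℂ) := LinearMap.eqLocus
    (∑ k ∈ T.neighborFinset j, (T.faceNormal j k a : ℂ) • edgeJump j.1 (k.1 - j.1))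
    ((2 * (T.cellVolume j : ℂ)) • (evalPt j.1 ∘ₗ (pderiv a).toLinearMap)
      - (1 / 2 : ℂ) • (T.momentFunctional j ∘ₗ (pderiv a).toLinearMap))
  have hS : ∀ g, g ∈ S ↔
      ∑ k ∈ T.neighborFinset j, (T.faceNormal j k a : ℂ) * edgeJump j.1 (k.1 - j.1) g =
      2 * (T.cellVolume j : ℂ) * evalPt j.1 (pderiv a g)
        - 1 / 2 * T.momentFunctional j (pderiv a g) := fun g => by
    rw [LinearMap.mem_eqLocus, LinearMap.sum_apply]
    rfl
  rw [← hS]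
  refine mem_of_totalDegree_le_three j.1 S ?_ (fun i => ?_) (fun i l => ?_) (fun i l m => ?_) hf
  · rw [hS]
    simp [edgeJump_one]
  · rw [hS]
    simp only [edgeJump_centered, pderiv_centered, evalPt_C, momentFunctional_C]
    have h := congrArg (fun x : ℝ => (x : ℂ)) (sum_normal_edge hd hT j a i)
    simp only [Complex.ofReal_sum, Complex.ofReal_mul, PiLp.sub_apply] at h ⊢
    rw [h]
    split_ifs <;> simp
  · rw [hS]
    simp only [edgeJump_centered_mul, mul_zero, Finset.sum_const_zero, pderiv_mul, map_add,
      pderiv_centered, evalPt_centered_self, ← smul_eq_C_mul, mul_comm _ (C _),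
      map_smul, momentFunctional_centered, smul_zero, add_zero, sub_zero]
  · rw [hS]
    have h := congrArg (fun x : ℝ => (x : ℂ)) (sum_normal_edge_cube hd hT j a i l m)
    have hp : pderiv a (centered j.1 i * (centered j.1 l * centered j.1 m)) =
        (if a = i then (1 : ℂ) else 0) • (centered j.1 l * centered j.1 m)
        + (if a = l then (1 : ℂ) else 0) • (centered j.1 i * centered j.1 m)
        + (if a = m then (1 : ℂ) else 0) • (centered j.1 i * centered j.1 l) := by
      simp only [pderiv_mul, pderiv_centered, smul_eq_C_mul]
      ring
    rw [hp]
    simp only [edgeJump_centered_mul_mul, map_add, map_smul, evalPt_mul, evalPt_centered_self,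
      momentFunctional_centered_mul, smul_eq_mul, mul_zero, add_zero, zero_sub]
    have h2 : ∀ k ∈ T.neighborFinset j, (T.faceNormal j k a : ℂ) *
        (-(((k.1 - j.1) i : ℝ) * ((k.1 - j.1) l : ℝ) * ((k.1 - j.1) m : ℝ) : ℂ) / 2) =
        -(1 / 2) * ((T.faceNormal j k a *
          ((k.1 i - j.1 i) * (k.1 l - j.1 l) * (k.1 m - j.1 m)) : ℝ) : ℂ) := fun k _ => by
      simp only [PiLp.sub_apply]
      push_cast
      ring
    rw [Finset.sum_congr rfl h2, ← Finset.mul_sum, ← Complex.ofReal_sum, h]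
    split_ifs <;> (push_cast; ring)

/-! ### Summation of invariant antisymmetric fluxes -/

theorem neighbors_symm (hd : 1 ≤ d) {j k : T.Node} (h : k ∈ T.neighbors j) :
    j ∈ T.neighbors k := by
  obtain ⟨h1, e, he, hk⟩ := (mem_neighbors_iff hd).1 h
  have he := mem_star.1 he
  exact (mem_neighbors_iff hd).2 ⟨h1.symm, e, mem_star.2 ⟨he.1, hk⟩, he.2⟩

theorem isTranslation_of_neighbors (hd : 1 ≤ d) (hT : T.IsTI) {j k : T.Node}
    (h : k ∈ T.neighbors j) : T.IsTranslation (j.1 - k.1) := by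
  obtain ⟨-, e, he, hk⟩ := (mem_neighbors_iff hd).1 h
  have he := mem_star.1 he
  exact isTranslation_sub hT he.1 hk he.2

theorem mem_neighborFinset {j k : T.Node} : k ∈ T.neighborFinset j ↔ k ∈ T.neighbors j := by
  rw [neighborFinset, Set.Finite.mem_toFinset]

/-- The reflection of `k` with respect to its neighbor `j`. -/
theorem translate_mem_neighbors (hd : 1 ≤ d) {j k : T.Node} (h : k ∈ T.neighbors j)
    (hτ : T.IsTranslation (j.1 - k.1)) : T.translate hτ j ∈ T.neighbors j := by
  obtain ⟨h1, e, he, hk⟩ := (mem_neighbors_iff hd).1 h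
  have he := mem_star.1 he
  refine (mem_neighbors_iff hd).2 ⟨fun h2 => h1 (Subtype.ext ?_), shift e (j.1 - k.1),
    mem_star.2 ⟨shift_mem_elements hτ he.1, ?_⟩, add_mem_shift.2 he.2⟩
  · have h3 : j.1 + (j.1 - k.1) = j.1 := congrArg Subtype.val h2
    rw [add_eq_left, sub_eq_zero] at h3
    exact h3.symm
  · rw [mem_shift, sub_sub_cancel]
    exact hk

/-- Put k' = 2j - k. Translation by j - k' takes the pair (k', j) to (j, k), so F_jk[u] = F_k'j[v
k'] = -F_jk'[v k']. The sum over k is thus also the sum of -F_jk[v k], and the two expressions are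
added. -/
theorem two_smul_sum_flux (hd : 1 ≤ d) (hT : T.IsTI) {X Y : Type*} [AddCommGroup X] [Module ℂ X]
    [AddCommGroup Y] [Module ℂ Y] (F : T.Node → T.Node → (T.Node → X) →ₗ[ℂ] Y)
    (hF : T.FluxInvariant fun j k u => F j k u)
    (hanti : ∀ j k, j ≠ k → ∀ u, F k j u = - F j k u) (j : T.Node) (u : T.Node → X)
    (v : T.Node → T.Node → X)
    (hv : ∀ k ∈ T.neighbors j, ∀ hτ : T.IsTranslation (j.1 - k.1), v k = u ∘ T.translate hτ) :
    (2 : ℂ) • ∑ k ∈ T.neighborFinset j, F j k u = ∑ k ∈ T.neighborFinset j, F j k (u - v k) := by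
  have htr : ∀ k ∈ T.neighborFinset j, T.IsTranslation (j.1 - k.1) := fun k hk =>
    isTranslation_of_neighbors hd hT (mem_neighborFinset.1 hk)
  have hmem : ∀ k (hk : k ∈ T.neighborFinset j),
      T.translate (htr k hk) j ∈ T.neighborFinset j := fun k hk =>
    mem_neighborFinset.2 (translate_mem_neighbors hd (mem_neighborFinset.1 hk) _)
  have hinv : ∀ k (hk : k ∈ T.neighborFinset j),
      T.translate (htr _ (hmem k hk)) j = k := fun k hk => Subtype.ext (by
    change j.1 + (j.1 - (j.1 + (j.1 - k.1))) = k.1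
    abel)
  have h1 : ∑ k ∈ T.neighborFinset j, F j k u = ∑ k ∈ T.neighborFinset j, -F j k (v k) := by
    refine Finset.sum_bij' (fun k hk => T.translate (htr k hk) j)
      (fun k hk => T.translate (htr k hk) j) hmem hmem hinv hinv fun k hk => ?_
    set k' := T.translate (htr k hk) j with hk'
    have hk'm := mem_neighborFinset.1 (hmem k hk)
    have hτ := htr k' (hmem k hk)
    have h2 := hF (j.1 - k'.1) hτ k' j (neighbors_symm hd hk'm) u
    have h3 : T.translate hτ k' = j := Subtype.ext (by
      change k'.1 + (j.1 - k'.1) = j.1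
      abel)
    have h4 : T.translate hτ j = k := hinv k hk
    rw [h3, h4] at h2
    change F j k u = F k' j (u ∘ T.translate hτ) at h2
    rw [h2, ← hv k' hk'm hτ, hanti j k' hk'm.1.symm]
  rw [two_smul]
  conv_lhs => enter [2]; rw [h1]
  rw [← Finset.sum_add_distrib]
  exact Finset.sum_congr rfl fun k _ => by rw [map_sub, sub_eq_add_neg]

/-! ### The two kinds of fluxes -/

theorem sample_apply (f : VecPoly d n) (j : T.Node) (a : Fin n) :
    T.sample f j a = evalPt j.1 (f a) := (evalPt_apply _ _).symm

theorem reconstruction_sample {G : T.Node → Fin d → T.Stencil n}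
    (hG : ∀ i, T.Approximates 2 (fun j => G j i) (VecPoly.partialDeriv i)) {q : VecPoly d n}
    (hq : q.DegLE 2) (j k : T.Node) (a : Fin n) :
    T.reconstruction G j k (T.sample q) a = halfStep j.1 (k.1 - j.1) (q a) := by
  have hGi : ∀ i, T.functional (G j i) (T.sample q) = T.sample (q.partialDeriv i) j :=
    fun i => hG i q hq j
  simp only [reconstruction, LinearMap.add_apply, LinearMap.sum_apply, LinearMap.smul_apply, hGi,
    LinearMap.proj_apply, Pi.add_apply, Finset.sum_apply, Pi.smul_apply, sample_apply, smul_eq_mul,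
    halfStep_apply, PiLp.sub_apply, VecPoly.partialDeriv]

theorem matrixAbs_neg {B : Matrix (Fin n) (Fin n) ℝ} (h : ∃ S Λ, Diagonalizes B S Λ) :
    matrixAbs (-B) = matrixAbs B := by
  obtain ⟨S, Λ, h⟩ := h
  have h' : Diagonalizes (-B) S (fun i => -Λ i) := ⟨h.1, by
    have : Matrix.diagonal (fun i => -Λ i) = -Matrix.diagonal Λ := (Matrix.diagonal_neg Λ).symm
    rw [this, Matrix.mul_neg, Matrix.neg_mul, ← h.2]⟩
  rw [matrixAbs_eq h, matrixAbs_eq h']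
  simp only [abs_neg]

theorem dotMatrix_neg (A : Fin d → Matrix (Fin n) (Fin n) ℝ) (v : Space d) :
    dotMatrix A (-v) = -dotMatrix A v := by
  simp [dotMatrix]

/-- Reversing the normal changes the sign of A·n but not |A·n|, so the two upwind matrices are
interchanged and negated. -/
theorem upwindFlux_comm (hd : 1 ≤ d) {A : Fin d → Matrix (Fin n) (Fin n) ℝ} (hA : IsHyperbolic A)
    (G : T.Node → Fin d → T.Stencil n) (j k : T.Node) (hjk : j ≠ k) (u : T.MeshFun n) :
    T.upwindFlux A G k j u = - T.upwindFlux A G j k u := by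
  simp only [upwindFlux, faceNormal_comm hd j k hjk, dotMatrix_neg, matrixAbs_neg (hA _),
    LinearMap.add_apply, LinearMap.comp_apply, Matrix.mulVecLin_apply]
  set B := dotMatrix A (T.faceNormal j k)
  have h1 : ((1 / 2 : ℝ) • (-B + matrixAbs B)).map Complex.ofReal =
      -((1 / 2 : ℝ) • (B - matrixAbs B)).map Complex.ofReal := by
    ext a b
    simp only [Matrix.map_apply, Matrix.neg_apply, Matrix.smul_apply, Matrix.add_apply,
      Matrix.sub_apply, ← Complex.ofReal_neg]
    congr 1
    simp only [smul_eq_mul]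
    ring
  have h2 : ((1 / 2 : ℝ) • (-B - matrixAbs B)).map Complex.ofReal =
      -((1 / 2 : ℝ) • (B + matrixAbs B)).map Complex.ofReal := by
    ext a b
    simp only [Matrix.map_apply, Matrix.neg_apply, Matrix.smul_apply, Matrix.add_apply,
      Matrix.sub_apply, ← Complex.ofReal_neg]
    congr 1
    simp only [smul_eq_mul]
    ring
  rw [h1, h2, Matrix.neg_mulVec, Matrix.neg_mulVec]
  abel

theorem centralFlux_comm (hd : 1 ≤ d) (G : T.Node → Fin d → T.Stencil n) (j k : T.Node)
    (hjk : j ≠ k) (u : T.Node → Fin d → Fin n → ℂ) :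
    T.centralFlux G k j u = - T.centralFlux G j k u := by
  simp only [centralFlux, faceNormal_comm hd j k hjk, LinearMap.sum_apply, LinearMap.smul_apply,
    LinearMap.comp_apply, ← Finset.sum_neg_distrib]
  refine Finset.sum_congr rfl fun i _ => ?_
  rw [add_comm (T.reconstruction G k j), ← neg_smul]
  congr 1
  simp only [PiLp.neg_apply]
  push_cast
  ring

/-- Both one-sided reconstructions take the same value on quadratics, so the two upwind matrices add
up to A·n_jk and the dissipation disappears. -/
theorem upwindFlux_sample (A : Fin d → Matrix (Fin n) (Fin n) ℝ) {G : T.Node → Fin d → T.Stencil n}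
    (hG : ∀ i, T.Approximates 2 (fun j => G j i) (VecPoly.partialDeriv i)) {q : VecPoly d n}
    (hq : q.DegLE 2) (j k : T.Node) (a : Fin n) :
    T.upwindFlux A G j k (T.sample q) a = ∑ b, ∑ i, (A i a b : ℂ) *
      ((T.faceNormal j k i : ℂ) * halfStep j.1 (k.1 - j.1) (q b)) := by
  have h1 : T.reconstruction G j k (T.sample q) = fun b => halfStep j.1 (k.1 - j.1) (q b) :=
    funext fun b => reconstruction_sample hG hq j k b
  have h2 : T.reconstruction G k j (T.sample q) = fun b => halfStep j.1 (k.1 - j.1) (q b) :=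
    funext fun b => by rw [reconstruction_sample hG hq k j b, halfStep_opposite _ _ (hq b)]
  simp only [upwindFlux, LinearMap.add_apply, LinearMap.comp_apply, Matrix.mulVecLin_apply, h1, h2]
  rw [← Matrix.add_mulVec]
  have h3 : ∀ B C : Matrix (Fin n) (Fin n) ℝ, ((1 / 2 : ℝ) • (B + C)).map Complex.ofReal +
      ((1 / 2 : ℝ) • (B - C)).map Complex.ofReal = B.map Complex.ofReal := fun B C => by
    ext a b
    simp only [Matrix.map_apply, Matrix.smul_apply, Matrix.add_apply, Matrix.sub_apply,
      ← Complex.ofReal_add]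
    congr 1
    simp only [smul_eq_mul]
    ring
  rw [h3, Matrix.mulVec, dotProduct]
  refine Finset.sum_congr rfl fun b _ => ?_
  rw [Matrix.map_apply, dotMatrix, Matrix.sum_apply, Complex.ofReal_sum, Finset.sum_mul]
  refine Finset.sum_congr rfl fun i _ => ?_
  rw [Matrix.smul_apply, smul_eq_mul]
  push_cast
  ring

theorem centralFlux_sample {G : T.Node → Fin d → T.Stencil n}
    (hG : ∀ i, T.Approximates 2 (fun j => G j i) (VecPoly.partialDeriv i)) {q : Fin d → VecPoly d n}
    (hq : ∀ i, (q i).DegLE 2) (j k : T.Node) (a : Fin n) :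
    T.centralFlux G j k (fun l i => T.sample (q i) l) a =
      ∑ i, (T.faceNormal j k i : ℂ) * halfStep j.1 (k.1 - j.1) (q i a) := by
  simp only [centralFlux, LinearMap.sum_apply, LinearMap.smul_apply, LinearMap.comp_apply,
    Finset.sum_apply, Pi.smul_apply, smul_eq_mul, LinearMap.add_apply, Pi.add_apply]
  refine Finset.sum_congr rfl fun i _ => ?_
  have h0 : (LinearMap.pi fun l => LinearMap.proj i ∘ₗ LinearMap.proj l :
      (T.Node → Fin d → Fin n → ℂ) →ₗ[ℂ] T.MeshFun n) (fun l i => T.sample (q i) l) =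
      T.sample (q i) := rfl
  rw [h0, reconstruction_sample hG (hq i), reconstruction_sample hG (hq i),
    ← halfStep_opposite _ _ (hq i a)]
  push_cast
  ring

/-- The polynomial `x ↦ f (x) - f (x - h)`. -/
def increment (h : Space d) (f : VecPoly d n) : VecPoly d n := fun a => f a - translatePoly h (f a)

theorem increment_degLE (h : Space d) {f : VecPoly d n} (hf : f.DegLE 3) :
    (increment h f).DegLE 2 := fun a => totalDegree_sub_translatePoly h (hf a)

theorem sample_sub_comp (f : VecPoly d n) {j k : T.Node} (l : T.Node)
    (hτ : T.IsTranslation (j.1 - k.1)) :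
    T.sample f l - T.sample f (T.translate hτ l) = T.sample (increment (k.1 - j.1) f) l := by
  ext a
  rw [Pi.sub_apply, sample_apply, sample_apply, sample_apply, increment, map_sub,
    evalPt_translatePoly]
  congr 3
  change l.1 + (j.1 - k.1) = l.1 - (k.1 - j.1)
  abel

theorem sum_upwindFlux (hd : 1 ≤ d) (hT : T.IsTI) {A : Fin d → Matrix (Fin n) (Fin n) ℝ}
    (hA : IsHyperbolic A) {G : T.Node → Fin d → T.Stencil n}
    (hG : ∀ i, T.Approximates 2 (fun j => G j i) (VecPoly.partialDeriv i))
    (hF : T.FluxInvariant fun j k u => T.upwindFlux A G j k u) {f : VecPoly d n} (hf : f.DegLE 3)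
    (j : T.Node) (a : Fin n) :
    2 * (∑ k ∈ T.neighborFinset j, T.upwindFlux A G j k (T.sample f)) a =
      2 * (T.cellVolume j : ℂ) * evalPt j.1 (f.advect A a)
        - 1 / 2 * T.momentFunctional j (f.advect A a) := by
  -- The translated sample is written as f minus its increment, so that each flux acts on the
  -- quadratic increment only.
  have h1 := two_smul_sum_flux hd hT (T.upwindFlux A G) hF (upwindFlux_comm hd hA G) j (T.sample f)
    (fun k => T.sample f - T.sample (increment (k.1 - j.1) f)) (fun k _ hτ => by
      ext1 l
      rw [Pi.sub_apply, ← sample_sub_comp f l hτ, sub_sub_cancel]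
      rfl)
  simp only [sub_sub_cancel] at h1
  have h2 := congrFun h1 a
  rw [Pi.smul_apply, smul_eq_mul] at h2
  rw [h2, Finset.sum_apply]
  simp only [upwindFlux_sample A hG (increment_degLE _ hf)]
  have h3 : f.advect A a = ∑ b, ∑ i, (A i a b : ℂ) • pderiv i (f b) := by
    rw [VecPoly.advect, Finset.sum_comm]
    simp only [smul_eq_C_mul, VecPoly.partialDeriv]
  rw [Finset.sum_comm, h3]
  simp only [map_sum, map_smul, Finset.mul_sum, ← Finset.sum_sub_distrib]
  refine Finset.sum_congr rfl fun b _ => ?_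
  rw [Finset.sum_comm]
  refine Finset.sum_congr rfl fun i _ => ?_
  rw [← Finset.mul_sum]
  have := sum_normal_edgeJump hd hT j i (hf b)
  simp only [edgeJump_apply] at this
  simp only [increment]
  rw [this]
  simp only [smul_eq_mul]
  ring

theorem sum_centralFlux (hd : 1 ≤ d) (hT : T.IsTI) {G : T.Node → Fin d → T.Stencil n}
    (hG : ∀ i, T.Approximates 2 (fun j => G j i) (VecPoly.partialDeriv i))
    (hF : T.FluxInvariant fun j k u => T.centralFlux G j k u) {w : Fin d → VecPoly d n}
    (hw : ∀ i, (w i).DegLE 3) (j : T.Node) (a : Fin n) :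
    2 * (∑ k ∈ T.neighborFinset j, T.centralFlux G j k (fun l i => T.sample (w i) l)) a =
      2 * (T.cellVolume j : ℂ) * evalPt j.1 (∑ i, pderiv i (w i a))
        - 1 / 2 * T.momentFunctional j (∑ i, pderiv i (w i a)) := by
  have h1 := two_smul_sum_flux hd hT (T.centralFlux G) hF (centralFlux_comm hd G) j
    (fun l i => T.sample (w i) l)
    (fun k => (fun l i => T.sample (w i) l) - fun l i => T.sample (increment (k.1 - j.1) (w i)) l)
    (fun k _ hτ => by
      ext1 l
      ext1 i
      rw [Pi.sub_apply, Pi.sub_apply, ← sample_sub_comp (w i) l hτ, sub_sub_cancel]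
      rfl)
  simp only [sub_sub_cancel] at h1
  have h2 := congrFun h1 a
  rw [Pi.smul_apply, smul_eq_mul] at h2
  rw [h2, Finset.sum_apply]
  have h3 : ∀ k, T.centralFlux G j k
      (fun l i => T.sample (increment (k.1 - j.1) (w i)) l) a =
      ∑ i, (T.faceNormal j k i : ℂ) * halfStep j.1 (k.1 - j.1) (increment (k.1 - j.1) (w i) a) :=
    fun k => centralFlux_sample hG (q := fun i => increment (k.1 - j.1) (w i))
      (fun i => increment_degLE _ (hw i)) j k a
  simp only [h3]
  rw [Finset.sum_comm]
  simp only [map_sum, Finset.mul_sum, ← Finset.sum_sub_distrib]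
  refine Finset.sum_congr rfl fun i _ => ?_
  have := sum_normal_edgeJump hd hT j i (hw i a)
  simp only [edgeJump_apply] at this
  simp only [increment]
  exact this

end SimplicialMesh

/-! ### The mass operators -/

namespace SimplicialMesh

open MvPolynomial

variable {d n : ℕ} {T : SimplicialMesh d}

theorem advect_degLE (A : Fin d → Matrix (Fin n) (Fin n) ℝ) {f : VecPoly d n} {p : ℕ}
    (hf : f.DegLE (p + 1)) : (f.advect A).DegLE p := by
  intro a
  refine totalDegree_finsetSum_le fun i _ => totalDegree_finsetSum_le fun b _ => ?_
  refine (totalDegree_mul _ _).trans ?_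
  rw [totalDegree_C, zero_add]
  exact totalDegree_pderiv_le i (hf b)

theorem edgeVolume_eq (j k : T.Node) :
    T.edgeVolume j k = 1 / (2 * d) * ∑ a, T.faceNormal j k a * (k.1 a - j.1 a) := by
  rw [edgeVolume, PiLp.inner_apply]
  rfl

theorem sum_edgeVolume (hd : 1 ≤ d) (hT : T.IsTI) (j : T.Node) :
    ∑ k ∈ T.neighborFinset j, T.edgeVolume j k = T.cellVolume j := by
  have hd0 : (d : ℝ) ≠ 0 := by positivity
  simp only [edgeVolume_eq]
  rw [← Finset.mul_sum, Finset.sum_comm]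
  simp only [sum_normal_edge hd hT, if_true, Finset.sum_const, Finset.card_univ, Fintype.card_fin,
    nsmul_eq_mul]
  field_simp

/-- Contracting the cubic tensor over a = i gives d M_lm + M_lm + M_lm, which explains d + 2; the
factor 1/(2d) comes from v_jk. -/
theorem sum_edgeVolume_mul (hd : 1 ≤ d) (hT : T.IsTI) (j : T.Node) (l m : Fin d) :
    ∑ k ∈ T.neighborFinset j, T.edgeVolume j k * ((k.1 l - j.1 l) * (k.1 m - j.1 m)) =
      (d + 2) / (2 * d) * T.edgeMoment j l m := by
  have hd0 : (d : ℝ) ≠ 0 := by positivity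
  have h1 : ∀ k ∈ T.neighborFinset j,
      T.edgeVolume j k * ((k.1 l - j.1 l) * (k.1 m - j.1 m)) =
      1 / (2 * d) * ∑ a, T.faceNormal j k a *
        ((k.1 a - j.1 a) * (k.1 l - j.1 l) * (k.1 m - j.1 m)) := fun k _ => by
    rw [edgeVolume_eq, mul_assoc, Finset.sum_mul]
    congr 1
    exact Finset.sum_congr rfl fun a _ => by ring
  rw [Finset.sum_congr rfl h1, ← Finset.mul_sum, Finset.sum_comm]
  simp only [sum_normal_edge_cube hd hT, if_true, Finset.sum_add_distrib, ite_mul, one_mul,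
    zero_mul, Finset.sum_ite_eq', Finset.mem_univ, Finset.sum_const, Finset.card_univ,
    Fintype.card_fin, nsmul_eq_mul]
  rw [edgeMoment_comm j m l]
  field_simp
  ring

theorem evalPt_secondDeriv (x v : Space d) (p : VecPoly d n) (a : Fin n) :
    evalPt x (p.secondDeriv v a) =
      ∑ i, ∑ l, ((v i * v l : ℝ) : ℂ) * evalPt x (pderiv i (pderiv l (p a))) := by
  simp only [VecPoly.secondDeriv, map_sum, evalPt_C_mul, VecPoly.partialDeriv]

/-- The coefficient d/(4(d+2)) is tuned to the contraction factor (d+2)/(2d): their product 1/8 is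
1/4 times the 1/2 inside `momentFunctional`, the same correction as in the flux divergence. -/
theorem sum_extendedGalerkin (hd : 1 ≤ d) (hT : T.IsTI) {s : T.Node → T.Node → T.Stencil n}
    (hs : T.IsExtendedGalerkin s) {p : VecPoly d n} (hp : p.DegLE 2) (j : T.Node) (a : Fin n) :
    (∑ k ∈ T.neighborFinset j, (T.edgeVolume j k : ℂ) • T.functional (s j k) (T.sample p)) a =
      (T.cellVolume j : ℂ) * evalPt j.1 (p a) - 1 / 4 * T.momentFunctional j (p a) := by
  have hd0 : (d : ℂ) ≠ 0 := by
    have : d ≠ 0 := by omega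
    exact_mod_cast this
  have hd2 : (d : ℂ) + 2 ≠ 0 := by exact_mod_cast (by omega : d + 2 ≠ 0)
  have h1 : ∀ k ∈ T.neighborFinset j,
      ((T.edgeVolume j k : ℂ) • T.functional (s j k) (T.sample p)) a =
      (T.edgeVolume j k : ℂ) * evalPt j.1 (p a) - ((d / (4 * (d + 2)) : ℝ) : ℂ) *
        ∑ i, ∑ l, ((T.edgeVolume j k * ((k.1 i - j.1 i) * (k.1 l - j.1 l)) : ℝ) : ℂ) *
          evalPt j.1 (pderiv i (pderiv l (p a))) := fun k hk => by
    rw [hs j k (mem_neighborFinset.1 hk) p hp, Pi.smul_apply, Pi.sub_apply, Pi.smul_apply,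
      VecPoly.evalAt, VecPoly.evalAt, ← evalPt_apply, ← evalPt_apply, evalPt_secondDeriv,
      smul_eq_mul, smul_eq_mul, mul_sub, mul_left_comm]
    congr 2
    simp only [Finset.mul_sum]
    refine Finset.sum_congr rfl fun i _ => Finset.sum_congr rfl fun l _ => ?_
    rw [← mul_assoc, ← Complex.ofReal_mul]
    rfl
  rw [Finset.sum_apply, Finset.sum_congr rfl h1, Finset.sum_sub_distrib, ← Finset.sum_mul,
    ← Complex.ofReal_sum, sum_edgeVolume hd hT, ← Finset.mul_sum, Finset.sum_comm]
  congr 1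
  rw [momentFunctional_apply, Finset.mul_sum, Finset.mul_sum]
  refine Finset.sum_congr rfl fun i _ => ?_
  rw [Finset.sum_comm, Finset.mul_sum, Finset.mul_sum]
  refine Finset.sum_congr rfl fun l _ => ?_
  rw [← Finset.sum_mul, ← Complex.ofReal_sum, sum_edgeVolume_mul hd hT]
  push_cast
  field_simp

/-- The polynomials whose nodal values are the components of the auxiliary vector field. -/
def auxPoly (r : Space d) (p : VecPoly d n) (i : Fin d) : VecPoly d n := fun a =>
  C ((d : ℂ)⁻¹) * (centered r i * p a - C (1 / 2) * centered r i ^ 2 * pderiv i (p a)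
    + C (1 / 6) * centered r i ^ 3 * pderiv i (pderiv i (p a)))

theorem auxField_sample {D₁ D₂ : T.Node → Fin d → T.Stencil n}
    (h₁ : ∀ i, T.Approximates 2 (fun l => D₁ l i) (VecPoly.partialDeriv i))
    (h₂ : ∀ i, T.Approximates 2 (fun l => D₂ l i) (fun f => (f.partialDeriv i).partialDeriv i))
    {p : VecPoly d n} (hp : p.DegLE 2) (j : T.Node) :
    T.auxField D₁ D₂ j (T.sample p) = fun l i => T.sample (auxPoly j.1 p i) l := by
  ext l i a
  have e₁ : T.functional (D₁ l i) (T.sample p) = T.sample (p.partialDeriv i) l := h₁ i p hp l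
  have e₂ : T.functional (D₂ l i) (T.sample p) =
    T.sample ((p.partialDeriv i).partialDeriv i) l := h₂ i p hp l
  simp only [auxField, LinearMap.pi_apply, LinearMap.add_apply, LinearMap.sub_apply,
    LinearMap.smul_apply, LinearMap.proj_apply, e₁, e₂, Pi.add_apply, Pi.sub_apply, Pi.smul_apply,
    smul_eq_mul, sample_apply, auxPoly, evalPt_mul, evalPt_C, map_add, map_sub, pow_succ, pow_zero,
    one_mul, evalPt_centered, VecPoly.partialDeriv]
  push_cast
  field_simp

theorem auxPoly_degLE (r : Space d) {p : VecPoly d n} (hp : p.DegLE 2) (i : Fin d) :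
    (auxPoly r p i).DegLE 3 := by
  intro a
  have h1 := totalDegree_centered r i
  have h2 : ∀ m, (centered r i ^ m).totalDegree ≤ m := fun m =>
    (totalDegree_pow _ _).trans (by nlinarith)
  have h3 := totalDegree_pderiv_le i (p := 1) (hp a)
  have h4 := totalDegree_pderiv_le i (p := 0) h3
  have hC : ∀ (c : ℂ) (g : MvPolynomial (Fin d) ℂ), (C c * g).totalDegree ≤ g.totalDegree :=
    fun c g => (totalDegree_mul _ _).trans (by rw [totalDegree_C, zero_add])
  refine (hC _ _).trans ((totalDegree_add _ _).trans (max_le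
    ((totalDegree_sub _ _).trans (max_le ?_ ?_)) ?_))
  · exact (totalDegree_mul _ _).trans (add_le_add h1 (hp a))
  · exact (totalDegree_mul _ _).trans (add_le_add ((hC _ _).trans (h2 2)) h3)
  · exact (totalDegree_mul _ _).trans (add_le_add ((hC _ _).trans (h2 3)) h4)

/-- With y the centred coordinate, ∂(y p - y²/2 ∂p + y³/6 ∂²p) telescopes to p + y³/6 ∂³p, and ∂³p =
0 for quadratic p. Each of the d directions thus contributes p/d. -/
theorem sum_pderiv_auxPoly (hd : 1 ≤ d) (r : Space d) {p : VecPoly d n} (hp : p.DegLE 2)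
    (a : Fin n) : ∑ i, pderiv i (auxPoly r p i a) = p a := by
  have h1 : ∀ i, pderiv i (auxPoly r p i a) = C ((d : ℂ)⁻¹) * p a := fun i => by
    have h3 := totalDegree_pderiv_le i (p := 1) (hp a)
    have h4 := pderiv_eq_zero_of_totalDegree i (totalDegree_pderiv_le i (p := 0) h3)
    have c2 : (C (1 / 2) : MvPolynomial (Fin d) ℂ) * 2 = 1 := by
      rw [← map_ofNat C 2, ← C_mul]
      norm_num
    have c6 : (C (1 / 6) : MvPolynomial (Fin d) ℂ) * 3 = C (1 / 2) := by
      rw [← map_ofNat C 3, ← C_mul]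
      norm_num
    simp only [auxPoly, map_add, map_sub, pderiv_mul, pderiv_pow, pderiv_C,
      pderiv_centered, h4, if_true, C_1]
    push_cast
    linear_combination (-C ((d : ℂ)⁻¹) * centered r i * pderiv i (p a)) * c2
      + (C ((d : ℂ)⁻¹) * centered r i ^ 2 * pderiv i (pderiv i (p a))) * c6
  have hd0 : (d : ℂ) ≠ 0 := by
    have : d ≠ 0 := by omega
    exact_mod_cast this
  simp only [h1, Finset.sum_const, Finset.card_univ, Fintype.card_fin, nsmul_eq_mul]
  rw [← mul_assoc, ← map_natCast C d, ← C_mul, mul_inv_cancel₀ hd0, C_1, one_mul]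

/-- The truncation error of the flux divergence. -/
theorem fluxDivergence_sample (hd : 1 ≤ d) (hT : T.IsTI)
    {A : Fin d → Matrix (Fin n) (Fin n) ℝ} (hA : IsHyperbolic A)
    {G : T.Node → Fin d → T.Stencil n}
    (hG : ∀ i, T.Approximates 2 (fun j => G j i) (VecPoly.partialDeriv i))
    (hF : T.FluxInvariant fun j k u => T.upwindFlux A G j k u) {f : VecPoly d n} (hf : f.DegLE 3)
    (j : T.Node) (a : Fin n) :
    T.fluxDivergence A G j (T.sample f) a = ((T.cellVolume j : ℂ))⁻¹ *
      ((T.cellVolume j : ℂ) * evalPt j.1 (f.advect A a)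
        - 1 / 4 * T.momentFunctional j (f.advect A a)) := by
  have h := sum_upwindFlux hd hT hA hG hF hf j a
  -- The factor |K_j|⁻¹ stays uncancelled: the mass operators produce the same bracket with the same
  -- factor.
  rw [fluxDivergence, LinearMap.smul_apply, Pi.smul_apply, smul_eq_mul, LinearMap.sum_apply]
  congr 1
  linear_combination (1 / 2 : ℂ) * h

/-! ### Exactness of the three schemes -/

theorem extendedGalerkinFC_isExact (hd : 1 ≤ d) (hT : T.IsTI)
    {A : Fin d → Matrix (Fin n) (Fin n) ℝ} (hA : IsHyperbolic A)
    {G : T.Node → Fin d → T.Stencil n}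
    (hG : ∀ i, T.Approximates 2 (fun j => G j i) (VecPoly.partialDeriv i))
    (hF : T.FluxInvariant fun j k u => T.upwindFlux A G j k u)
    {s : T.Node → T.Node → T.Stencil n} (hs : T.IsExtendedGalerkin s) :
    (T.extendedGalerkinFC A G s).IsExact A 3 := by
  intro f hf j
  ext a
  have h := sum_extendedGalerkin hd hT hs (advect_degLE A (p := 2) hf) j a
  simp only [Scheme.truncationError, extendedGalerkinFC, Pi.add_apply, Pi.neg_apply,
    fluxDivergence_sample hd hT hA hG hF hf, LinearMap.smul_apply, LinearMap.sum_apply,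
    Pi.smul_apply, smul_eq_mul, h, Pi.zero_apply]
  ring

/-- The mass operator is itself a flux divergence, so it carries the same moment correction,
evaluated on the divergence of the auxiliary field. That divergence is A·∇f, and the two corrections
cancel. -/
theorem divergenceFC_isExact (hd : 1 ≤ d) (hT : T.IsTI)
    {A : Fin d → Matrix (Fin n) (Fin n) ℝ} (hA : IsHyperbolic A)
    {G D₁ D₂ : T.Node → Fin d → T.Stencil n}
    (hG : ∀ i, T.Approximates 2 (fun j => G j i) (VecPoly.partialDeriv i))
    (hF : T.FluxInvariant fun j k u => T.upwindFlux A G j k u)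
    (h₁ : ∀ i, T.Approximates 2 (fun l => D₁ l i) (VecPoly.partialDeriv i))
    (h₂ : ∀ i, T.Approximates 2 (fun l => D₂ l i) (fun f => (f.partialDeriv i).partialDeriv i))
    (hC : T.FluxInvariant fun j k u => T.centralFlux G j k u) :
    (T.divergenceFC A G D₁ D₂).IsExact A 3 := by
  intro f hf j
  ext a
  have hp := advect_degLE A (p := 2) hf
  have h := sum_centralFlux hd hT hG hC (auxPoly_degLE j.1 hp) j a
  rw [sum_pderiv_auxPoly hd j.1 hp] at h
  simp only [Scheme.truncationError, divergenceFC, Pi.add_apply, Pi.neg_apply,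
    fluxDivergence_sample hd hT hA hG hF hf, LinearMap.smul_apply, LinearMap.comp_apply,
    LinearMap.sum_apply, auxField_sample h₁ h₂ hp, Pi.smul_apply, smul_eq_mul, Pi.zero_apply]
  linear_combination (-(1 / 2 : ℂ) * (T.cellVolume j : ℂ)⁻¹) * h

/-- On cubics the flux divergence, with its correction, depends on f only through A·∇f. -/
theorem steadyFC_truncationError (hd : 1 ≤ d) (hT : T.IsTI)
    {A : Fin d → Matrix (Fin n) (Fin n) ℝ} (hA : IsHyperbolic A)
    {G : T.Node → Fin d → T.Stencil n}
    (hG : ∀ i, T.Approximates 2 (fun j => G j i) (VecPoly.partialDeriv i))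
    (hF : T.FluxInvariant fun j k u => T.upwindFlux A G j k u) {f : VecPoly d n} (hf : f.DegLE 3)
    (hf0 : f.advect A = 0) (j : T.Node) : (T.steadyFC A G).truncationError A f j = 0 := by
  ext a
  simp [Scheme.truncationError, steadyFC, fluxDivergence_sample hd hT hA hG hF hf, hf0,
    sample_apply]

end SimplicialMesh

end FluxCorrection

end

theorem mainTheorem4 (d : ℕ) (hd : 1 ≤ d) (T : FluxCorrection.SimplicialMesh d) (hT : T.IsTI)
    (n : ℕ) (A : Fin d → Matrix (Fin n) (Fin n) ℝ) (hA : FluxCorrection.IsHyperbolic A)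
    (G : T.Node → Fin d → T.Stencil n)
    (hG : ∀ i, T.Approximates 2 (fun j => G j i) (FluxCorrection.VecPoly.partialDeriv i))
    (hF : T.FluxInvariant fun j k u => T.upwindFlux A G j k u) :
    (∀ s : T.Node → T.Node → T.Stencil n, T.IsExtendedGalerkin s →
      (T.extendedGalerkinFC A G s).IsExact A 3) ∧
    (∀ D₁ D₂ : T.Node → Fin d → T.Stencil n,
      (∀ i, T.Approximates 2 (fun l => D₁ l i) (FluxCorrection.VecPoly.partialDeriv i)) →
      (∀ i, T.Approximates 2 (fun l => D₂ l i)
        (fun f => (f.partialDeriv i).partialDeriv i)) →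
      (T.FluxInvariant fun j k u => T.centralFlux G j k u) →
      (T.divergenceFC A G D₁ D₂).IsExact A 3) ∧
    (∀ f : FluxCorrection.VecPoly d n, f.DegLE 3 → f.advect A = 0 →
      ∀ j, (T.steadyFC A G).truncationError A f j = 0) := by
  open FluxCorrection.SimplicialMesh in
  exact ⟨fun _ hs => extendedGalerkinFC_isExact hd hT hA hG hF hs,
    fun _ _ h₁ h₂ hC => divergenceFC_isExact hd hT hA hG hF h₁ h₂ hC,
    fun _ hf hf0 j => steadyFC_truncationError hd hT hA hG hF hf hf0 j⟩
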